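/- **Definitions.** Let $p$ be a prime. A finitely generated group $G$ is *RFR$p$* (residually finite rationally $p$) if there are subgroups $G=G_1\ge G_2\ge\cdots$ with $G_{i+1}$ normal in $G_i$, $\bigcap_i G_i=\{1\}$, each $G_i/G_{i+1}$ an elementary abelian $p$-group, and $\ker\big(G_i\to H_1(G_i,\mathbb Q)\big)\le G_{i+1}$ for all $i$. The *standard RFR$p$ filtration* of a group $G$ is $K_1=G$, $K_{i+1}=\ker\big(K_i\to \mathrm{TF}\,H_1(K_i,\mathbb Z)\to \mathrm{TF}\,H_1(K_i,\mathbb Z)\otimes\mathbb Z/p\big)$, where $\mathrm{TF}\,A$ is the quotient of an abelian group $A$ by its torsion subgroup. The *RFR$p$ topology* on $G$ has the cosets of the $K_i$ as a basis. For a homomorphism $f\colon H\to G$, the RFR$p$ topology on $G$ *induces* (or restricts to) the RFR$p$ topology on $H$ if the latter is the topology induced through $f$ by the former. Let $\Gamma$ be a finite graph with vertex set $V$ and edge set $E$, each edge $e$ being oriented arbitrarily from $s(e)$ to $t(e)$; loops and multiple edges are allowed. A *graph of groups* $\mathcal G$ over $\Gamma$ consists of groups $G_v$ ($v\in V$), $G_e$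 ($e\in E$) and homomorphisms $\phi_{e,s}\colon G_e\to G_{s(e)}$, $\phi_{e,t}\colon G_e\to G_{t(e)}$, not necessarily injective. Let $F(\mathcal G)$ be the group generated by all $G_v$ and letters $t_e$ ($e\in E$), subject to the relations of the $G_v$ and $t_e\,\phi_{e,t}(a)\,t_e^{-1}=\phi_{e,s}(a)$ for $e\in E$, $a\in G_e$. Its fundamental group $\pi_1(\mathcal G,v)$ is the subgroup of $F(\mathcal G)$ of the elements represented by words $g_0\,\tau_1\,g_1\cdots \tau_n\, g_n$ along closed edge paths at $v$ (each $\tau_j$ is $t_e$ or $t_e^{-1}$, and each $g_j$ lies in the group of the vertex reached); it receives a canonical homomorphism from $G_v$. A *graph of spaces* over $\Gamma$ consists of spaces $X_v$, $X_e$ and continuous maps $\phi_{e,s}\colon X_e\to X_{s(e)}$, $\phi_{e,t}\colon X_e\to X_{t(e)}$, not necessarily $\pi_1$-injective. Its total space $X$ is the quotient of $\bigsqcup_v X_v\sqcup\bigsqcup_e X_e\times[0,1]$ obtained by identifying $(y,0)\in X_e\times[0,1]$ with $\phi_{e,s}(y)$ and $(y,1)$ with $\phi_{e,t}(y)$. **Theorem.**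 Fix a prime $p$ and a finite graph $\Gamma$ as above. (A) Let $\mathcal G$ be a graph of finitely generated groups over $\Gamma$ such that 1. every $G_v$ is RFR$p$; 2. for every $v$, the RFR$p$ topology on $\pi_1(\mathcal G,v)$ induces the RFR$p$ topology on $G_v$; 3. for every edge $e$, the images $\phi_{e,s}(G_e)\le G_{s(e)}$ and $\phi_{e,t}(G_e)\le G_{t(e)}$ are closed in the RFR$p$ topologies on $G_{s(e)}$ and $G_{t(e)}$. Then $\pi_1(\mathcal G,v)$ is RFR$p$ for every vertex $v$. (B) Let $X$ be the total space of a graph of spaces over $\Gamma$ whose vertex spaces $X_v$ and edge spaces $X_e$ are connected finite CW complexes, such that 1. every $\pi_1(X_v)$ is RFR$p$; 2. for every $v$, the RFR$p$ topology on $\pi_1(X)$ induces the RFR$p$ topology on $\pi_1(X_v)$ through the homomorphism given by $X_v\to X$, with base points in $X_v$; 3. for every edge $e$, the images of $\pi_1(X_e)$ in $\pi_1(X_{s(e)})$ and $\pi_1(X_{t(e)})$ under $\phi_{e,s}$ and $\phi_{e,t}$ are closed in the RFR$p$ topologies on these groups. Then $\pi_1(X,x)$ is RFR$p$ for every $x\in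 X$. -/

import Mathlib

open scoped TensorProduct unitInterval commutatorElement

universe u v w x

/-! ### RFRp groups, the standard filtration and the RFRp topology -/

/-- `TF H₁(G, ℤ)`: the abelianization of `G` modulo its torsion subgroup. -/
abbrev TFAb (G : Type u) [Group G] : Type u :=
  Abelianization G ⧸ CommGroup.torsion (Abelianization G)

/-- The canonical homomorphism `G → H₁(G, ℚ)`, with `H₁(G, ℚ) = ℚ ⊗ Gᵃᵇ`. -/
noncomputable def toRationalH1 (G : Type u) [Group G] :
    G →* Multiplicative (ℚ ⊗[ℤ] Additive (Abelianization G)) :=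
  MonoidHom.mk' (fun g => Multiplicative.ofAdd ((1 : ℚ) ⊗ₜ[ℤ] Additive.ofMul (Abelianization.of g)))
    (fun a b => by rw [map_mul, ofMul_mul, TensorProduct.tmul_add, ofAdd_add])

/-- The canonical homomorphism `G → TF H₁(G, ℤ) → (ℤ/p) ⊗ TF H₁(G, ℤ)`. -/
noncomputable def toTFModP (p : ℕ) (G : Type u) [Group G] :
    G →* Multiplicative (ZMod p ⊗[ℤ] Additive (TFAb G)) :=
  MonoidHom.mk'
    (fun g => Multiplicative.ofAdd
      ((1 : ZMod p) ⊗ₜ[ℤ] Additive.ofMul (QuotientGroup.mk (Abelianization.of g) : TFAb G)))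
    (fun a b => by
      rw [map_mul, QuotientGroup.mk_mul, ofMul_mul, TensorProduct.tmul_add, ofAdd_add])

/-- `K 0, K 1, K 2, …` is a sequence of subgroups witnessing that `G` is RFRp. -/
structure IsRFRpSequence (p : ℕ) {G : Type u} [Group G] (K : ℕ → Subgroup G) : Prop where
  zero_eq : K 0 = ⊤
  le : ∀ i, K (i + 1) ≤ K i
  normal : ∀ i, ((K (i + 1)).subgroupOf (K i)).Normal
  iInf_eq : ⨅ i, K i = ⊥
  /-- the quotient `K i / K (i+1)` is abelian -/
  commutator_mem : ∀ i, ∀ a ∈ K i, ∀ b ∈ K i, ⁅a, b⁆ ∈ K (i + 1)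
  /-- the quotient `K i / K (i+1)` has exponent dividing `p` -/
  pow_mem : ∀ i, ∀ a ∈ K i, a ^ p ∈ K (i + 1)
  /-- the kernel of `K i → H₁(K i, ℚ)` is contained in `K (i+1)` -/
  ker_le : ∀ i, (toRationalH1 (K i)).ker ≤ (K (i + 1)).subgroupOf (K i)

/-- A group is residually finite rationally `p` if it is finitely generated and has a witnessing
sequence of subgroups. -/
def IsRFRp (p : ℕ) (G : Type u) [Group G] : Prop :=
  Group.FG G ∧ ∃ K : ℕ → Subgroup G, IsRFRpSequence p K

/-- The standard RFRp filtration: `K 0 = G` and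
`K (i+1) = ker (K i → TF H₁(K i, ℤ) → (ℤ/p) ⊗ TF H₁(K i, ℤ))`. -/
noncomputable def rfrpFiltration (p : ℕ) (G : Type u) [Group G] : ℕ → Subgroup G
  | 0 => ⊤
  | i + 1 => (toTFModP p (rfrpFiltration p G i)).ker.map (rfrpFiltration p G i).subtype

/-- The RFRp topology: the topology with the cosets of the terms of the standard RFRp filtration
as a basis. -/
abbrev rfrpTopology (p : ℕ) (G : Type u) [Group G] : TopologicalSpace G :=
  TopologicalSpace.generateFrom
    {U | ∃ (g : G) (i : ℕ), U = {h | g⁻¹ * h ∈ rfrpFiltration p G i}}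

/-- For a homomorphism `f : H → G`, the RFRp topology on `G` induces (through `f`) the RFRp
topology on `H`. -/
def InducesRFRpTopology (p : ℕ) {H : Type u} {G : Type v} [Group H] [Group G] (f : H →* G) : Prop :=
  (rfrpTopology p G).induced f = rfrpTopology p H

/-- The subgroup `H` is closed in the RFRp topology on `G`. -/
def IsRFRpClosed (p : ℕ) {G : Type u} [Group G] (H : Subgroup G) : Prop :=
  @IsClosed G (rfrpTopology p G) (H : Set G)

/-! ### Graphs of groups -/

/-- A graph of groups over the graph with vertex set `V` and (arbitrarily oriented) edge set `E`.
Loops and multiple edges are allowed, and the edge homomorphisms need not be injective. -/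
structure GraphOfGroups (V : Type u) (E : Type v) where
  src : E → V
  tgt : E → V
  vertexGroup : V → Type w
  edgeGroup : E → Type x
  [vertexInst : ∀ a, Group (vertexGroup a)]
  [edgeInst : ∀ e, Group (edgeGroup e)]
  srcHom : ∀ e, edgeGroup e →* vertexGroup (src e)
  tgtHom : ∀ e, edgeGroup e →* vertexGroup (tgt e)

namespace GraphOfGroups

attribute [instance] GraphOfGroups.vertexInst GraphOfGroups.edgeInst

variable {V : Type u} {E : Type v} (𝒢 : GraphOfGroups.{u, v, w, x} V E)

/-- The free product of all vertex groups and of the free group on the edges. -/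
abbrev FreeProd : Type (max u v w) :=
  Monoid.Coprod (Monoid.CoprodI 𝒢.vertexGroup) (FreeGroup E)

/-- The relators `t_e φ_{e,tgt}(a) t_e⁻¹ φ_{e,src}(a)⁻¹`. -/
def relators : Set 𝒢.FreeProd :=
  {r | ∃ (e : E) (a : 𝒢.edgeGroup e),
    r = Monoid.Coprod.inr (FreeGroup.of e)
      * Monoid.Coprod.inl (Monoid.CoprodI.of (𝒢.tgtHom e a))
      * (Monoid.Coprod.inr (FreeGroup.of e))⁻¹
      * (Monoid.Coprod.inl (Monoid.CoprodI.of (𝒢.srcHom e a)))⁻¹}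

/-- Serre's group `F(𝒢)`, generated by the vertex groups and the edges, in which
`t_e φ_{e,tgt}(a) t_e⁻¹ = φ_{e,src}(a)` for all edges `e` and all `a` in the edge group. -/
abbrev PathGroup : Type (max u v w) :=
  𝒢.FreeProd ⧸ Subgroup.normalClosure 𝒢.relators

/-- The homomorphism from a vertex group to `F(𝒢)`. -/
def ofVertex (a : V) : 𝒢.vertexGroup a →* 𝒢.PathGroup :=
  (QuotientGroup.mk' (Subgroup.normalClosure 𝒢.relators)).comp
    (Monoid.Coprod.inl.comp Monoid.CoprodI.of)

/-- The element of `F(𝒢)` given by an edge, read from its source to its target. -/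
def ofEdge (e : E) : 𝒢.PathGroup :=
  QuotientGroup.mk' (Subgroup.normalClosure 𝒢.relators) (Monoid.Coprod.inr (FreeGroup.of e))

/-- `IsPath a b z`: the element `z` of `F(𝒢)` is represented by a word
`g₀ t₁ g₁ ⋯ tₙ gₙ` of type `c`, for some edge path `c` from `a` to `b` (in which edges may be
traversed in both directions). -/
inductive IsPath : V → V → 𝒢.PathGroup → Prop
  | nil (a : V) : IsPath a a 1
  | vertex {a b : V} {z : 𝒢.PathGroup} (h : IsPath a b z) (g : 𝒢.vertexGroup b) :
      IsPath a b (z * 𝒢.ofVertex b g)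
  | edge {a : V} {z : 𝒢.PathGroup} (e : E) (h : IsPath a (𝒢.src e) z) :
      IsPath a (𝒢.tgt e) (z * 𝒢.ofEdge e)
  | edgeInv {a : V} {z : 𝒢.PathGroup} (e : E) (h : IsPath a (𝒢.tgt e) z) :
      IsPath a (𝒢.src e) (z * (𝒢.ofEdge e)⁻¹)

variable {𝒢}

theorem IsPath.mul {a b c : V} {z z' : 𝒢.PathGroup} (h : 𝒢.IsPath a b z) (h' : 𝒢.IsPath b c z') :
    𝒢.IsPath a c (z * z') := by
  induction h' with
  | nil => simpa using h
  | vertex _ g ih => rw [← mul_assoc]; exact ih.vertex g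
  | edge e _ ih => rw [← mul_assoc]; exact ih.edge e
  | edgeInv e _ ih => rw [← mul_assoc]; exact ih.edgeInv e

theorem IsPath.inv {a b : V} {z : 𝒢.PathGroup} (h : 𝒢.IsPath a b z) : 𝒢.IsPath b a z⁻¹ := by
  induction h with
  | nil => simpa using IsPath.nil (𝒢 := 𝒢) a
  | @vertex b z _ g ih =>
    have h1 := (IsPath.nil (𝒢 := 𝒢) b).vertex g⁻¹
    simpa using h1.mul ih
  | @edge z e _ ih =>
    have h1 := (IsPath.nil (𝒢 := 𝒢) (𝒢.tgt e)).edgeInv e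
    simpa using h1.mul ih
  | @edgeInv z e _ ih =>
    have h1 := (IsPath.nil (𝒢 := 𝒢) (𝒢.src e)).edge e
    simpa using h1.mul ih

variable (𝒢)

/-- The fundamental group `π₁(𝒢, a)` of the graph of groups, based at the vertex `a`: the elements
of `F(𝒢)` represented by words whose type is a closed edge path at `a`. -/
def fundamentalGroup (a : V) : Subgroup 𝒢.PathGroup where
  carrier := {z | 𝒢.IsPath a a z}
  one_mem' := IsPath.nil a
  mul_mem' h h' := h.mul h'
  inv_mem' h := h.inv

/-- The canonical homomorphism from the vertex group at `a` to `π₁(𝒢, a)`. -/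
def vertexHom (a : V) : 𝒢.vertexGroup a →* 𝒢.fundamentalGroup a :=
  (𝒢.ofVertex a).codRestrict (𝒢.fundamentalGroup a) (fun g => by
    have h := (IsPath.nil (𝒢 := 𝒢) a).vertex g
    rw [one_mul] at h
    exact h)

end GraphOfGroups

/-! ### Graphs of spaces -/

/-- `X` is a finite CW complex: it is Hausdorff and admits a CW structure with finitely many
cells. -/
def IsFiniteCWComplex (X : Type u) [TopologicalSpace X] : Prop :=
  T2Space X ∧ ∃ _ : Topology.CWComplex (Set.univ : Set X),
    Topology.RelCWComplex.Finite (Set.univ : Set X)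

/-- A graph of spaces over the graph with vertex set `V` and (arbitrarily oriented) edge set `E`.
Loops and multiple edges are allowed. -/
structure GraphOfSpaces (V : Type u) (E : Type v) where
  src : E → V
  tgt : E → V
  vertexSpace : V → Type w
  edgeSpace : E → Type x
  [vertexTop : ∀ a, TopologicalSpace (vertexSpace a)]
  [edgeTop : ∀ e, TopologicalSpace (edgeSpace e)]
  srcMap : ∀ e, C(edgeSpace e, vertexSpace (src e))
  tgtMap : ∀ e, C(edgeSpace e, vertexSpace (tgt e))

namespace GraphOfSpaces

attribute [instance] GraphOfSpaces.vertexTop GraphOfSpaces.edgeTop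

variable {V : Type u} {E : Type v} (𝒳 : GraphOfSpaces.{u, v, w, x} V E)

/-- The disjoint union of all vertex spaces and all thickened edge spaces `X_e × [0,1]`. -/
abbrev Pieces : Type (max u v w x) :=
  (Σ a, 𝒳.vertexSpace a) ⊕ (Σ e, 𝒳.edgeSpace e × I)

/-- The gluing: `(y, 0) ∈ X_e × [0,1]` is identified with `φ_{e,src}(y)`, and `(y, 1)` with
`φ_{e,tgt}(y)`. -/
inductive Glue : 𝒳.Pieces → 𝒳.Pieces → Prop
  | src (e : E) (y : 𝒳.edgeSpace e) :
      Glue (Sum.inr ⟨e, (y, 0)⟩) (Sum.inl ⟨𝒳.src e, 𝒳.srcMap e y⟩)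
  | tgt (e : E) (y : 𝒳.edgeSpace e) :
      Glue (Sum.inr ⟨e, (y, 1)⟩) (Sum.inl ⟨𝒳.tgt e, 𝒳.tgtMap e y⟩)

/-- The total space of the graph of spaces, with the quotient topology. -/
abbrev Total : Type (max u v w x) := Quot 𝒳.Glue

/-- The canonical map from a vertex space to the total space. -/
def vertexMap (a : V) : C(𝒳.vertexSpace a, 𝒳.Total) where
  toFun z := Quot.mk _ (Sum.inl ⟨a, z⟩)
  continuous_toFun := continuous_quot_mk.comp (continuous_inl.comp continuous_sigmaMk)

end GraphOfSpaces

/-! ### The standard filtration -/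

/-! A finitely generated group is RFRp once its standard filtration `K_i` has trivial intersection
(`IsRFRp.of_exists_notMem`). The filtration is functorial, and a homomorphism defined only on
`K_N(G)` sends `K_{N+i}(G)` into the `i`-th term of its target (`map_mem_rfrpFiltration_add`). Hence
a nontrivial element of `K_N(G)` is detected by any homomorphism from `K_N(G)` to a free group that
does not kill it, because free groups are separated by their filtration
(`FreeGroup.exists_notMem_rfrpFiltration`).

Graphs of groups: the argument runs in the path group `F`. An element `z` is written as a word in
which no backtracking can be removed by an edge relation. If no edge is crossed, `z` lies in a
vertex group and the hypothesis on topologies applies. Otherwise every backtracking turns through a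
vertex element outside the edge group. As edge groups are closed and the topologies are induced,
this persists modulo `K = K_N(F)` for some `N`. If `z` lies in `K`, its path in the Bass–Serre tree
projects to a path without backtracking in the quotient by `K`. Recording the quotient edges that
are crossed gives a homomorphism from `K` to a free group (`crossingHom`), under which `z` becomes a
nonempty reduced word.

Graphs of spaces: let `F` be the path group of the fundamental groups of the pieces. In the manner
of van Kampen, cocycles on paths are glued over two open sets, which gives a homomorphism from
`π₁(X)` to `F` (`totalCocycle`). A homomorphism back is defined on generators (`realize`). The
composite on `π₁(X)` is inner, so `π₁(X)` is both a quotient of `F`, hence finitely generated, and a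
subgroup of `F` formed by closed paths, to which the separation argument applies. -/

theorem exists_nsmul_eq_of_one_tmul_eq_zero (p : ℕ) {A : Type*} [AddCommGroup A] {a : A}
    (h : (1 : ZMod p) ⊗ₜ[ℤ] a = 0) : ∃ b : A, a = p • b := by
  -- The tensor product maps to `A / pA` by `z ⊗ a ↦ z • [a]`, and `1 ⊗ a` goes to the class of `a`.
  let S : AddSubgroup A := (nsmulAddMonoidHom (α := A) p).range
  have hS : ∀ x : A ⧸ S, p • x = 0 := by
    intro x
    obtain ⟨y, rfl⟩ := QuotientAddGroup.mk_surjective x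
    rw [← QuotientAddGroup.mk_nsmul, QuotientAddGroup.eq_zero_iff]
    exact ⟨y, rfl⟩
  let _ : Module (ZMod p) (A ⧸ S) := AddCommGroup.zmodModule hS
  let f : ZMod p →ₗ[ℤ] A →ₗ[ℤ] A ⧸ S := LinearMap.mk₂ ℤ (fun z a => z • (a : A ⧸ S))
    (fun z z' a => add_smul _ _ _) (fun n z a => by rw [smul_assoc])
    (fun z a b => by rw [QuotientAddGroup.mk_add, smul_add])
    (fun n z a => by rw [QuotientAddGroup.mk_zsmul, smul_comm])
  have h1 : TensorProduct.lift f ((1 : ZMod p) ⊗ₜ[ℤ] a) = 0 := by rw [h, map_zero]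
  have h2 : ((a : A) : A ⧸ S) = 0 := by simpa [f] using h1
  obtain ⟨b, hb⟩ := (QuotientAddGroup.eq_zero_iff a).1 h2
  exact ⟨b, hb.symm⟩

theorem Abelianization.of_eq_one_iff {G : Type*} [Group G] {g : G} :
    Abelianization.of g = 1 ↔ g ∈ commutator G := by
  rw [← MonoidHom.mem_ker, Abelianization.ker_of]

theorem mem_torsion_of_iff {G : Type*} [Group G] {g : G} :
    Abelianization.of g ∈ CommGroup.torsion (Abelianization G) ↔
      ∃ n : ℕ, 0 < n ∧ g ^ n ∈ commutator G := by
  rw [CommGroup.mem_torsion, isOfFinOrder_iff_pow_eq_one]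
  simp only [← map_pow, Abelianization.of_eq_one_iff]

/-- Unwinds the tensor product and the two quotients into a condition on elements that any
homomorphism visibly preserves. -/
theorem mem_ker_toTFModP {p : ℕ} {G : Type*} [Group G] {g : G} :
    g ∈ (toTFModP p G).ker ↔ ∃ h : G, ∃ n : ℕ, 0 < n ∧ ((h ^ p)⁻¹ * g) ^ n ∈ commutator G := by
  constructor
  · intro hg
    obtain ⟨b, hb⟩ := exists_nsmul_eq_of_one_tmul_eq_zero p (a := Additive.ofMul
      (QuotientGroup.mk (Abelianization.of g) : TFAb G)) (Multiplicative.ofAdd.injective hg)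
    obtain ⟨c, hc⟩ := QuotientGroup.mk_surjective b.toMul
    obtain ⟨h, rfl⟩ := QuotientGroup.mk_surjective c
    refine ⟨h, mem_torsion_of_iff.1 ?_⟩
    rw [← QuotientGroup.eq_one_iff, map_mul, map_inv, map_pow, QuotientGroup.mk_mul,
      QuotientGroup.mk_inv, QuotientGroup.mk_pow, inv_mul_eq_one]
    have : (QuotientGroup.mk (Abelianization.of g) : TFAb G) = b.toMul ^ p :=
      Additive.ofMul.injective hb
    rw [this, ← hc]
    rfl
  · rintro ⟨h, hn⟩
    have h1 := mem_torsion_of_iff.2 hn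
    rw [← QuotientGroup.eq_one_iff, map_mul, map_inv, map_pow, QuotientGroup.mk_mul,
      QuotientGroup.mk_inv, QuotientGroup.mk_pow, inv_mul_eq_one] at h1
    change Multiplicative.ofAdd ((1 : ZMod p) ⊗ₜ[ℤ] Additive.ofMul
      (QuotientGroup.mk (Abelianization.of g) : TFAb G)) = 1
    rw [← h1, ofMul_pow, ← TensorProduct.smul_tmul]
    simp

/-- `ℚ ⊗ A` is the localization of `A` at the nonzero integers, so exactly the torsion dies in it.
-/
theorem mem_ker_toRationalH1 {G : Type*} [Group G] {g : G} :
    g ∈ (toRationalH1 G).ker ↔ ∃ n : ℕ, 0 < n ∧ g ^ n ∈ commutator G := by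
  rw [← mem_torsion_of_iff, CommGroup.mem_torsion]
  have h0 : g ∈ (toRationalH1 G).ker ↔ TensorProduct.mk ℤ ℚ (Additive (Abelianization G)) 1
      (Additive.ofMul (Abelianization.of g)) = 0 := Iff.rfl
  rw [h0, IsLocalizedModule.eq_zero_iff (nonZeroDivisors ℤ), isOfFinOrder_iff_zpow_eq_one]
  constructor
  · rintro ⟨⟨n, hn⟩, h⟩
    exact ⟨n, nonZeroDivisors.ne_zero hn, Additive.ofMul.injective h⟩
  · rintro ⟨n, hn, h⟩
    exact ⟨⟨n, mem_nonZeroDivisors_of_ne_zero hn⟩, congrArg Additive.ofMul h⟩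

theorem MonoidHom.map_mem_commutator {G H : Type*} [Group G] [Group H] (f : G →* H) {g : G}
    (hg : g ∈ commutator G) : f g ∈ commutator H := by
  have : f g ∈ (commutator G).map f := ⟨g, hg, rfl⟩
  rw [commutator_def, Subgroup.map_commutator] at this
  exact Subgroup.commutator_mono le_top le_top this

theorem MonoidHom.map_mem_ker_toTFModP {p : ℕ} {G H : Type*} [Group G] [Group H] (f : G →* H)
    {g : G} (hg : g ∈ (toTFModP p G).ker) : f g ∈ (toTFModP p H).ker := by
  obtain ⟨h, n, hn, hc⟩ := mem_ker_toTFModP.1 hg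
  refine mem_ker_toTFModP.2 ⟨f h, n, hn, ?_⟩
  simpa using f.map_mem_commutator hc

section Filtration

variable {p : ℕ} {G : Type u} [Group G] {H : Type v} [Group H]

theorem mem_rfrpFiltration_succ {i : ℕ} {g : G} :
    g ∈ rfrpFiltration p G (i + 1) ↔
      ∃ h : g ∈ rfrpFiltration p G i, (⟨g, h⟩ : rfrpFiltration p G i) ∈ (toTFModP p _).ker := by
  change g ∈ Subgroup.map _ _ ↔ _
  constructor
  · rintro ⟨x, hx, rfl⟩
    exact ⟨x.2, hx⟩
  · rintro ⟨h, hx⟩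
    exact ⟨_, hx, rfl⟩

theorem rfrpFiltration_succ_le (i : ℕ) : rfrpFiltration p G (i + 1) ≤ rfrpFiltration p G i :=
  fun _ h => (mem_rfrpFiltration_succ.1 h).1

theorem rfrpFiltration_antitone : Antitone (rfrpFiltration p G) :=
  antitone_nat_of_succ_le rfrpFiltration_succ_le

theorem map_mem_rfrpFiltration (f : G →* H) (i : ℕ) {g : G} (hg : g ∈ rfrpFiltration p G i) :
    f g ∈ rfrpFiltration p H i := by
  induction i generalizing g with
  | zero => trivial
  | succ i ih =>
    obtain ⟨h, hk⟩ := mem_rfrpFiltration_succ.1 hg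
    have hf (y : rfrpFiltration p G i) :
        (f.comp (rfrpFiltration p G i).subtype) y ∈ rfrpFiltration p H i := ih y.2
    have hk' := ((f.comp (rfrpFiltration p G i).subtype).codRestrict _ hf).map_mem_ker_toTFModP hk
    exact mem_rfrpFiltration_succ.2 ⟨_, hk'⟩

/-- Restarting the filtration at `K_N` shifts its index. Thus elements can be detected by
homomorphisms that exist only on a finite stage. -/
theorem map_mem_rfrpFiltration_add {N : ℕ} (f : rfrpFiltration p G N →* H) (i : ℕ) {g : G}
    (hN : g ∈ rfrpFiltration p G N) (hg : g ∈ rfrpFiltration p G (N + i)) :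
    f ⟨g, hN⟩ ∈ rfrpFiltration p H i := by
  induction i generalizing g with
  | zero => trivial
  | succ i ih =>
    obtain ⟨h, hk⟩ := mem_rfrpFiltration_succ.1 hg
    let f' := f.comp (Subgroup.inclusion (rfrpFiltration_antitone (Nat.le_add_right N i)))
    have hf (y : rfrpFiltration p G (N + i)) : f' y ∈ rfrpFiltration p H i := ih _ y.2
    have hk' := (f'.codRestrict _ hf).map_mem_ker_toTFModP hk
    exact mem_rfrpFiltration_succ.2 ⟨_, hk'⟩

/-- Functoriality applied to inner automorphisms. -/
instance rfrpFiltration_normal (i : ℕ) : (rfrpFiltration p G i).Normal :=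
  ⟨fun _ hn g => map_mem_rfrpFiltration (MulAut.conj g).toMonoidHom i hn⟩

theorem isRFRpSequence_rfrpFiltration (h : ∀ g : G, g ≠ 1 → ∃ i, g ∉ rfrpFiltration p G i) :
    IsRFRpSequence p (rfrpFiltration p G) where
  zero_eq := rfl
  le := rfrpFiltration_succ_le
  normal i := inferInstance
  iInf_eq := by
    refine (Subgroup.eq_bot_iff_forall _).2 fun g hg => ?_
    by_contra hne
    obtain ⟨i, hi⟩ := h g hne
    exact hi (Subgroup.mem_iInf.1 hg i)
  commutator_mem i a ha b hb := by
    refine mem_rfrpFiltration_succ.2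
      ⟨(⁅(⟨a, ha⟩ : rfrpFiltration p G i), ⟨b, hb⟩⁆ : rfrpFiltration p G i).2, ?_⟩
    refine mem_ker_toTFModP.2 ⟨1, 1, one_pos, ?_⟩
    rw [one_pow, inv_one, one_mul, pow_one]
    exact Subgroup.commutator_mem_commutator (Subgroup.mem_top
      (⟨a, ha⟩ : rfrpFiltration p G i)) (Subgroup.mem_top (⟨b, hb⟩ : rfrpFiltration p G i))
  pow_mem i a ha := by
    refine mem_rfrpFiltration_succ.2 ⟨pow_mem ha p, ?_⟩
    refine mem_ker_toTFModP.2 ⟨⟨a, ha⟩, 1, one_pos, ?_⟩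
    have : ((⟨a, ha⟩ : rfrpFiltration p G i) ^ p)⁻¹ * ⟨a ^ p, pow_mem ha p⟩ = 1 := by
      rw [inv_mul_eq_one]; rfl
    rw [this, one_pow]
    exact one_mem _
  ker_le i g hg := by
    obtain ⟨n, hn, hc⟩ := mem_ker_toRationalH1.1 hg
    refine Subgroup.mem_subgroupOf.2 (mem_rfrpFiltration_succ.2 ⟨g.2, ?_⟩)
    exact mem_ker_toTFModP.2 ⟨1, n, hn, by simpa using hc⟩

/-- The standard filtration descends fastest: an element of its next term is, inside `K i`, a `p`-th
power times an element that dies rationally, and `K (i+1)` contains both factors. -/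
theorem IsRFRpSequence.rfrpFiltration_le {K : ℕ → Subgroup G} (hK : IsRFRpSequence p K) (i : ℕ) :
    rfrpFiltration p G i ≤ K i := by
  induction i with
  | zero => rw [hK.zero_eq]; exact le_top
  | succ i ih =>
    intro g hg
    obtain ⟨h, hk⟩ := mem_rfrpFiltration_succ.1 hg
    obtain ⟨a, n, hn, hc⟩ := mem_ker_toTFModP.1 ((Subgroup.inclusion ih).map_mem_ker_toTFModP hk)
    have h1 := Subgroup.mem_subgroupOf.1 (hK.ker_le i (mem_ker_toRationalH1.2 ⟨n, hn, hc⟩))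
    have h2 := mul_mem (hK.pow_mem i a a.2) h1
    simpa using h2

theorem IsRFRp.exists_notMem (hG : IsRFRp p G) {g : G} (hg : g ≠ 1) :
    ∃ i, g ∉ rfrpFiltration p G i := by
  obtain ⟨_, K, hK⟩ := hG
  by_contra! h
  refine hg ?_
  rw [← Subgroup.mem_bot, ← hK.iInf_eq, Subgroup.mem_iInf]
  exact fun i => hK.rfrpFiltration_le i (h i)

theorem IsRFRp.of_exists_notMem (hG : Group.FG G)
    (h : ∀ g : G, g ≠ 1 → ∃ i, g ∉ rfrpFiltration p G i) : IsRFRp p G :=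
  ⟨hG, _, isRFRpSequence_rfrpFiltration h⟩

theorem IsRFRp.of_mulEquiv (e : G ≃* H) (hG : IsRFRp p G) : IsRFRp p H := by
  refine .of_exists_notMem ?_ fun h hh => ?_
  · have := hG.1
    exact Group.fg_of_surjective (f := e.toMonoidHom) e.surjective
  · obtain ⟨i, hi⟩ := hG.exists_notMem (g := e.symm h) (by simpa using hh)
    exact ⟨i, fun hm => hi (map_mem_rfrpFiltration e.symm.toMonoidHom i hm)⟩

/-! ### The RFRp topology -/

/-- The filtration is nested, so the intersection of two neighbourhoods of `g` contains a coset of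
the later of two terms. -/
theorem exists_rfrpFiltration_subset {U : Set G} (hU : @IsOpen G (rfrpTopology p G) U) {g : G}
    (hg : g ∈ U) : ∃ N, ∀ k ∈ rfrpFiltration p G N, g * k ∈ U := by
  induction hU generalizing g with
  | basic s hs =>
    obtain ⟨a, i, rfl⟩ := hs
    refine ⟨i, fun k hk => ?_⟩
    simpa [mul_assoc] using mul_mem hg hk
  | univ => exact ⟨0, fun _ _ => trivial⟩
  | inter s t _ _ hs ht =>
    obtain ⟨m, hm⟩ := hs hg.1
    obtain ⟨n, hn⟩ := ht hg.2
    exact ⟨max m n, fun k hk => ⟨hm k (rfrpFiltration_antitone (le_max_left m n) hk),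
      hn k (rfrpFiltration_antitone (le_max_right m n) hk)⟩⟩
  | sUnion S _ ih =>
    obtain ⟨s, hs, hgs⟩ := hg
    obtain ⟨N, hN⟩ := ih s hs hgs
    exact ⟨N, fun k hk => ⟨s, hs, hN k hk⟩⟩

theorem IsRFRpClosed.exists_notMem {S : Subgroup G} (hS : IsRFRpClosed p S) {g : G} (hg : g ∉ S) :
    ∃ N, ∀ k ∈ rfrpFiltration p G N, g * k ∉ S :=
  exists_rfrpFiltration_subset hS.isOpen_compl hg

theorem IsRFRpClosed.map_mulEquiv {S : Subgroup G} (hS : IsRFRpClosed p S) (e : G ≃* H) :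
    IsRFRpClosed p (S.map e.toMonoidHom) := by
  have hc : @Continuous H G (rfrpTopology p H) (rfrpTopology p G) e.symm := by
    refine continuous_generateFrom_iff.2 ?_
    rintro _ ⟨g, i, rfl⟩
    refine TopologicalSpace.isOpen_generateFrom_of_mem ⟨e g, i, ?_⟩
    ext h
    constructor
    · intro hm
      have := map_mem_rfrpFiltration e.toMonoidHom i hm
      simpa using this
    · intro hm
      have := map_mem_rfrpFiltration e.symm.toMonoidHom i hm
      simpa using this
  have := @IsClosed.preimage H G (rfrpTopology p H) (rfrpTopology p G) _ hc _ hS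
  have heq : (e.symm ⁻¹' (S : Set G)) = ((S.map e.toMonoidHom : Subgroup H) : Set H) := by
    ext h
    exact (Subgroup.mem_map_equiv (f := e) (K := S) (x := h)).symm
  rw [heq] at this
  exact this

/-- The openness of a filtration term of `H`, unwound at the identity. The hypothesis on topologies
is used in this form. -/
theorem InducesRFRpTopology.exists_mem {f : H →* G} (hf : InducesRFRpTopology p f) (i : ℕ) :
    ∃ N, ∀ h : H, f h ∈ rfrpFiltration p G N → h ∈ rfrpFiltration p H i := by
  have ho : @IsOpen H (rfrpTopology p H) (rfrpFiltration p H i : Set H) :=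
    TopologicalSpace.isOpen_generateFrom_of_mem ⟨1, i, by simp⟩
  rw [← hf] at ho
  obtain ⟨U, hU, hUi⟩ := (@isOpen_induced_iff _ _ (rfrpTopology p G) _ f).1 ho
  have h1 : f 1 ∈ U := by
    change (1 : H) ∈ f ⁻¹' U
    rw [hUi]
    exact one_mem _
  obtain ⟨N, hN⟩ := exists_rfrpFiltration_subset hU h1
  refine ⟨N, fun h hh => ?_⟩
  have : h ∈ f ⁻¹' U := by simpa using hN _ hh
  rwa [hUi] at this

end Filtration

/-! ### Free groups -/

/-- The abelianization of a free group is free abelian, hence torsion-free. -/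
theorem mem_commutator_of_pow_mem {G : Type*} [Group G] [IsFreeGroup G] {g : G} {n : ℕ}
    (hn : 0 < n) (h : g ^ n ∈ commutator G) : g ∈ commutator G := by
  let e := (IsFreeGroup.toFreeGroup G).abelianizationCongr
  let a : FreeAbelianGroup (IsFreeGroup.Generators G) := Additive.ofMul (e (Abelianization.of g))
  have h1 : n • a = 0 := by
    refine congrArg Additive.ofMul (?_ : e (Abelianization.of g) ^ n = 1)
    rw [← map_pow, ← map_pow, Abelianization.of_eq_one_iff.2 h, map_one]
  have h2 : n • FreeAbelianGroup.equivFinsupp _ a = 0 := by rw [← map_nsmul, h1, map_zero]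
  have h3 : FreeAbelianGroup.equivFinsupp _ a = 0 := by
    ext y
    have := DFunLike.congr_fun h2 y
    simpa [hn.ne'] using this
  have h4 : e (Abelianization.of g) = 1 := Additive.ofMul.injective
    ((FreeAbelianGroup.equivFinsupp _).map_eq_zero_iff.1 h3)
  exact Abelianization.of_eq_one_iff.1 (e.map_eq_one_iff.1 h4)

/-- By Nielsen–Schreier every term of the filtration of `F` is free, so its abelianization has no
torsion and the next term is generated by commutators and `p`-th powers alone. -/
theorem map_mem_of_mem_rfrpFiltration {p : ℕ} {F P : Type*} [Group F] [IsFreeGroup F] [Group P]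
    (f : F →* P) (L : ℕ → Subgroup P) (h0 : ∀ g, f g ∈ L 0)
    (hcomm : ∀ i, ∀ a ∈ L i, ∀ b ∈ L i, ⁅a, b⁆ ∈ L (i + 1))
    (hpow : ∀ i, ∀ a ∈ L i, a ^ p ∈ L (i + 1)) (i : ℕ) {g : F} (hg : g ∈ rfrpFiltration p F i) :
    f g ∈ L i := by
  induction i generalizing g with
  | zero => exact h0 g
  | succ i ih =>
    obtain ⟨hgi, hk⟩ := mem_rfrpFiltration_succ.1 hg
    obtain ⟨h, n, hn, hc⟩ := mem_ker_toTFModP.1 hk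
    have h1 := mem_commutator_of_pow_mem hn hc
    have h2 : commutator (rfrpFiltration p F i) ≤
        (L (i + 1)).comap (f.comp (rfrpFiltration p F i).subtype) := by
      rw [commutator_def, Subgroup.commutator_le]
      intro a _ b _
      rw [Subgroup.mem_comap, map_commutatorElement]
      exact hcomm i _ (ih a.2) _ (ih b.2)
    have h3 := mul_mem (hpow i _ (ih h.2)) (h2 h1)
    simpa using h3

/-! ### Congruence subgroups of the units of a filtered ring. -/

section FilteredRing

variable {R : Type*} [Ring R] (D : ℕ → AddSubgroup R) (hone : (1 : R) ∈ D 0)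
  (hmul : ∀ i j, ∀ a ∈ D i, ∀ b ∈ D j, a * b ∈ D (i + j))

/-- The units congruent to `1` modulo the `(i + 1)`-st term of a ring filtration. -/
def congruenceUnits (i : ℕ) : Subgroup Rˣ where
  carrier := {u | (u : R) ∈ D 0 ∧ ((u⁻¹ : Rˣ) : R) ∈ D 0 ∧ (u : R) - 1 ∈ D (i + 1)}
  one_mem' := by simpa using hone
  mul_mem' := by
    rintro u v ⟨hu, hu', hu1⟩ ⟨hv, hv', hv1⟩
    refine ⟨hmul 0 0 _ hu _ hv, ?_, ?_⟩
    · rw [mul_inv_rev]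
      exact hmul 0 0 _ hv' _ hu'
    · have : ((u * v : Rˣ) : R) - 1 = u * (v - 1) + (u - 1) := by
        rw [Units.val_mul]; noncomm_ring
      rw [this]
      refine add_mem ?_ hu1
      simpa using hmul 0 (i + 1) _ hu _ hv1
  inv_mem' := by
    rintro u ⟨hu, hu', hu1⟩
    refine ⟨hu', by simpa using hu, ?_⟩
    have : ((u⁻¹ : Rˣ) : R) - 1 = -(((u⁻¹ : Rˣ) : R) * (u - 1)) := by
      rw [mul_sub, Units.inv_mul]; simp
    rw [this]
    refine neg_mem ?_
    simpa using hmul 0 (i + 1) _ hu' _ hu1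

/-- `⁅u, v⁆ - 1 = (uv - vu) u⁻¹ v⁻¹`, and `uv - vu` is also the ring commutator of `u - 1` and `v -
1`, of degree at least `2(i+1) ≥ i+2`. -/
theorem commutator_mem_congruenceUnits (anti : ∀ i, D (i + 1) ≤ D i) (i : ℕ) {u v : Rˣ}
    (hu : u ∈ congruenceUnits D hone hmul i) (hv : v ∈ congruenceUnits D hone hmul i) :
    ⁅u, v⁆ ∈ congruenceUnits D hone hmul (i + 1) := by
  have hc : ⁅u, v⁆ ∈ congruenceUnits D hone hmul i := by
    rw [commutatorElement_def]
    exact mul_mem (mul_mem (mul_mem hu hv) (inv_mem hu)) (inv_mem hv)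
  refine ⟨hc.1, hc.2.1, ?_⟩
  obtain ⟨_, hu', hu1⟩ := hu
  obtain ⟨_, hv', hv1⟩ := hv
  have h1 : (u : R) * v - v * u ∈ D (i + 1 + 1) := by
    have : (u : R) * v - v * u = (u - 1) * (v - 1) - (v - 1) * (u - 1) := by noncomm_ring
    rw [this]
    have hD : Antitone D := antitone_nat_of_succ_le anti
    refine sub_mem ?_ ?_
    · exact hD (by omega) (hmul (i + 1) (i + 1) _ hu1 _ hv1)
    · exact hD (by omega) (hmul (i + 1) (i + 1) _ hv1 _ hu1)
  have : ((⁅u, v⁆ : Rˣ) : R) - 1 =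
      ((u : R) * v - v * u) * (((u⁻¹ : Rˣ) : R) * ((v⁻¹ : Rˣ) : R)) := by
    rw [sub_mul, commutatorElement_def]
    simp [mul_assoc]
  rw [this]
  exact hmul (i + 1 + 1) 0 _ h1 _ (hmul 0 0 _ hu' _ hv')

/-- `u ^ p - 1` is `u - 1` times a geometric sum, which is congruent to `p`, hence to `0`, modulo `D
1`. -/
theorem pow_mem_congruenceUnits (anti : ∀ i, D (i + 1) ≤ D i) {p : ℕ} (hp : (p : R) ∈ D 1) (i : ℕ)
    {u : Rˣ} (hu : u ∈ congruenceUnits D hone hmul i) :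
    u ^ p ∈ congruenceUnits D hone hmul (i + 1) := by
  have hc : u ^ p ∈ congruenceUnits D hone hmul i := pow_mem hu p
  refine ⟨hc.1, hc.2.1, ?_⟩
  have hD : Antitone D := antitone_nat_of_succ_le anti
  have h1 : (∑ k ∈ Finset.range p, (u : R) ^ k) ∈ D 1 := by
    have h2 : (∑ k ∈ Finset.range p, (u : R) ^ k) =
        ∑ k ∈ Finset.range p, ((u : R) ^ k - 1) + p := by
      rw [Finset.sum_sub_distrib]; simp
    rw [h2]
    refine add_mem (sum_mem fun k _ => ?_) hp
    have : u ^ k ∈ congruenceUnits D hone hmul i := pow_mem hu k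
    have h3 := this.2.2
    rw [Units.val_pow_eq_pow_val] at h3
    exact hD (by omega) h3
  rw [Units.val_pow_eq_pow_val, ← geom_sum_mul, add_comm (i + 1) 1]
  exact hmul 1 (i + 1) _ h1 _ hu.2.2

end FilteredRing

/-! ### A unipotent representation of free groups on integer sequences. -/

section Unipotent

/-- Integer sequences whose `a`-th term is divisible by `p ^ (j + a)`. -/
def weightedSequences (p j : ℕ) : AddSubgroup (ℕ → ℤ) where
  carrier := {v | ∀ a, (p : ℤ) ^ (j + a) ∣ v a}
  zero_mem' _ := dvd_zero _
  add_mem' hv hw a := dvd_add (hv a) (hw a)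
  neg_mem' hv a := (dvd_neg).2 (hv a)

/-- Endomorphisms raising the weight by `i`. -/
def weightFiltration (p i : ℕ) : AddSubgroup (Module.End ℤ (ℕ → ℤ)) where
  carrier := {T | ∀ j, ∀ v ∈ weightedSequences p j, T v ∈ weightedSequences p (j + i)}
  zero_mem' _ _ _ := zero_mem _
  add_mem' hS hT j v hv := add_mem (hS j v hv) (hT j v hv)
  neg_mem' hS j v hv := neg_mem (hS j v hv)

theorem weightFiltration_mul (p i j : ℕ) (S : Module.End ℤ (ℕ → ℤ)) (hS : S ∈ weightFiltration p i)
    (T : Module.End ℤ (ℕ → ℤ)) (hT : T ∈ weightFiltration p j) :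
    S * T ∈ weightFiltration p (i + j) := by
  intro k v hv
  have := hS _ _ (hT _ _ hv)
  rwa [add_assoc, add_comm j i] at this

theorem weightFiltration_one (p : ℕ) : 1 ∈ weightFiltration p 0 := fun _ _ hv => hv

theorem weightFiltration_succ_le (p i : ℕ) : weightFiltration p (i + 1) ≤ weightFiltration p i :=
  fun _ hT j v hv a => (pow_dvd_pow _ (by omega)).trans (hT j v hv a)

theorem natCast_mem_weightFiltration (p : ℕ) :
    (p : Module.End ℤ (ℕ → ℤ)) ∈ weightFiltration p 1 := by
  intro j v hv a
  have : ((p : Module.End ℤ (ℕ → ℤ)) v) a = p * v a := by simp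
  rw [this, show j + 1 + a = (j + a) + 1 by ring, pow_succ']
  exact mul_dvd_mul_left _ (hv a)

variable {X : Type*}

open Classical in
/-- The shift `v ↦ (a ↦ v (a + 1))` restricted to the positions labelled `x`. -/
noncomputable def labelledShift (label : ℕ → Option X) (x : X) : Module.End ℤ (ℕ → ℤ) where
  toFun v a := if label a = some x then v (a + 1) else 0
  map_add' v w := by ext a; by_cases h : label a = some x <;> simp [h]
  map_smul' c v := by ext a; by_cases h : label a = some x <;> simp [h]

theorem labelledShift_mem (p : ℕ) (label : ℕ → Option X) (x : X) :
    labelledShift label x ∈ weightFiltration p 1 := by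
  intro j v hv a
  by_cases h : label a = some x
  · have := hv (a + 1)
    simp only [labelledShift, LinearMap.coe_mk, AddHom.coe_mk, h, if_true]
    rwa [add_assoc, add_comm 1 a]
  · simp [labelledShift, h]

theorem labelledShift_mul_self {label : ℕ → Option X} {x : X}
    (h : ∀ a, label a = some x → label (a + 1) ≠ some x) :
    labelledShift label x * labelledShift label x = 0 := by
  ext v a
  by_cases ha : label a = some x
  · simp [labelledShift, ha, h a ha]
  · simp [labelledShift, ha]

/-- The unipotent operator `1 + N`, where `N` is the labelled shift. -/
noncomputable def unipotentUnit (label : ℕ → Option X)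
    (h : ∀ x a, label a = some x → label (a + 1) ≠ some x) (x : X) :
    (Module.End ℤ (ℕ → ℤ))ˣ where
  val := 1 + labelledShift label x
  inv := 1 - labelledShift label x
  val_inv := by
    have := labelledShift_mul_self (h x)
    rw [add_mul, mul_sub, mul_sub, this]; simp
  inv_val := by
    have := labelledShift_mul_self (h x)
    rw [sub_mul, mul_add, mul_add, this]; simp

/-- The shift has square zero, so only the linear term of the binomial expansion survives. -/
theorem unipotentUnit_zpow (label : ℕ → Option X)
    (h : ∀ x a, label a = some x → label (a + 1) ≠ some x) (x : X) (e : ℤ) :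
    ((unipotentUnit label h x ^ e : (Module.End ℤ (ℕ → ℤ))ˣ) : Module.End ℤ (ℕ → ℤ)) =
      1 + e • labelledShift label x := by
  have h2 := labelledShift_mul_self (h x)
  induction e with
  | zero => simp
  | succ n ih =>
    rw [zpow_add_one, Units.val_mul, ih]
    change _ * (1 + labelledShift label x) = _
    rw [mul_add, mul_one, add_mul, smul_mul_assoc, h2, add_smul, one_smul, smul_zero, one_mul,
      add_zero, add_assoc]
  | pred n ih =>
    rw [zpow_sub_one, Units.val_mul, ih]
    change _ * (1 - labelledShift label x) = _
    rw [mul_sub, mul_one, add_mul, smul_mul_assoc, h2, sub_smul, one_smul, smul_zero, one_mul,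
      add_zero, add_sub_assoc]

theorem unipotentUnit_mem (p : ℕ) (label : ℕ → Option X)
    (h : ∀ x a, label a = some x → label (a + 1) ≠ some x) (x : X) :
    unipotentUnit label h x ∈
      congruenceUnits (weightFiltration p) (weightFiltration_one p) (weightFiltration_mul p) 0 := by
  have h1 := labelledShift_mem p label x
  have h0 := weightFiltration_succ_le p 0 h1
  refine ⟨add_mem (weightFiltration_one p) h0, sub_mem (weightFiltration_one p) h0, ?_⟩
  change 1 + labelledShift label x - 1 ∈ _
  simpa using h1

/-- Read from the right, each syllable moves the leading entry one position to the left and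
multiplies it by its exponent. The vanishing further left ensures that the identity part of the next
factor contributes nothing at the new leading position. -/
theorem unipotent_apply (label : ℕ → Option X)
    (h : ∀ x a, label a = some x → label (a + 1) ≠ some x) (c : ℤ) (l : List (X × ℤ)) (k : ℕ)
    (hl : ∀ j, label (k + j) = (l[j]?).map Prod.fst) :
    (∀ a < k, (((l.map fun s => unipotentUnit label h s.1 ^ s.2).prod :
        (Module.End ℤ (ℕ → ℤ))ˣ) : Module.End ℤ (ℕ → ℤ)) (Pi.single (k + l.length) c) a = 0) ∧
      (((l.map fun s => unipotentUnit label h s.1 ^ s.2).prod :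
        (Module.End ℤ (ℕ → ℤ))ˣ) : Module.End ℤ (ℕ → ℤ)) (Pi.single (k + l.length) c) k =
        (l.map Prod.snd).prod * c := by
  induction l generalizing k with
  | nil =>
    simp only [List.map_nil, List.prod_nil, Units.val_one, Module.End.one_apply, List.length_nil,
      add_zero, Pi.single_eq_same, one_mul, and_true]
    intro a ha
    rw [Pi.single_apply, if_neg ha.ne]
  | cons s l ih =>
    obtain ⟨ih1, ih2⟩ := ih (k + 1) (fun j => by
      have := hl (j + 1)
      rw [add_assoc, add_comm 1 j, this]
      simp)
    have hk : label k = some s.1 := by simpa using hl 0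
    rw [show k + (s :: l).length = k + 1 + l.length by simp; ring]
    set w := (((l.map fun s => unipotentUnit label h s.1 ^ s.2).prod :
      (Module.End ℤ (ℕ → ℤ))ˣ) : Module.End ℤ (ℕ → ℤ)) (Pi.single (k + 1 + l.length) c) with hw
    have key : ∀ a, ((((s :: l).map fun s => unipotentUnit label h s.1 ^ s.2).prod :
        (Module.End ℤ (ℕ → ℤ))ˣ) : Module.End ℤ (ℕ → ℤ)) (Pi.single (k + 1 + l.length) c) a =
        w a + s.2 * labelledShift label s.1 w a := by
      intro a
      rw [List.map_cons, List.prod_cons, Units.val_mul, Module.End.mul_apply, ← hw,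
        unipotentUnit_zpow]
      simp
    refine ⟨fun a ha => ?_, ?_⟩
    · rw [key, ih1 a (by omega)]
      have h0 : labelledShift label s.1 w a = 0 := by
        have : w (a + 1) = 0 := ih1 (a + 1) (by omega)
        simp [labelledShift, this]
      simp [h0]
    · rw [key, ih1 k (by omega)]
      have h0 : labelledShift label s.1 w k = w (k + 1) := by simp [labelledShift, hk]
      rw [h0, ih2]
      simp [mul_assoc]

end Unipotent

/-! ### Free groups are separated by their standard filtration. -/

section FreeGroup

variable {X : Type*}

/-- The new syllable is prepended, merged with the first one, or cancels it. In the last case the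
tail still alternates. -/
theorem FreeGroup.exists_syllables_of_zpow_mul (x : X) (d : ℤ) (hd : d ≠ 0) (l : List (X × ℤ))
    (hl : l.IsChain (fun s t => s.1 ≠ t.1)) (hl0 : ∀ s ∈ l, s.2 ≠ 0) :
    ∃ l' : List (X × ℤ), l'.IsChain (fun s t => s.1 ≠ t.1) ∧ (∀ s ∈ l', s.2 ≠ 0) ∧
      (l'.map fun s => FreeGroup.of s.1 ^ s.2).prod =
        FreeGroup.of x ^ d * (l.map fun s => FreeGroup.of s.1 ^ s.2).prod := by
  match l with
  | [] => exact ⟨[(x, d)], by simp, by simpa using hd, by simp⟩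
  | (y, e) :: t =>
    by_cases hxy : x = y
    · subst hxy
      by_cases hde : d + e = 0
      · refine ⟨t, hl.tail, fun s hs => hl0 s (List.mem_cons_of_mem _ hs), ?_⟩
        simp [← mul_assoc, ← zpow_add, hde]
      · refine ⟨(x, d + e) :: t, ?_, ?_, ?_⟩
        · cases t with
          | nil => simp
          | cons z t =>
            rw [List.isChain_cons_cons] at hl ⊢
            exact hl
        · intro s hs
          rcases List.mem_cons.1 hs with rfl | hs
          · exact hde
          · exact hl0 s (List.mem_cons_of_mem _ hs)
        · simp [← mul_assoc, ← zpow_add]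
    · refine ⟨(x, d) :: (y, e) :: t, List.isChain_cons_cons.2 ⟨hxy, hl⟩, ?_, by simp⟩
      intro s hs
      rcases List.mem_cons.1 hs with rfl | hs
      · exact hd
      · exact hl0 s hs

theorem FreeGroup.exists_syllables (g : FreeGroup X) :
    ∃ l : List (X × ℤ), l.IsChain (fun s t => s.1 ≠ t.1) ∧ (∀ s ∈ l, s.2 ≠ 0) ∧
      (l.map fun s => FreeGroup.of s.1 ^ s.2).prod = g := by
  obtain ⟨L, rfl⟩ : ∃ L, FreeGroup.mk L = g := Quot.exists_rep g
  induction L with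
  | nil => exact ⟨[], by simp, by simp, rfl⟩
  | cons a L ih =>
    obtain ⟨l, h1, h2, h3⟩ := ih
    obtain ⟨x, b⟩ := a
    have key : FreeGroup.mk ((x, b) :: L) =
        FreeGroup.of x ^ (if b then 1 else -1 : ℤ) * FreeGroup.mk L := by
      cases b
      · simp [FreeGroup.of, FreeGroup.invRev]
      · simp [FreeGroup.of]
    rw [key, ← h3]
    exact FreeGroup.exists_syllables_of_zpow_mul x _ (by split_ifs <;> simp) l h1 h2

/-- The word is tested on the representation whose labels are its own letters. If it lay in all
terms of the filtration, the nonzero integer `c`, a matrix entry of its action, would be divisible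
by every power of `p`. -/
theorem FreeGroup.exists_notMem_rfrpFiltration {p : ℕ} (hp : p.Prime) {g : FreeGroup X}
    (hg : g ≠ 1) : ∃ i, g ∉ rfrpFiltration p (FreeGroup X) i := by
  obtain ⟨l, hl, hl0, rfl⟩ := FreeGroup.exists_syllables g
  let label : ℕ → Option X := fun a => (l[a]?).map Prod.fst
  have hlabel : ∀ x a, label a = some x → label (a + 1) ≠ some x := by
    intro x a ha hb
    obtain ⟨s, hs, hsx⟩ := Option.map_eq_some_iff.1 ha
    obtain ⟨t, ht, htx⟩ := Option.map_eq_some_iff.1 hb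
    obtain ⟨h1, rfl⟩ := List.getElem?_eq_some_iff.1 hs
    obtain ⟨h2, rfl⟩ := List.getElem?_eq_some_iff.1 ht
    exact List.isChain_iff_getElem.1 hl a h2 (hsx.trans htx.symm)
  have hne : l ≠ [] := by rintro rfl; simp at hg
  have hlen : 0 < l.length := List.length_pos_of_ne_nil hne
  let f : FreeGroup X →* (Module.End ℤ (ℕ → ℤ))ˣ := FreeGroup.lift (unipotentUnit label hlabel)
  have hf : f (l.map fun s => FreeGroup.of s.1 ^ s.2).prod =
      (l.map fun s => unipotentUnit label hlabel s.1 ^ s.2).prod := by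
    rw [map_list_prod, List.map_map]
    congr 2
    ext1 s
    simp [f]
  by_contra! hall
  let c : ℤ := (l.map Prod.snd).prod * (p : ℤ) ^ l.length
  have hc : c ≠ 0 := by
    refine mul_ne_zero (List.prod_ne_zero ?_) (pow_ne_zero _ (by exact_mod_cast hp.ne_zero))
    intro h0
    obtain ⟨s, hs, hs0⟩ := List.mem_map.1 h0
    exact hl0 s hs hs0
  have hdvd : ∀ i, (p : ℤ) ^ (i + 1) ∣ c := by
    intro i
    have hL := map_mem_of_mem_rfrpFiltration f
      (congruenceUnits (weightFiltration p) (weightFiltration_one p) (weightFiltration_mul p))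
      (fun g => by
        induction g using FreeGroup.induction_on with
        | C1 => rw [f.map_one]; exact one_mem _
        | of x => simpa [f] using unipotentUnit_mem p label hlabel x
        | inv_of x hx => rw [f.map_inv]; exact inv_mem hx
        | mul x y hx hy => rw [f.map_mul]; exact mul_mem hx hy)
      (fun i a ha b hb => commutator_mem_congruenceUnits _ _ _ (weightFiltration_succ_le p) i ha hb)
      (fun i a ha => pow_mem_congruenceUnits _ _ _ (weightFiltration_succ_le p)
        (natCast_mem_weightFiltration p) i ha) i (hall i)
    -- The factor `p ^ l.length` in `c` is there to give the test vector weight `0`.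
    have hv : (Pi.single (0 + l.length) ((p : ℤ) ^ l.length) : ℕ → ℤ) ∈ weightedSequences p 0 := by
      intro a
      by_cases ha : a = 0 + l.length
      · subst ha; simp
      · rw [Pi.single_apply, if_neg ha]; exact dvd_zero _
    have h1 := hL.2.2 0 _ hv 0
    have h2 := (unipotent_apply label hlabel ((p : ℤ) ^ l.length) l 0 (fun j => by simp [label])).2
    rw [hf, LinearMap.sub_apply, Pi.sub_apply, h2, Module.End.one_apply, Pi.single_apply,
      if_neg (by omega), sub_zero] at h1
    simpa using h1
  have hfin : FiniteMultiplicity (p : ℤ) c := by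
    rw [Int.finiteMultiplicity_iff]
    exact ⟨by simpa using hp.ne_one, hc⟩
  obtain ⟨n, hn⟩ := hfin
  exact hn (hdvd n)

end FreeGroup

/-! ### Graphs of groups: the path group -/

namespace GraphOfGroups

variable {V : Type u} {E : Type v} (𝒢 : GraphOfGroups.{u, v, w, x} V E)

section Lift

variable {M : Type*} [Group M]

/-- The homomorphism from the path group given by homomorphisms from the vertex groups and images
of the edges satisfying the edge relations. -/
def lift (h : ∀ b, 𝒢.vertexGroup b →* M) (m : E → M)
    (rel : ∀ e a, m e * h _ (𝒢.tgtHom e a) * (m e)⁻¹ = h _ (𝒢.srcHom e a)) : 𝒢.PathGroup →* M :=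
  QuotientGroup.lift _ (Monoid.Coprod.lift (Monoid.CoprodI.lift h) (FreeGroup.lift m)) (by
    intro z hz
    have hle : Subgroup.normalClosure 𝒢.relators ≤
        (Monoid.Coprod.lift (Monoid.CoprodI.lift h) (FreeGroup.lift m)).ker := by
      refine Subgroup.normalClosure_le_normal ?_
      rintro _ ⟨e, a, rfl⟩
      simp [MonoidHom.mem_ker, rel]
    exact hle hz)

variable (h : ∀ b, 𝒢.vertexGroup b →* M) (m : E → M)
    (rel : ∀ e a, m e * h _ (𝒢.tgtHom e a) * (m e)⁻¹ = h _ (𝒢.srcHom e a))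

@[simp] theorem lift_ofVertex (b : V) (g : 𝒢.vertexGroup b) :
    𝒢.lift h m rel (𝒢.ofVertex b g) = h b g := by
  change Monoid.Coprod.lift (Monoid.CoprodI.lift h) (FreeGroup.lift m)
    (Monoid.Coprod.inl (Monoid.CoprodI.of g)) = _
  simp

@[simp] theorem lift_ofEdge (e : E) : 𝒢.lift h m rel (𝒢.ofEdge e) = m e := by
  change Monoid.Coprod.lift (Monoid.CoprodI.lift h) (FreeGroup.lift m)
    (Monoid.Coprod.inr (FreeGroup.of e)) = _
  simp

end Lift

theorem ofEdge_conj (e : E) (c : 𝒢.edgeGroup e) :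
    𝒢.ofEdge e * 𝒢.ofVertex _ (𝒢.tgtHom e c) * (𝒢.ofEdge e)⁻¹ = 𝒢.ofVertex _ (𝒢.srcHom e c) := by
  rw [← mul_inv_eq_one]
  refine (QuotientGroup.eq_one_iff _).2 (Subgroup.subset_normalClosure ⟨e, c, ?_⟩)
  rfl

theorem pathGroup_eq_top (S : Subgroup 𝒢.PathGroup) (hv : ∀ b g, 𝒢.ofVertex b g ∈ S)
    (he : ∀ e, 𝒢.ofEdge e ∈ S) : S = ⊤ := by
  refine (Subgroup.eq_top_iff' S).2 fun z => ?_
  obtain ⟨y, rfl⟩ := QuotientGroup.mk'_surjective _ z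
  induction y using Monoid.Coprod.induction_on with
  | inl m =>
    induction m using Monoid.CoprodI.induction_on with
    | one => rw [map_one, map_one]; exact one_mem _
    | of b g => exact hv b g
    | mul x y hx hy => rw [map_mul, map_mul]; exact mul_mem hx hy
  | inr n =>
    induction n using FreeGroup.induction_on with
    | C1 => rw [map_one, map_one]; exact one_mem _
    | of e => exact he e
    | inv_of e h => rw [map_inv, map_inv]; exact inv_mem h
    | mul x y hx hy => rw [map_mul, map_mul]; exact mul_mem hx hy
  | mul x y hx hy => rw [map_mul]; exact mul_mem hx hy

theorem fg_pathGroup [Finite V] [Finite E] (h : ∀ b, Group.FG (𝒢.vertexGroup b)) :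
    Group.FG 𝒢.PathGroup := by
  choose S hS hfin using fun b => Group.fg_iff.1 (h b)
  refine Group.fg_iff.2 ⟨(⋃ b, 𝒢.ofVertex b '' S b) ∪ Set.range 𝒢.ofEdge,
    𝒢.pathGroup_eq_top _ (fun b g => ?_) fun e => ?_,
    (Set.finite_iUnion fun b => (hfin b).image _).union (Set.finite_range _)⟩
  · have h1 : g ∈ Subgroup.closure (S b) := by rw [hS]; trivial
    have h2 : 𝒢.ofVertex b g ∈ (Subgroup.closure (S b)).map (𝒢.ofVertex b) := ⟨g, h1, rfl⟩
    rw [MonoidHom.map_closure] at h2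
    refine Subgroup.closure_mono ?_ h2
    exact (Set.subset_iUnion (fun b => 𝒢.ofVertex b '' S b) b).trans Set.subset_union_left
  · exact Subgroup.subset_closure (Or.inr ⟨e, rfl⟩)

/-! ### The path group maps onto the fundamental group. -/

section Retraction

variable (a : V)

open Classical in
/-- A chosen path from `a` to `b`, or `1` if there is none. -/
noncomputable def connector (b : V) : 𝒢.PathGroup :=
  if h : ∃ z, 𝒢.IsPath a b z then h.choose else 1

variable {a} in
theorem isPath_connector {b : V} (h : ∃ z, 𝒢.IsPath a b z) : 𝒢.IsPath a b (𝒢.connector a b) := by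
  rw [connector, dif_pos h]
  exact h.choose_spec

theorem reachable_src_iff (e : E) :
    (∃ z, 𝒢.IsPath a (𝒢.src e) z) ↔ ∃ z, 𝒢.IsPath a (𝒢.tgt e) z :=
  ⟨fun ⟨_, h⟩ => ⟨_, h.edge e⟩, fun ⟨_, h⟩ => ⟨_, h.edgeInv e⟩⟩

open Classical in
/-- The endomorphism of the path group that closes up paths by means of the chosen connecting paths
and is trivial on the vertices and edges not reachable from `a`. -/
noncomputable def closeUp : 𝒢.PathGroup →* 𝒢.PathGroup :=
  𝒢.lift
    (fun b => if ∃ z, 𝒢.IsPath a b z then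
      (MulAut.conj (𝒢.connector a b)).toMonoidHom.comp (𝒢.ofVertex b) else 1)
    (fun e => if ∃ z, 𝒢.IsPath a (𝒢.src e) z then
      𝒢.connector a (𝒢.src e) * 𝒢.ofEdge e * (𝒢.connector a (𝒢.tgt e))⁻¹ else 1)
    (by
      intro e c
      by_cases h : ∃ z, 𝒢.IsPath a (𝒢.src e) z
      · simp only [if_pos h, if_pos ((𝒢.reachable_src_iff a e).1 h)]
        simp [← 𝒢.ofEdge_conj, mul_assoc]
      · simp only [if_neg h, if_neg (fun h' => h ((𝒢.reachable_src_iff a e).2 h'))]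
        simp)

theorem closeUp_mem (z : 𝒢.PathGroup) : 𝒢.closeUp a z ∈ 𝒢.fundamentalGroup a := by
  have := 𝒢.pathGroup_eq_top ((𝒢.fundamentalGroup a).comap (𝒢.closeUp a))
    (fun b g => by
      rw [Subgroup.mem_comap, closeUp, lift_ofVertex]
      split_ifs with h
      · exact ((𝒢.isPath_connector h).vertex g).mul (𝒢.isPath_connector h).inv
      · exact one_mem _)
    (fun e => by
      rw [Subgroup.mem_comap, closeUp, lift_ofEdge]
      split_ifs with h
      · exact ((𝒢.isPath_connector h).edge e).mul
          (𝒢.isPath_connector ((𝒢.reachable_src_iff a e).1 h)).inv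
      · exact one_mem _)
  exact (Subgroup.eq_top_iff' _).1 this z

/-- The homomorphism `closeUp`, with values in the fundamental group. -/
noncomputable def toFundamentalGroup : 𝒢.PathGroup →* 𝒢.fundamentalGroup a :=
  (𝒢.closeUp a).codRestrict _ (𝒢.closeUp_mem a)

/-- The connector chosen from `a` to itself need not be trivial, whence the conjugation. -/
theorem exists_conj_toFundamentalGroup : ∃ c : 𝒢.fundamentalGroup a, ∀ g,
    𝒢.toFundamentalGroup a (𝒢.ofVertex a g) = c * 𝒢.vertexHom a g * c⁻¹ := by
  have h : ∃ z, 𝒢.IsPath a a z := ⟨1, .nil a⟩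
  refine ⟨⟨𝒢.connector a a, 𝒢.isPath_connector h⟩, fun g => Subtype.ext ?_⟩
  change 𝒢.closeUp a (𝒢.ofVertex a g) = _
  rw [closeUp, lift_ofVertex, if_pos h]
  rfl

/-- Functoriality along the map from the path group to the fundamental group, with the conjugation
absorbed by normality. This moves the hypothesis on topologies to the path group. -/
theorem vertexHom_mem_rfrpFiltration {p N : ℕ} {g : 𝒢.vertexGroup a}
    (hg : 𝒢.ofVertex a g ∈ rfrpFiltration p 𝒢.PathGroup N) :
    𝒢.vertexHom a g ∈ rfrpFiltration p (𝒢.fundamentalGroup a) N := by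
  obtain ⟨c, hc⟩ := 𝒢.exists_conj_toFundamentalGroup a
  have h1 := map_mem_rfrpFiltration (𝒢.toFundamentalGroup a) N hg
  rw [hc] at h1
  have h2 := (rfrpFiltration_normal (p := p) N).conj_mem _ h1 c⁻¹
  simpa [mul_assoc] using h2

theorem fg_fundamentalGroup [Finite V] [Finite E] (h : ∀ b, Group.FG (𝒢.vertexGroup b)) :
    Group.FG (𝒢.fundamentalGroup a) := by
  -- On a path, the connectors at the intermediate vertices cancel and only those at its two ends
  -- remain. So every loop at `a` is hit, by its conjugate by the connector at `a`.
  have hle : ∀ b z, 𝒢.IsPath a b z → (∃ z, 𝒢.IsPath a b z) ∧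
      (𝒢.toFundamentalGroup a z : 𝒢.PathGroup) =
        𝒢.connector a a * z * (𝒢.connector a b)⁻¹ := by
    intro b z hz
    refine ⟨⟨z, hz⟩, ?_⟩
    induction hz with
    | nil => simp
    | @vertex b z hz g ih =>
      rw [map_mul, Subgroup.coe_mul, ih]
      have : (𝒢.toFundamentalGroup a (𝒢.ofVertex b g) : 𝒢.PathGroup) =
          𝒢.connector a b * 𝒢.ofVertex b g * (𝒢.connector a b)⁻¹ := by
        change 𝒢.closeUp a _ = _
        rw [closeUp, lift_ofVertex, if_pos ⟨z, hz⟩]; rfl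
      rw [this]; group
    | @edge z e hz ih =>
      rw [map_mul, Subgroup.coe_mul, ih]
      have : (𝒢.toFundamentalGroup a (𝒢.ofEdge e) : 𝒢.PathGroup) =
          𝒢.connector a (𝒢.src e) * 𝒢.ofEdge e * (𝒢.connector a (𝒢.tgt e))⁻¹ := by
        change 𝒢.closeUp a _ = _
        rw [closeUp, lift_ofEdge, if_pos ⟨z, hz⟩]
      rw [this]; group
    | @edgeInv z e hz ih =>
      rw [map_mul, Subgroup.coe_mul, ih]
      have : (𝒢.toFundamentalGroup a (𝒢.ofEdge e) : 𝒢.PathGroup) =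
          𝒢.connector a (𝒢.src e) * 𝒢.ofEdge e * (𝒢.connector a (𝒢.tgt e))⁻¹ := by
        change 𝒢.closeUp a _ = _
        rw [closeUp, lift_ofEdge, if_pos ⟨_, hz.edgeInv e⟩]
      rw [map_inv, Subgroup.coe_inv, this]; group
  have := 𝒢.fg_pathGroup h
  refine Group.fg_of_surjective (f := 𝒢.toFundamentalGroup a) fun y => ?_
  have hc := 𝒢.isPath_connector (⟨1, .nil a⟩ : ∃ z, 𝒢.IsPath a a z)
  have hy : 𝒢.IsPath a a ((𝒢.connector a a)⁻¹ * y * 𝒢.connector a a) :=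
    (hc.inv.mul y.2).mul hc
  refine ⟨_, Subtype.ext ((hle a _ hy).2.trans ?_)⟩
  group

end Retraction

/-! ### Reduced words -/

/-- `Spells a b z L`: the element `z` is represented by a word along an edge path from `a` to `b`.
The list `L` records the edges that are traversed, the direction, and the prefix of the word that
ends at the source of the edge. -/
inductive Spells (a : V) : V → 𝒢.PathGroup → List ((E × 𝒢.PathGroup) × Bool) → Prop
  | nil : Spells a a 1 []
  | vertex {b : V} {z : 𝒢.PathGroup} {L} (h : Spells a b z L) (g : 𝒢.vertexGroup b) :
      Spells a b (z * 𝒢.ofVertex b g) L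
  | edge {z : 𝒢.PathGroup} {L} (e : E) (h : Spells a (𝒢.src e) z L) :
      Spells a (𝒢.tgt e) (z * 𝒢.ofEdge e) (L ++ [((e, z), true)])
  | edgeInv {z : 𝒢.PathGroup} {L} (e : E) (h : Spells a (𝒢.tgt e) z L) :
      Spells a (𝒢.src e) (z * (𝒢.ofEdge e)⁻¹) (L ++ [((e, z * (𝒢.ofEdge e)⁻¹), false)])

variable {𝒢}

theorem Spells.eq_of_nil {a b : V} {z : 𝒢.PathGroup} {L} (h : 𝒢.Spells a b z L) (hL : L = []) :
    ∃ g, z = 𝒢.ofVertex a g := by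
  have : b = a ∧ ∃ g : 𝒢.vertexGroup b, z = 𝒢.ofVertex b g := by
    induction h with
    | nil => exact ⟨rfl, 1, (map_one _).symm⟩
    | vertex h g ih =>
      obtain ⟨h1, g', rfl⟩ := ih hL
      exact ⟨h1, g' * g, (map_mul _ _ _).symm⟩
    | edge => simp at hL
    | edgeInv => simp at hL
  obtain ⟨rfl, hg⟩ := this
  exact hg

/-- For a backward crossing the list stores the prefix `u` that already includes the inverse edge
letter. Undoing the crossing therefore leaves `u` times the edge. -/
theorem Spells.eq_of_concat_false {a b : V} {z u : 𝒢.PathGroup} {L L' e} (h : 𝒢.Spells a b z L)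
    (hL : L = L' ++ [((e, u), false)]) :
    ∃ g, z = u * 𝒢.ofVertex b g ∧ 𝒢.Spells a (𝒢.tgt e) (u * 𝒢.ofEdge e) L' := by
  induction h with
  | nil => simp at hL
  | vertex h g ih =>
    obtain ⟨g', rfl, h2⟩ := ih hL
    exact ⟨g' * g, by rw [map_mul, mul_assoc], h2⟩
  | edge e' h ih =>
    have := (List.append_inj' hL rfl).2
    simp at this
  | edgeInv e' h ih =>
    obtain ⟨rfl, h1⟩ := List.append_inj' hL rfl
    simp only [List.cons.injEq, Prod.mk.injEq, and_true] at h1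
    obtain ⟨rfl, rfl⟩ := h1
    exact ⟨1, by simp, by simpa using h⟩

theorem Spells.eq_of_concat_true {a b : V} {z u : 𝒢.PathGroup} {L L' e} (h : 𝒢.Spells a b z L)
    (hL : L = L' ++ [((e, u), true)]) :
    ∃ g, z = u * 𝒢.ofEdge e * 𝒢.ofVertex b g ∧ 𝒢.Spells a (𝒢.src e) u L' := by
  induction h with
  | nil => simp at hL
  | vertex h g ih =>
    obtain ⟨g', rfl, h2⟩ := ih hL
    exact ⟨g' * g, by rw [map_mul, mul_assoc], h2⟩
  | edgeInv e' h ih =>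
    have := (List.append_inj' hL rfl).2
    simp at this
  | edge e' h ih =>
    obtain ⟨rfl, h1⟩ := List.append_inj' hL rfl
    simp only [List.cons.injEq, Prod.mk.injEq, and_true] at h1
    obtain ⟨rfl, rfl⟩ := h1
    exact ⟨1, by simp, h⟩

variable (𝒢) in
/-- The turn `y` at the edge `e` cannot be shortened by the edge relation. -/
def IsReducedTurn (e : E) (y : 𝒢.PathGroup) : Prop :=
  (∃ g, g ∉ (𝒢.srcHom e).range ∧ y = 𝒢.ofVertex _ g) ∨
    ∃ g, g ∉ (𝒢.tgtHom e).range ∧ y = 𝒢.ofEdge e * 𝒢.ofVertex _ g * (𝒢.ofEdge e)⁻¹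

/-- Letters are appended one at a time. If a new crossing undoes the last one through an element of
the edge group, the edge relation removes both crossings. -/
theorem IsPath.exists_spells {a b : V} {z : 𝒢.PathGroup} (h : 𝒢.IsPath a b z) :
    ∃ L, 𝒢.Spells a b z L ∧ L.IsChain fun s t =>
      s.1.1 = t.1.1 → s.2 ≠ t.2 → 𝒢.IsReducedTurn s.1.1 (s.1.2⁻¹ * t.1.2) := by
  induction h with
  | nil => exact ⟨[], .nil, by simp⟩
  | vertex _ g ih =>
    obtain ⟨L, hL, hc⟩ := ih
    exact ⟨L, hL.vertex g, hc⟩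
  | @edge z e _ ih =>
    obtain ⟨L, hL, hc⟩ := ih
    by_cases hgood : ∀ s ∈ L.getLast?, s.1.1 = e → s.2 ≠ true →
        𝒢.IsReducedTurn s.1.1 (s.1.2⁻¹ * z)
    · refine ⟨_, hL.edge e, List.isChain_append.2 ⟨hc, by simp, fun s hs t ht => ?_⟩⟩
      obtain rfl : t = ((e, z), true) := by simpa [eq_comm] using ht
      exact hgood s hs
    · push Not at hgood
      obtain ⟨⟨⟨e, u⟩, _⟩, hs, rfl, hb, hturn⟩ := hgood
      obtain rfl := Bool.eq_false_of_not_eq_true hb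
      obtain ⟨L', rfl⟩ := List.mem_getLast?_eq_getLast hs |>.elim fun h1 h2 =>
        (⟨L.dropLast, by rw [h2]; exact (List.dropLast_append_getLast h1).symm⟩ :
          ∃ L', L = L' ++ [((e, u), false)])
      obtain ⟨g, rfl, hL'⟩ := hL.eq_of_concat_false rfl
      obtain ⟨c, rfl⟩ : g ∈ (𝒢.srcHom e).range := by
        by_contra hg
        exact hturn (Or.inl ⟨g, hg, by simp⟩)
      refine ⟨L', ?_, hc.left_of_append⟩
      -- As `φ_src(c) t_e = t_e φ_tgt(c)`, the two crossings together amount to a vertex element.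
      have := hL'.vertex (𝒢.tgtHom e c)
      rw [← 𝒢.ofEdge_conj]
      simpa [mul_assoc] using this
  | @edgeInv z e _ ih =>
    obtain ⟨L, hL, hc⟩ := ih
    by_cases hgood : ∀ s ∈ L.getLast?, s.1.1 = e → s.2 ≠ false →
        𝒢.IsReducedTurn s.1.1 (s.1.2⁻¹ * (z * (𝒢.ofEdge e)⁻¹))
    · refine ⟨_, hL.edgeInv e, List.isChain_append.2 ⟨hc, by simp, fun s hs t ht => ?_⟩⟩
      obtain rfl : t = ((e, z * (𝒢.ofEdge e)⁻¹), false) := by simpa [eq_comm] using ht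
      exact hgood s hs
    · push Not at hgood
      obtain ⟨⟨⟨e, u⟩, _⟩, hs, rfl, hb, hturn⟩ := hgood
      obtain rfl := Bool.eq_true_of_not_eq_false hb
      obtain ⟨L', rfl⟩ := List.mem_getLast?_eq_getLast hs |>.elim fun h1 h2 =>
        (⟨L.dropLast, by rw [h2]; exact (List.dropLast_append_getLast h1).symm⟩ :
          ∃ L', L = L' ++ [((e, u), true)])
      obtain ⟨g, rfl, hL'⟩ := hL.eq_of_concat_true rfl
      obtain ⟨c, rfl⟩ : g ∈ (𝒢.tgtHom e).range := by
        by_contra hg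
        exact hturn (Or.inr ⟨g, hg, by simp [mul_assoc]⟩)
      refine ⟨L', ?_, hc.left_of_append⟩
      have := hL'.vertex (𝒢.srcHom e c)
      rw [← 𝒢.ofEdge_conj] at this
      simpa [mul_assoc] using this

/-! ### Separating reduced words from the identity -/

section Quotient

open scoped Pointwise

variable (𝒢) (K : Subgroup 𝒢.PathGroup) [K.Normal]

/-- The image of an edge group in a quotient of the path group. -/
def edgeImage (e : E) : Subgroup (𝒢.PathGroup ⧸ K) :=
  (𝒢.srcHom e).range.map ((QuotientGroup.mk' K).comp (𝒢.ofVertex (𝒢.src e)))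

/-- Left translation of the second coordinate, as an action on a free group. -/
def translation (E Q : Type*) [Group Q] : Q →* MulAut (FreeGroup (E × Set Q)) where
  toFun q := FreeGroup.freeGroupCongr ((Equiv.refl E).prodCongr (MulAction.toPerm q))
  map_one' := by
    ext x
    have : ((Equiv.refl E).prodCongr (MulAction.toPerm (1 : Q)) : E × Set Q ≃ E × Set Q) =
      Equiv.refl _ := by ext1 ⟨e, S⟩; simp
    rw [this, FreeGroup.freeGroupCongr_refl]
    rfl
  map_mul' q r := by
    ext x
    have : ((Equiv.refl E).prodCongr (MulAction.toPerm (q * r)) : E × Set Q ≃ E × Set Q) =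
      ((Equiv.refl E).prodCongr (MulAction.toPerm r)).trans
        ((Equiv.refl E).prodCongr (MulAction.toPerm q)) := by
      ext1 ⟨e, S⟩; simp [mul_smul]
    rw [this, ← FreeGroup.freeGroupCongr_trans]
    rfl

theorem translation_of {E Q : Type*} [Group Q] (q : Q) (e : E) (S : Set Q) :
    translation E Q q (FreeGroup.of (e, S)) = FreeGroup.of (e, q • S) := by
  simp [translation]

/-- The edge group stabilizes its own coset. This is what makes `crossingHom` respect the edge
relations. -/
theorem translation_edgeImage (e : E) (c : 𝒢.edgeGroup e) :
    (QuotientGroup.mk' K (𝒢.ofVertex _ (𝒢.srcHom e c))) • (𝒢.edgeImage K e : Set (𝒢.PathGroup ⧸ K)) =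
      (𝒢.edgeImage K e : Set (𝒢.PathGroup ⧸ K)) :=
  smul_coe_set ⟨_, ⟨c, rfl⟩, rfl⟩

/-- The homomorphism recording the lifts to the quotient of the Bass–Serre tree by `K` of the edges
traversed by a word. -/
def crossingHom : 𝒢.PathGroup →*
    FreeGroup (E × Set (𝒢.PathGroup ⧸ K)) ⋊[translation E (𝒢.PathGroup ⧸ K)] (𝒢.PathGroup ⧸ K) :=
  𝒢.lift (fun b => SemidirectProduct.inr.comp ((QuotientGroup.mk' K).comp (𝒢.ofVertex b)))
    (fun e => ⟨FreeGroup.of (e, (𝒢.edgeImage K e : Set (𝒢.PathGroup ⧸ K))), QuotientGroup.mk' K (𝒢.ofEdge e)⟩) (by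
      intro e c
      rw [mul_inv_eq_iff_eq_mul]
      have h1 := congrArg (QuotientGroup.mk' K) (mul_inv_eq_iff_eq_mul.1 (𝒢.ofEdge_conj e c))
      rw [map_mul, map_mul] at h1
      refine SemidirectProduct.ext ?_ ?_
      · simp only [SemidirectProduct.mul_left, MonoidHom.comp_apply, SemidirectProduct.left_inr,
          map_one, mul_one, SemidirectProduct.right_inr, one_mul]
        rw [translation_of, translation_edgeImage]
      · exact h1)

theorem crossingHom_right (z : 𝒢.PathGroup) : (𝒢.crossingHom K z).right = QuotientGroup.mk' K z := by
  have : SemidirectProduct.rightHom.comp (𝒢.crossingHom K) = QuotientGroup.mk' K := by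
    refine MonoidHom.eq_of_eqOn_top ?_
    rw [← 𝒢.pathGroup_eq_top (MonoidHom.eqLocus (SemidirectProduct.rightHom.comp
      (𝒢.crossingHom K)) (QuotientGroup.mk' K)) (fun b g => ?_) fun e => ?_]
    · exact fun z hz => hz
    · change (𝒢.crossingHom K _).right = _
      rw [crossingHom, lift_ofVertex]; rfl
    · change (𝒢.crossingHom K _).right = _
      rw [crossingHom, lift_ofEdge]
  exact DFunLike.congr_fun this z

variable {𝒢} in
-- A letter contributes its generator translated by the class of the preceding prefix, which is the
-- coset of the edge that is crossed. For an inverse letter, inversion in the semidirect product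
-- adds a translation by `t_e⁻¹`; this is why the recorded prefix ends at the source in both
-- directions.
theorem Spells.crossingHom_left {a b : V} {z : 𝒢.PathGroup} {L} (h : 𝒢.Spells a b z L) :
    (𝒢.crossingHom K z).left = FreeGroup.mk (L.map fun s =>
      ((s.1.1, QuotientGroup.mk' K s.1.2 • (𝒢.edgeImage K s.1.1 : Set (𝒢.PathGroup ⧸ K))), s.2)) := by
  induction h with
  | nil => rw [map_one]; rfl
  | vertex h g ih =>
    rw [map_mul, SemidirectProduct.mul_left, ih]
    have : (𝒢.crossingHom K (𝒢.ofVertex _ g)).left = 1 := by rw [crossingHom, lift_ofVertex]; rfl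
    rw [this, map_one, mul_one]
  | @edge z L e h ih =>
    rw [map_mul, SemidirectProduct.mul_left, ih, crossingHom_right]
    have : (𝒢.crossingHom K (𝒢.ofEdge e)).left = FreeGroup.of (e, (𝒢.edgeImage K e : Set (𝒢.PathGroup ⧸ K))) := by
      rw [crossingHom, lift_ofEdge]
    rw [this, translation_of, List.map_append, ← FreeGroup.mul_mk]
    rfl
  | @edgeInv z L e h ih =>
    rw [map_mul, SemidirectProduct.mul_left, ih, crossingHom_right, map_inv,
      SemidirectProduct.inv_left, crossingHom_right]
    have : (𝒢.crossingHom K (𝒢.ofEdge e)).left = FreeGroup.of (e, (𝒢.edgeImage K e : Set (𝒢.PathGroup ⧸ K))) := by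
      rw [crossingHom, lift_ofEdge]
    rw [this, ← MulAut.mul_apply, ← map_mul, ← map_inv, ← map_mul, map_inv, translation_of,
      List.map_append, ← FreeGroup.mul_mk]
    rfl

end Quotient

/-! ### Separation of turns and of reduced words by the filtration. -/

section Core

open scoped Pointwise

variable {p : ℕ}

/-- Closedness gives a coset of some `K_i` of the vertex group that misses the edge group, and the
topological hypothesis puts the part of `K_N(F)` in the vertex group inside `K_i`. A turn at the
target is first conjugated by the edge. The conclusion says that `y` stays outside the edge image
modulo `K_N(F)`. -/
theorem exists_turn_separated
    (hclosed : ∀ e, IsRFRpClosed p (𝒢.srcHom e).range ∧ IsRFRpClosed p (𝒢.tgtHom e).range)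
    (htop : ∀ b i, ∃ N, ∀ g, 𝒢.ofVertex b g ∈ rfrpFiltration p 𝒢.PathGroup N →
      g ∈ rfrpFiltration p (𝒢.vertexGroup b) i) {e : E} {y : 𝒢.PathGroup}
    (h : 𝒢.IsReducedTurn e y) : ∃ N, ∀ c,
      y⁻¹ * 𝒢.ofVertex _ (𝒢.srcHom e c) ∉ rfrpFiltration p 𝒢.PathGroup N := by
  obtain ⟨g, hg, rfl⟩ | ⟨g, hg, rfl⟩ := h
  · obtain ⟨i, hi⟩ := (hclosed e).1.exists_notMem hg
    obtain ⟨N, hN⟩ := htop _ i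
    refine ⟨N, fun c hc => ?_⟩
    rw [← map_inv, ← map_mul] at hc
    exact hi _ (hN _ hc) ⟨c, by simp⟩
  · obtain ⟨i, hi⟩ := (hclosed e).2.exists_notMem hg
    obtain ⟨N, hN⟩ := htop _ i
    refine ⟨N, fun c hc => ?_⟩
    have h1 := (rfrpFiltration_normal N).conj_mem _ hc (𝒢.ofEdge e)⁻¹
    rw [← 𝒢.ofEdge_conj] at h1
    have h2 : 𝒢.ofVertex _ (g⁻¹ * 𝒢.tgtHom e c) ∈ rfrpFiltration p 𝒢.PathGroup N := by
      rw [map_mul, map_inv]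
      convert h1 using 1
      group
    exact hi _ (hN _ h2) ⟨c, by simp⟩

theorem exists_chain_separated
    (hclosed : ∀ e, IsRFRpClosed p (𝒢.srcHom e).range ∧ IsRFRpClosed p (𝒢.tgtHom e).range)
    (htop : ∀ b i, ∃ N, ∀ g, 𝒢.ofVertex b g ∈ rfrpFiltration p 𝒢.PathGroup N →
      g ∈ rfrpFiltration p (𝒢.vertexGroup b) i) (L : List ((E × 𝒢.PathGroup) × Bool))
    (h : L.IsChain fun s t =>
      s.1.1 = t.1.1 → s.2 ≠ t.2 → 𝒢.IsReducedTurn s.1.1 (s.1.2⁻¹ * t.1.2)) :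
    ∃ N, L.IsChain fun s t => s.1.1 = t.1.1 → s.2 ≠ t.2 → ∀ c,
      (s.1.2⁻¹ * t.1.2)⁻¹ * 𝒢.ofVertex _ (𝒢.srcHom s.1.1 c) ∉
        rfrpFiltration p 𝒢.PathGroup N := by
  induction L with
  | nil => exact ⟨0, by simp⟩
  | cons s L ih =>
    cases L with
    | nil => exact ⟨0, by simp⟩
    | cons t L =>
      rw [List.isChain_cons_cons] at h
      obtain ⟨M, hM⟩ := ih h.2
      obtain ⟨N, hN⟩ : ∃ N, s.1.1 = t.1.1 → s.2 ≠ t.2 → ∀ c,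
          (s.1.2⁻¹ * t.1.2)⁻¹ * 𝒢.ofVertex _ (𝒢.srcHom s.1.1 c) ∉
            rfrpFiltration p 𝒢.PathGroup N := by
        by_cases h1 : s.1.1 = t.1.1 ∧ s.2 ≠ t.2
        · obtain ⟨N, hN⟩ := exists_turn_separated hclosed htop (h.1 h1.1 h1.2)
          exact ⟨N, fun _ _ => hN⟩
        · exact ⟨0, fun h2 h3 => (h1 ⟨h2, h3⟩).elim⟩
      refine ⟨max M N, List.isChain_cons_cons.2 ⟨fun h1 h2 c hc => ?_, hM.imp ?_⟩⟩
      · exact hN h1 h2 c (rfrpFiltration_antitone (le_max_right M N) hc)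
      · exact fun s t hst h1 h2 c hc =>
          hst h1 h2 c (rfrpFiltration_antitone (le_max_left M N) hc)

theorem exists_notMem_rfrpFiltration (hp : p.Prime) (hG : ∀ b, IsRFRp p (𝒢.vertexGroup b))
    (hclosed : ∀ e, IsRFRpClosed p (𝒢.srcHom e).range ∧ IsRFRpClosed p (𝒢.tgtHom e).range)
    (htop : ∀ b i, ∃ N, ∀ g, 𝒢.ofVertex b g ∈ rfrpFiltration p 𝒢.PathGroup N →
      g ∈ rfrpFiltration p (𝒢.vertexGroup b) i)
    {a b : V} {z : 𝒢.PathGroup} (hz : 𝒢.IsPath a b z) (hne : z ≠ 1) :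
    ∃ i, z ∉ rfrpFiltration p 𝒢.PathGroup i := by
  obtain ⟨L, hL, hc⟩ := hz.exists_spells
  by_cases hnil : L = []
  · obtain ⟨g, rfl⟩ := hL.eq_of_nil hnil
    obtain ⟨i, hi⟩ := (hG a).exists_notMem (g := g) (by rintro rfl; simp at hne)
    obtain ⟨N, hN⟩ := htop a i
    exact ⟨N, fun h => hi (hN g h)⟩
  · obtain ⟨N, hN⟩ := exists_chain_separated hclosed htop L hc
    let K := rfrpFiltration p 𝒢.PathGroup N
    by_cases hzN : z ∈ K
    swap
    · exact ⟨N, hzN⟩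
    -- Elements of `K` have trivial second coordinate, so the first coordinate is multiplicative on
    -- `K`.
    let f : K →* FreeGroup (E × Set (𝒢.PathGroup ⧸ K)) :=
      MonoidHom.mk' (fun y => (𝒢.crossingHom K y).left) (fun x y => by
        have : QuotientGroup.mk' K (x : 𝒢.PathGroup) = 1 := (QuotientGroup.eq_one_iff _).2 x.2
        rw [Subgroup.coe_mul, map_mul, SemidirectProduct.mul_left, crossingHom_right, this]
        simp)
    -- A cancellation would need two consecutive crossings of one edge in opposite directions with
    -- the same coset modulo `K`, which the choice of `N` excludes.
    have hred : FreeGroup.IsReduced (L.map fun s =>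
        ((s.1.1, QuotientGroup.mk' K s.1.2 • (𝒢.edgeImage K s.1.1 : Set (𝒢.PathGroup ⧸ K))), s.2)) := by
      rw [FreeGroup.IsReduced, List.isChain_map]
      refine hN.imp fun s t hst heq => ?_
      by_contra hb
      obtain ⟨h1, h2⟩ := Prod.ext_iff.1 heq
      obtain ⟨⟨e, u⟩, _⟩ := s
      obtain ⟨⟨e', u'⟩, _⟩ := t
      obtain rfl : e = e' := h1
      replace h2 : QuotientGroup.mk' K u • (𝒢.edgeImage K e : Set (𝒢.PathGroup ⧸ K)) =
        QuotientGroup.mk' K u' • (𝒢.edgeImage K e : Set (𝒢.PathGroup ⧸ K)) := h2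
      rw [← smul_left_cancel_iff (QuotientGroup.mk' K u)⁻¹, inv_smul_smul, smul_smul] at h2
      have h3 : (QuotientGroup.mk' K u)⁻¹ * QuotientGroup.mk' K u' ∈ 𝒢.edgeImage K e := by
        rw [← SetLike.mem_coe, h2]
        exact ⟨1, one_mem _, by simp⟩
      obtain ⟨_, ⟨c, rfl⟩, hcc⟩ := h3
      refine hst rfl hb c ?_
      rw [← QuotientGroup.eq_one_iff (N := K)]
      change QuotientGroup.mk' K _ = 1
      rw [map_mul, map_inv, inv_mul_eq_one, map_mul, map_inv]
      exact hcc.symm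
    have hf : f ⟨z, hzN⟩ ≠ 1 := by
      classical
      change (𝒢.crossingHom K z).left ≠ 1
      rw [hL.crossingHom_left K, Ne, ← FreeGroup.toWord_eq_nil_iff, FreeGroup.toWord_mk,
        hred.reduce_eq]
      simpa using hnil
    obtain ⟨i, hi⟩ := FreeGroup.exists_notMem_rfrpFiltration hp hf
    exact ⟨N + i, fun h => hi (map_mem_rfrpFiltration_add f i hzN h)⟩

theorem isRFRp_fundamentalGroup [Finite V] [Finite E] (hp : p.Prime)
    (hG : ∀ b, IsRFRp p (𝒢.vertexGroup b))
    (hclosed : ∀ e, IsRFRpClosed p (𝒢.srcHom e).range ∧ IsRFRpClosed p (𝒢.tgtHom e).range)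
    (htop : ∀ b, InducesRFRpTopology p (𝒢.vertexHom b)) (a : V) :
    IsRFRp p (𝒢.fundamentalGroup a) := by
  refine .of_exists_notMem (𝒢.fg_fundamentalGroup a fun b => (hG b).1) fun z hz => ?_
  -- Membership descends from the path group to the fundamental group in the topological hypothesis,
  -- and ascends along the inclusion for the conclusion.
  obtain ⟨i, hi⟩ := exists_notMem_rfrpFiltration hp hG hclosed (fun b i => by
    obtain ⟨N, hN⟩ := (htop b).exists_mem i
    exact ⟨N, fun g hg => hN g (𝒢.vertexHom_mem_rfrpFiltration b hg)⟩) z.2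
    (fun h => hz (Subtype.ext h))
  exact ⟨i, fun h => hi (map_mem_rfrpFiltration (𝒢.fundamentalGroup a).subtype i h)⟩

end Core

end GraphOfGroups

/-! ### Group-valued cocycles on paths -/

/-- A function on the paths of `X` with values in a group that is multiplicative and invariant
under homotopy, with the order of multiplication of the fundamental group of Mathlib. -/
structure PathCocycle (X : Type*) [TopologicalSpace X] (G : Type*) [Group G] where
  toFun : ∀ {x y : X}, Path x y → G
  trans : ∀ {x y z : X} (γ : Path x y) (γ' : Path y z), toFun (γ.trans γ') = toFun γ' * toFun γ
  homotopic : ∀ {x y : X} (γ γ' : Path x y), γ.Homotopic γ' → toFun γ = toFun γ'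

/-- A function on the paths of `X` with values in a group that is multiplicative and invariant
under homotopy as long as paths and homotopies run inside `U`. -/
structure LocalPathCocycle {X : Type*} [TopologicalSpace X] (U : Set X) (G : Type*) [Group G] where
  toFun : ∀ {x y : X}, Path x y → G
  trans : ∀ {x y z : X} (γ : Path x y) (γ' : Path y z), (∀ t, γ t ∈ U) → (∀ t, γ' t ∈ U) →
    toFun (γ.trans γ') = toFun γ' * toFun γ
  homotopic : ∀ {x y : X} (γ γ' : Path x y) (F : γ.Homotopy γ'), (∀ z, F z ∈ U) →
    toFun γ = toFun γ'

/-- Allows paths equal as functions to be exchanged when their end points agree only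
propositionally. -/
theorem Path.forall_of_eqOn {X : Type*} [TopologicalSpace X] {P : ∀ {x y : X}, Path x y → Prop}
    {x y x' y' : X} {γ : Path x y} {γ' : Path x' y'} (h : ∀ t, γ t = γ' t) (hP : P γ) : P γ' := by
  obtain rfl : x = x' := by simpa using h 0
  obtain rfl : y = y' := by simpa using h 1
  obtain rfl : γ = γ' := by ext t; exact h t
  exact hP

theorem Path.apply_congr {X : Type*} [TopologicalSpace X] {α : Sort*} (c : ∀ {x y : X}, Path x y → α)
    {x y x' y' : X} {γ : Path x y} {γ' : Path x' y'} (h : ∀ t, γ t = γ' t) : c γ = c γ' := by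
  obtain rfl : x = x' := by simpa using h 0
  obtain rfl : y = y' := by simpa using h 1
  obtain rfl : γ = γ' := by ext t; exact h t
  rfl

/-- A subdivision puts each piece in one set of the cover, and the path is homotopic to the
concatenation of its pieces. -/
theorem Path.induction_on_cover {X : Type*} [TopologicalSpace X] {ι : Type*} {U : ι → Set X}
    (hU : ∀ i, IsOpen (U i)) (hcov : ∀ x, ∃ i, x ∈ U i) {P : ∀ {x y : X}, Path x y → Prop}
    (htrans : ∀ {x y z : X} (γ : Path x y) (γ' : Path y z), P γ → P γ' → P (γ.trans γ'))
    (hhom : ∀ {x y : X} (γ γ' : Path x y), γ.Homotopic γ' → P γ → P γ')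
    (hloc : ∀ i {x y : X} (γ : Path x y), (∀ t, γ t ∈ U i) → P γ) {x y : X} (γ : Path x y) :
    P γ := by
  obtain ⟨t, ht0, htm, ⟨n, hn⟩, hti⟩ := exists_monotone_Icc_subset_open_cover_unitInterval
    (c := fun i => γ ⁻¹' U i) (fun i => (hU i).preimage γ.continuous)
    (fun s _ => Set.mem_iUnion.2 (hcov (γ s)))
  have key : ∀ m, P (γ.subpath 0 (t m)) := by
    intro m
    induction m with
    | zero =>
      rw [ht0, Path.subpath_self]
      obtain ⟨i, hi⟩ := hcov (γ 0)
      exact hloc i _ (fun _ => hi)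
    | succ m ih =>
      refine hhom _ _ ⟨Path.Homotopy.subpathTransSubpath γ 0 (t m) (t (m + 1))⟩ (htrans _ _ ih ?_)
      obtain ⟨i, hi⟩ := hti m
      refine hloc i _ fun s => ?_
      have h1 : γ.subpath (t m) (t (m + 1)) s ∈ Set.range (γ.subpath (t m) (t (m + 1))) := ⟨s, rfl⟩
      rw [Path.range_subpath_of_le _ _ _ (htm (Nat.le_succ m))] at h1
      obtain ⟨r, hr, hrs⟩ := h1
      rw [← hrs]
      exact hi hr
  have h1 := key n
  rw [hn n le_rfl] at h1
  refine Path.forall_of_eqOn (P := P) (fun s => ?_) h1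
  simp

/-- Paths with common end points in a real vector space are homotopic along segments. -/
noncomputable def Path.affineHomotopy {E : Type*} [NormedAddCommGroup E] [NormedSpace ℝ E] {x y : E}
    (γ γ' : Path x y) : γ.Homotopy γ' where
  toFun z := AffineMap.lineMap (γ z.2) (γ' z.2) (z.1 : ℝ)
  continuous_toFun := by
    simp only [AffineMap.lineMap_apply_module]
    fun_prop
  map_zero_left := by simp
  map_one_left := by simp
  prop' t z hz := by
    rcases hz with rfl | rfl <;> simp

namespace LocalPathCocycle

variable {X : Type*} [TopologicalSpace X] {U : Set X} {G : Type*} [Group G]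
  (c : LocalPathCocycle U G)

theorem refl {x : X} (hx : x ∈ U) : c.toFun (Path.refl x) = 1 := by
  have := c.trans (Path.refl x) (Path.refl x) (fun _ => hx) (fun _ => hx)
  rw [Path.refl_trans_refl] at this
  exact (mul_eq_left.1 this.symm)

variable {E : Type*} [NormedAddCommGroup E] [NormedSpace ℝ E]

theorem eq_of_convex (f : C(E, X)) {N : Set E} (hN : Convex ℝ N) (hNU : ∀ x ∈ N, f x ∈ U) {x y : E}
    (γ γ' : Path x y) (hγ : ∀ t, γ t ∈ N) (hγ' : ∀ t, γ' t ∈ N) :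
    c.toFun (γ.map f.continuous) = c.toFun (γ'.map f.continuous) := by
  refine c.homotopic _ _ ((γ.affineHomotopy γ').map f) fun z => hNU _ ?_
  exact hN.lineMap_mem (hγ z.2) (hγ' z.2) ⟨z.1.2.1, z.1.2.2⟩

theorem segment_mem {N : Set E} (hN : Convex ℝ N) {x y : E} (hx : x ∈ N) (hy : y ∈ N) (t : I) :
    Path.segment x y t ∈ N :=
  hN.lineMap_mem hx hy ⟨t.2.1, t.2.2⟩

/-- The segment and the broken line are homotopic inside the convex set, whose image lies in `U`. -/
theorem segment_mul (f : C(E, X)) {N : Set E} (hN : Convex ℝ N) (hNU : ∀ x ∈ N, f x ∈ U) {x y z : E}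
    (hx : x ∈ N) (hy : y ∈ N) (hz : z ∈ N) :
    c.toFun ((Path.segment x z).map f.continuous) =
      c.toFun ((Path.segment y z).map f.continuous) *
        c.toFun ((Path.segment x y).map f.continuous) := by
  rw [← c.trans _ _ (fun t => hNU _ (segment_mem hN hx hy t))
    (fun t => hNU _ (segment_mem hN hy hz t)), ← Path.map_trans]
  refine c.eq_of_convex f hN hNU _ _ (segment_mem hN hx hz) fun t => ?_
  rw [Path.trans_apply]
  split_ifs
  · exact segment_mem hN hx hy _
  · exact segment_mem hN hy hz _

end LocalPathCocycle

/-! ### Potentials on convex sets -/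

section Potential

variable {E : Type*} [NormedAddCommGroup E] [NormedSpace ℝ E] {G : Type*} [Group G]

theorem exists_nat_dist_lineMap_lt {x y : E} {D ε : ℝ} (hD : dist x y ≤ D) {n : ℕ}
    (hn : D < ε * n) (hn0 : 0 < n) (k : ℕ) :
    dist (AffineMap.lineMap x y ((k : ℝ) / n) : E) (AffineMap.lineMap x y (((k + 1 : ℕ) : ℝ) / n)) <
      ε := by
  have hn' : (0 : ℝ) < n := by exact_mod_cast hn0
  rw [dist_lineMap_lineMap, Real.dist_eq]
  have : (k : ℝ) / n - ((k + 1 : ℕ) : ℝ) / n = -(1 / n) := by push_cast; ring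
  rw [this, abs_neg, abs_of_pos (by positivity), one_div, inv_mul_eq_div, div_lt_iff₀ hn']
  exact hD.trans_lt hn

/-- `g x` is the product of `d` along a fine subdivision of the segment from `x₀` to `x`. For nearby
`x` and `y`, the strip between their segments is cut into quadrilaterals, each divided by a diagonal
into two triangles on which the cocycle identity applies. -/
theorem exists_potential_of_local_cocycle {K : Set E} (hK : Convex ℝ K) (hKb : Bornology.IsBounded K)
    (d : E → E → G) {δ : ℝ} (hδ : 0 < δ) (hd : ∀ x ∈ K, ∀ y ∈ K, ∀ z ∈ K, dist x y < δ →
      dist x z < δ → d x z = d y z * d x y) :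
    ∃ g : E → G, ∀ x ∈ K, ∀ y ∈ K, dist x y < δ / 2 → d x y = g y * (g x)⁻¹ := by
  rcases K.eq_empty_or_nonempty with rfl | ⟨x₀, hx₀⟩
  · exact ⟨1, by simp⟩
  obtain ⟨D, hD⟩ := hKb.subset_closedBall x₀
  -- Subdivision steps shorter than `δ / 2` keep the diagonals, bounded by the sum of two sides,
  -- shorter than `δ`.
  obtain ⟨n, hn⟩ := exists_nat_gt (max (D / (δ / 2)) 0)
  have hn0 : 0 < n := by exact_mod_cast (le_max_right _ _).trans_lt hn
  have hnD : D < δ / 2 * n := by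
    have := (le_max_left _ _).trans_lt hn
    rwa [div_lt_iff₀ (by positivity), mul_comm] at this
  have hn' : (0 : ℝ) < n := by exact_mod_cast hn0
  let q : E → ℕ → E := fun x k => AffineMap.lineMap x₀ x ((k : ℝ) / n)
  have hq : ∀ x ∈ K, ∀ k ≤ n, q x k ∈ K := fun x hx k hk =>
    hK.lineMap_mem hx₀ hx ⟨by positivity, by rw [div_le_one hn']; exact_mod_cast hk⟩
  let P : E → ℕ → G := fun x k => Nat.rec 1 (fun k r => d (q x k) (q x (k + 1)) * r) k
  have hstep : ∀ x ∈ K, ∀ k, dist (q x k) (q x (k + 1)) < δ / 2 := fun x hx k =>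
    exists_nat_dist_lineMap_lt (by rw [dist_comm]; exact hD hx) hnD hn0 k
  refine ⟨fun x => P x n, fun x hx y hy hxy => ?_⟩
  have hdist : ∀ k ≤ n, dist (q x k) (q y k) < δ / 2 := by
    intro k hk
    refine lt_of_le_of_lt ?_ hxy
    have h1 : q x k - q y k = ((k : ℝ) / n) • (x - y) := by
      simp only [q, AffineMap.lineMap_apply_module]
      module
    rw [dist_eq_norm, h1, norm_smul, dist_eq_norm, Real.norm_of_nonneg (by positivity)]
    refine mul_le_of_le_one_left (norm_nonneg _) ?_
    rw [div_le_one hn']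
    exact_mod_cast hk
  have key : ∀ k ≤ n, d (q x k) (q y k) * P x k = P y k := by
    intro k
    induction k with
    | zero =>
      intro _
      have h0 : ∀ x, q x 0 = x₀ := fun x => by simp [q]
      -- The degenerate triangle gives `d x₀ x₀ = 1`.
      have h1 := hd x₀ hx₀ x₀ hx₀ x₀ hx₀ (by simpa using hδ) (by simpa using hδ)
      rw [h0, h0]
      simpa [P] using h1
    | succ k ih =>
      intro hk
      have hk' : k ≤ n := by omega
      have hqx := hq x hx k hk'
      have hqy := hq y hy k hk'
      have hqx' := hq x hx (k + 1) hk
      have hqy' := hq y hy (k + 1) hk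
      have h4 : dist (q x k) (q y (k + 1)) < δ := by
        have := dist_triangle (q x k) (q y k) (q y (k + 1))
        have := hdist k hk'
        have := hstep y hy k
        linarith
      have h2 := hd _ hqx _ hqx' _ hqy' (by have := hstep x hx k; linarith) h4
      have h3 := hd _ hqx _ hqy _ hqy' (by have := hdist k hk'; linarith) h4
      change _ * (d (q x k) (q x (k + 1)) * P x k) = d (q y k) (q y (k + 1)) * P y k
      rw [← mul_assoc, ← h2, h3, mul_assoc, ih hk']
  have h1 : ∀ x, q x n = x := fun x => by simp [q, div_self hn'.ne']
  have h2 := key n le_rfl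
  rw [h1, h1] at h2
  exact eq_mul_inv_of_mul_eq h2

variable {X : Type*} [TopologicalSpace X] {ι : Type*} {U : ι → Set X}
  (c : ∀ i, LocalPathCocycle (U i) G)

/-- `g` computes the local cocycles on the images of all short segments in `K`. -/
def IsPotential (f : C(E, X)) (K : Set E) (g : E → G) : Prop :=
  ∃ ε > 0, ∀ x ∈ K, ∀ y ∈ K, dist x y < ε → ∀ i, (∀ t, f (Path.segment x y t) ∈ U i) →
    (c i).toFun ((Path.segment x y).map f.continuous) = g y * (g x)⁻¹

variable {c}

/-- Below a Lebesgue number of the cover, short segments lie in a single `U i`, and agreement on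
overlaps makes the value on them independent of `i`. The default value of `d` is never met there. -/
theorem exists_isPotential (hU : ∀ i, IsOpen (U i)) (hcov : ∀ x, ∃ i, x ∈ U i)
    (hagree : ∀ i j {x y : X} (γ : Path x y), (∀ t, γ t ∈ U i) → (∀ t, γ t ∈ U j) →
      (c i).toFun γ = (c j).toFun γ)
    (f : C(E, X)) {K : Set E} (hK : Convex ℝ K) (hKc : IsCompact K) :
    ∃ g, IsPotential c f K g := by
  classical
  obtain ⟨δ, hδ, hball⟩ := lebesgue_number_lemma_of_metric (c := fun i => f ⁻¹' U i) hKc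
    (fun i => (hU i).preimage f.continuous) (fun x _ => Set.mem_iUnion.2 (hcov (f x)))
  let d : E → E → G := fun x y => if h : ∃ i, ∀ t, f (Path.segment x y t) ∈ U i then
    (c h.choose).toFun ((Path.segment x y).map f.continuous) else 1
  have hd : ∀ i x y, (∀ t, f (Path.segment x y t) ∈ U i) →
      d x y = (c i).toFun ((Path.segment x y).map f.continuous) := by
    intro i x y h
    have h' : ∃ i, ∀ t, f (Path.segment x y t) ∈ U i := ⟨i, h⟩
    simp only [d, dif_pos h']
    exact hagree _ _ _ h'.choose_spec h
  obtain ⟨g, hg⟩ := exists_potential_of_local_cocycle hK hKc.isBounded d hδ (by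
    intro x hx y _ z _ hxy hxz
    obtain ⟨i, hi⟩ := hball x hx
    have hN := convex_ball x δ
    have hxN : x ∈ Metric.ball x δ := Metric.mem_ball_self hδ
    have hyN : y ∈ Metric.ball x δ := by rwa [Metric.mem_ball, dist_comm]
    have hzN : z ∈ Metric.ball x δ := by rwa [Metric.mem_ball, dist_comm]
    have hs := fun {y z : E} (hy : y ∈ Metric.ball x δ) (hz : z ∈ Metric.ball x δ) (t : I) =>
      hi (LocalPathCocycle.segment_mem hN hy hz t)
    rw [hd i x z (hs hxN hzN), hd i y z (hs hyN hzN), hd i x y (hs hxN hyN)]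
    exact (c i).segment_mul f hN (fun w hw => hi hw) hxN hyN hzN)
  refine ⟨g, δ / 2, by positivity, fun x hx y hy hxy i hi => ?_⟩
  rw [← hg x hx y hy hxy, hd i x y hi]

/-- Two potentials have equal increments over short segments, and these are chained along the
segment from `x` to `y`. -/
theorem IsPotential.unique (hU : ∀ i, IsOpen (U i)) (hcov : ∀ x, ∃ i, x ∈ U i)
    {f : C(E, X)} {K : Set E} (hK : Convex ℝ K) (hKc : IsCompact K) {g g' : E → G}
    (hg : IsPotential c f K g) (hg' : IsPotential c f K g') {x y : E} (hx : x ∈ K) (hy : y ∈ K) :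
    g y * (g x)⁻¹ = g' y * (g' x)⁻¹ := by
  obtain ⟨δ, hδ, hball⟩ := lebesgue_number_lemma_of_metric (c := fun i => f ⁻¹' U i) hKc
    (fun i => (hU i).preimage f.continuous) (fun x _ => Set.mem_iUnion.2 (hcov (f x)))
  obtain ⟨ε, hε, h⟩ := hg
  obtain ⟨ε', hε', h'⟩ := hg'
  have hη : 0 < min δ (min ε ε') := by positivity
  obtain ⟨n, hn⟩ := exists_nat_gt (max (dist x y / min δ (min ε ε')) 0)
  have hn0 : 0 < n := by exact_mod_cast (le_max_right _ _).trans_lt hn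
  have hnD : dist x y < min δ (min ε ε') * n := by
    have := (le_max_left _ _).trans_lt hn
    rwa [div_lt_iff₀ hη, mul_comm] at this
  have hn' : (0 : ℝ) < n := by exact_mod_cast hn0
  let q : ℕ → E := fun k => AffineMap.lineMap x y ((k : ℝ) / n)
  have hq : ∀ k ≤ n, q k ∈ K := fun k hk =>
    hK.lineMap_mem hx hy ⟨by positivity, by rw [div_le_one hn']; exact_mod_cast hk⟩
  have key : ∀ k ≤ n, (g' (q k))⁻¹ * g (q k) = (g' x)⁻¹ * g x := by
    intro k
    induction k with
    | zero => simp [q]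
    | succ k ih =>
      intro hk
      have hk' : k ≤ n := by omega
      have hdist : dist (q k) (q (k + 1)) < min δ (min ε ε') :=
        exists_nat_dist_lineMap_lt le_rfl hnD hn0 k
      obtain ⟨i, hi⟩ := hball _ (hq k hk')
      have hseg : ∀ t, f (Path.segment (q k) (q (k + 1)) t) ∈ U i := fun t =>
        hi (LocalPathCocycle.segment_mem (convex_ball _ _) (Metric.mem_ball_self hδ)
          (by rw [Metric.mem_ball, dist_comm]; exact hdist.trans_le (min_le_left _ _)) t)
      have h1 := h _ (hq k hk') _ (hq _ hk)
        (hdist.trans_le ((min_le_right _ _).trans (min_le_left _ _))) i hseg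
      have h2 := h' _ (hq k hk') _ (hq _ hk)
        (hdist.trans_le ((min_le_right _ _).trans (min_le_right _ _))) i hseg
      rw [h1, mul_inv_eq_iff_eq_mul] at h2
      rw [← ih hk', h2]
      group
  have h1 : q n = y := by simp [q, div_self hn'.ne']
  have h2 := key n le_rfl
  rw [h1, inv_mul_eq_iff_eq_mul] at h2
  rw [h2]
  group

theorem IsPotential.congr {f f' : C(E, X)} {K : Set E} (hK : Convex ℝ K) (h : Set.EqOn f f' K)
    {g : E → G} (hg : IsPotential c f K g) : IsPotential c f' K g := by
  obtain ⟨ε, hε, hg⟩ := hg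
  refine ⟨ε, hε, fun x hx y hy hxy i hi => ?_⟩
  have hs : ∀ t, f (Path.segment x y t) = f' (Path.segment x y t) := fun t =>
    h (LocalPathCocycle.segment_mem hK hx hy t)
  rw [← hg x hx y hy hxy i (fun t => by rw [hs]; exact hi t)]
  exact Path.apply_congr (c i).toFun fun t => (hs t).symm

theorem IsPotential.comp_lineMap {f : C(E, X)} {K : Set E} (hK : Convex ℝ K)
    {g : E → G} (hg : IsPotential c f K g) {a b : E} (ha : a ∈ K) (hb : b ∈ K) {f' : C(ℝ, X)}
    (hf' : ∀ t ∈ Set.Icc (0 : ℝ) 1, f (AffineMap.lineMap a b t) = f' t) :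
    IsPotential c f' (Set.Icc 0 1) (fun t => g (AffineMap.lineMap a b t)) := by
  refine IsPotential.congr (f := f.comp ⟨_, AffineMap.lineMap_continuous (p := a) (q := b)⟩)
    (convex_Icc 0 1) hf' ?_
  obtain ⟨ε, hε, hg⟩ := hg
  -- The affine map stretches distances by `dist a b`; the added `1` covers the case `a = b`.
  refine ⟨ε / (dist a b + 1), by positivity, fun x hx y hy hxy i hi => ?_⟩
  have hs : ∀ t, (AffineMap.lineMap a b (Path.segment x y t) : E) =
      Path.segment (AffineMap.lineMap a b x) (AffineMap.lineMap a b y) t := by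
    intro t
    simp only [Path.segment_apply, AffineMap.lineMap_apply_module]
    module
  rw [← hg _ (hK.lineMap_mem ha hb hx) _ (hK.lineMap_mem ha hb hy) ?_ i
    (fun t => by rw [← hs]; exact hi t)]
  · refine Path.apply_congr (c i).toFun fun t => ?_
    exact congrArg f (hs t)
  · rw [dist_lineMap_lineMap]
    rw [lt_div_iff₀ (by positivity)] at hxy
    nlinarith [dist_nonneg (x := x) (y := y)]

/-- A path, extended to the real line. -/
noncomputable def Path.extendC {x y : X} (γ : Path x y) : C(ℝ, X) := ⟨γ.extend, γ.continuous_extend⟩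

/-- Van Kampen's theorem for cocycles: the value on a path is the increment over `[0,1]` of any
potential for it. A potential of a concatenation restricts to both halves. A potential of a homotopy
on the square restricts to the four sides, two of which are constant paths. -/
theorem exists_pathCocycle (hU : ∀ i, IsOpen (U i)) (hcov : ∀ x, ∃ i, x ∈ U i)
    (hagree : ∀ i j {x y : X} (γ : Path x y), (∀ t, γ t ∈ U i) → (∀ t, γ t ∈ U j) →
      (c i).toFun γ = (c j).toFun γ) :
    ∃ Φ : PathCocycle X G, ∀ i {x y : X} (γ : Path x y), (∀ t, γ t ∈ U i) →
      Φ.toFun γ = (c i).toFun γ := by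
  have hI : Convex ℝ (Set.Icc (0 : ℝ) 1) := convex_Icc 0 1
  have hIc : IsCompact (Set.Icc (0 : ℝ) 1) := isCompact_Icc
  have h0 : (0 : ℝ) ∈ Set.Icc (0 : ℝ) 1 := by simp
  have h1 : (1 : ℝ) ∈ Set.Icc (0 : ℝ) 1 := by simp
  choose! g hg using fun f : C(ℝ, X) => exists_isPotential hU hcov hagree f hI hIc
  let Φ : ∀ {x y : X}, Path x y → G := fun γ => g γ.extendC 1 * (g γ.extendC 0)⁻¹
  have hΦ : ∀ {x y : X} (γ : Path x y) (g' : ℝ → G), IsPotential c γ.extendC (Set.Icc 0 1) g' →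
      Φ γ = g' 1 * (g' 0)⁻¹ := fun γ g' hg' =>
    IsPotential.unique hU hcov hI hIc (hg _) hg' h0 h1
  have htrans : ∀ {x y z : X} (γ : Path x y) (γ' : Path y z), Φ (γ.trans γ') = Φ γ' * Φ γ := by
    intro x y z γ γ'
    have hγ := hg (γ.trans γ').extendC
    have hhalf : (1 / 2 : ℝ) ∈ Set.Icc (0 : ℝ) 1 := by constructor <;> norm_num
    have e1 := hΦ γ _ (hγ.comp_lineMap hI h0 hhalf (f' := γ.extendC) (by
      intro t ht
      change (γ.trans γ').extend _ = γ.extend t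
      have : (AffineMap.lineMap (0 : ℝ) (1 / 2) t : ℝ) = t / 2 := by
        simp [AffineMap.lineMap_apply_module]; ring
      rw [this, Path.extend_apply _ (⟨by linarith [ht.1], by linarith [ht.2]⟩ : t / 2 ∈ Set.Icc (0 : ℝ) 1),
        Path.extend_apply _ ht, Path.trans_apply, dif_pos (by simpa using by linarith [ht.2])]
      congr 2
      ring))
    have e2 := hΦ γ' _ (hγ.comp_lineMap hI hhalf h1 (f' := γ'.extendC) (by
      intro t ht
      change (γ.trans γ').extend _ = γ'.extend t
      have : (AffineMap.lineMap (1 / 2 : ℝ) 1 t : ℝ) = (t + 1) / 2 := by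
        simp [AffineMap.lineMap_apply_module]; ring
      rw [this]
      have hmem : (t + 1) / 2 ∈ Set.Icc (0 : ℝ) 1 := ⟨by linarith [ht.1], by linarith [ht.2]⟩
      rw [Path.extend_apply _ hmem, Path.extend_apply _ ht, Path.trans_apply]
      split_ifs with h
      · have ht0 : t = 0 := le_antisymm (by simpa using by linarith [show (t+1)/2 ≤ 1/2 from h]) ht.1
        subst ht0
        simp
      · congr 2
        ring))
    rw [e1, e2]
    simp only [AffineMap.lineMap_apply_zero, AffineMap.lineMap_apply_one]
    change g _ 1 * (g _ 0)⁻¹ = _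
    group
  have hrefl : ∀ x : X, Φ (Path.refl x) = 1 := by
    intro x
    have := htrans (Path.refl x) (Path.refl x)
    rw [Path.refl_trans_refl] at this
    exact mul_eq_left.1 this.symm
  refine ⟨⟨Φ, htrans, ?_⟩, ?_⟩
  · rintro x y γ γ' ⟨F⟩
    let f : C(ℝ × ℝ, X) :=
      ⟨fun z => F (Set.projIcc 0 1 zero_le_one z.1, Set.projIcc 0 1 zero_le_one z.2), by
        have := continuous_projIcc (a := (0 : ℝ)) (b := 1) (h := zero_le_one)
        exact F.continuous.comp ((this.comp continuous_fst).prodMk (this.comp continuous_snd))⟩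
    have hK : Convex ℝ (Set.Icc (0 : ℝ) 1 ×ˢ Set.Icc (0 : ℝ) 1) := hI.prod hI
    obtain ⟨G', hG⟩ := exists_isPotential hU hcov hagree f hK (hIc.prod hIc)
    have h00 : ((0 : ℝ), (0 : ℝ)) ∈ Set.Icc (0 : ℝ) 1 ×ˢ Set.Icc (0 : ℝ) 1 := ⟨h0, h0⟩
    have h01 : ((0 : ℝ), (1 : ℝ)) ∈ Set.Icc (0 : ℝ) 1 ×ˢ Set.Icc (0 : ℝ) 1 := ⟨h0, h1⟩
    have h10 : ((1 : ℝ), (0 : ℝ)) ∈ Set.Icc (0 : ℝ) 1 ×ˢ Set.Icc (0 : ℝ) 1 := ⟨h1, h0⟩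
    have h11 : ((1 : ℝ), (1 : ℝ)) ∈ Set.Icc (0 : ℝ) 1 ×ˢ Set.Icc (0 : ℝ) 1 := ⟨h1, h1⟩
    have e0 := hΦ γ _ (hG.comp_lineMap hK h00 h01 (f' := γ.extendC) (by
      intro t ht
      change F _ = γ.extend t
      rw [Path.extend_apply _ ht]
      simp [AffineMap.lineMap_apply_module, Set.projIcc_of_mem zero_le_one ht]))
    have e1 := hΦ γ' _ (hG.comp_lineMap hK h10 h11 (f' := γ'.extendC) (by
      intro t ht
      change F _ = γ'.extend t
      rw [Path.extend_apply _ ht]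
      simp [AffineMap.lineMap_apply_module, Set.projIcc_of_mem zero_le_one ht]))
    have e2 := hΦ (Path.refl x) _ (hG.comp_lineMap hK h00 h10 (f' := (Path.refl x).extendC) (by
      intro t ht
      change F _ = (Path.refl x).extend t
      rw [Path.extend_apply _ ht]
      simp [AffineMap.lineMap_apply_module]))
    have e3 := hΦ (Path.refl y) _ (hG.comp_lineMap hK h01 h11 (f' := (Path.refl y).extendC) (by
      intro t ht
      change F _ = (Path.refl y).extend t
      rw [Path.extend_apply _ ht]
      simp [AffineMap.lineMap_apply_module]))
    simp only [AffineMap.lineMap_apply_zero, AffineMap.lineMap_apply_one, hrefl] at e0 e1 e2 e3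
    rw [e0, e1, mul_inv_eq_one.1 e2.symm, mul_inv_eq_one.1 e3.symm]
  · intro i x y γ hγ
    have hN : ∀ s ∈ (Set.univ : Set ℝ), γ.extendC s ∈ U i := fun s _ => hγ _
    -- Inside `U i`, the local cocycle on segments starting at `0` is itself a potential.
    have hpot : IsPotential c γ.extendC (Set.Icc 0 1)
        (fun t => (c i).toFun ((Path.segment 0 t).map γ.extendC.continuous)) := by
      refine ⟨1, one_pos, fun s _ t _ _ j hj => ?_⟩
      rw [hagree j i ((Path.segment s t).map γ.extendC.continuous) hj (fun r => hγ _)]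
      simp only
      rw [(c i).segment_mul γ.extendC convex_univ hN
        (x := 0) (y := s) (z := t) trivial trivial trivial, mul_inv_cancel_right]
    change Φ γ = _
    rw [hΦ γ _ hpot, Path.segment_same]
    have e1 : (c i).toFun ((Path.refl (0 : ℝ)).map γ.extendC.continuous) = 1 := (c i).refl (hγ _)
    rw [e1, inv_one, mul_one]
    refine Path.apply_congr (c i).toFun fun t => ?_
    change γ.extend (Path.segment 0 1 t) = γ t
    simp [AffineMap.lineMap_apply_module]

end Potential

/-! ### Operations on cocycles -/

namespace PathCocycle

variable {X Y : Type*} [TopologicalSpace X] [TopologicalSpace Y] {G : Type*} [Group G]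

theorem congr (c : PathCocycle X G) {x y x' y' : X} {γ : Path x y} {γ' : Path x' y'}
    (h : ∀ t, γ t = γ' t) : c.toFun γ = c.toFun γ' :=
  Path.apply_congr c.toFun h

theorem refl (c : PathCocycle X G) (x : X) : c.toFun (Path.refl x) = 1 := by
  have := c.trans (Path.refl x) (Path.refl x)
  rw [Path.refl_trans_refl] at this
  exact mul_eq_left.1 this.symm

theorem symm (c : PathCocycle X G) {x y : X} (γ : Path x y) : c.toFun γ.symm = (c.toFun γ)⁻¹ := by
  rw [eq_inv_iff_mul_eq_one, ← c.trans, ← c.refl x]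
  exact c.homotopic _ _ ⟨(Path.Homotopy.reflTransSymm γ).symm⟩

/-- The pullback of a cocycle along a continuous map. -/
def comap (c : PathCocycle Y G) (f : C(X, Y)) : PathCocycle X G where
  toFun γ := c.toFun (γ.map f.continuous)
  trans γ γ' := by rw [Path.map_trans, c.trans]
  homotopic γ γ' h := c.homotopic _ _ (h.map f)

/-- The composition of a cocycle with a homomorphism. -/
def mapHom {H : Type*} [Group H] (c : PathCocycle X G) (φ : G →* H) : PathCocycle X H where
  toFun γ := φ (c.toFun γ)
  trans γ γ' := by rw [c.trans, map_mul]
  homotopic γ γ' h := by rw [c.homotopic _ _ h]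

/-- The homomorphism from the fundamental group defined by a cocycle. -/
noncomputable def hom (c : PathCocycle X G) (x : X) : FundamentalGroup X x →* G :=
  MonoidHom.mk' (fun q => Quotient.lift c.toFun c.homotopic q) (by
    intro p q
    induction p using Path.Homotopic.Quotient.ind with | mk p
    induction q using Path.Homotopic.Quotient.ind with | mk q
    exact c.trans q p)

theorem hom_mk (c : PathCocycle X G) {x : X} (γ : Path x x) :
    c.hom x (FundamentalGroup.fromPath (Path.Homotopic.Quotient.mk γ)) = c.toFun γ := rfl

theorem hom_comap (c : PathCocycle Y G) (f : C(X, Y)) (x : X) :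
    (c.comap f).hom x = (c.hom (f x)).comp (FundamentalGroup.map f x) := by
  ext q
  induction q using Path.Homotopic.Quotient.ind with | mk q
  rfl

/-- The square is contractible, so the two ways around its boundary are homotopic. -/
theorem square (c : PathCocycle X G) (F : C(I × I, X)) {x₀₀ x₁₀ x₀₁ x₁₁ : X} (b : Path x₀₀ x₁₀)
    (t : Path x₀₁ x₁₁) (l : Path x₀₀ x₀₁) (r : Path x₁₀ x₁₁) (hb : ∀ s, F (s, 0) = b s)
    (ht : ∀ s, F (s, 1) = t s) (hl : ∀ s, F (0, s) = l s) (hr : ∀ s, F (1, s) = r s) :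
    c.toFun r * c.toFun b = c.toFun t * c.toFun l := by
  let idI : Path (0 : I) 1 := ⟨ContinuousMap.id I, rfl, rfl⟩
  let pb : Path ((0 : I), (0 : I)) (1, 0) := idI.prod (Path.refl 0)
  let pt : Path ((0 : I), (1 : I)) (1, 1) := idI.prod (Path.refl 1)
  let pl : Path ((0 : I), (0 : I)) (0, 1) := (Path.refl 0).prod idI
  let pr : Path ((1 : I), (0 : I)) (1, 1) := (Path.refl 1).prod idI
  have eb : c.toFun b = (c.comap F).toFun pb := c.congr fun s => (hb s).symm
  have et : c.toFun t = (c.comap F).toFun pt := c.congr fun s => (ht s).symm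
  have el : c.toFun l = (c.comap F).toFun pl := c.congr fun s => (hl s).symm
  have er : c.toFun r = (c.comap F).toFun pr := c.congr fun s => (hr s).symm
  rw [eb, et, el, er, ← (c.comap F).trans, ← (c.comap F).trans]
  have : ContractibleSpace I := (convex_Icc 0 1).contractibleSpace ⟨0, by simp⟩
  exact (c.comap F).homotopic _ _ (SimplyConnectedSpace.paths_homotopic _ _)

section Base

open CategoryTheory

variable (z : X)

/-- A chosen class of paths from the base point, trivial at the base point itself. -/
noncomputable def connection {x : X} (h : Joined z x) :
    FundamentalGroupoid.mk z ⟶ FundamentalGroupoid.mk x :=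
  Groupoid.inv (show FundamentalGroupoid.mk z ⟶ FundamentalGroupoid.mk z from
    Path.Homotopic.Quotient.mk (Joined.refl z).somePath) ≫
    (show FundamentalGroupoid.mk z ⟶ FundamentalGroupoid.mk x from
      Path.Homotopic.Quotient.mk h.somePath)

theorem connection_self (h : Joined z z) : connection z h = 𝟙 _ := Groupoid.inv_comp _

/-- The class of a path as a morphism of the fundamental groupoid. -/
abbrev arrow {x y : X} (γ : Path x y) : FundamentalGroupoid.mk x ⟶ FundamentalGroupoid.mk y :=
  Path.Homotopic.Quotient.mk γ

theorem arrow_trans {x y z : X} (γ : Path x y) (γ' : Path y z) :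
    arrow (γ.trans γ') = arrow γ ≫ arrow γ' := rfl

open Classical in
/-- The cocycle that closes up paths by means of chosen paths from the base point, and is trivial
outside its path component. -/
noncomputable def base : PathCocycle X (FundamentalGroup X z) where
  toFun {x y} γ := if h : Joined z x then
    (connection z h ≫ arrow γ ≫ Groupoid.inv (connection z (h.trans ⟨γ⟩)) :
      FundamentalGroupoid.mk z ⟶ FundamentalGroupoid.mk z) else 1
  trans {x y y'} γ γ' := by
    by_cases h : Joined z x
    · have h' : Joined z y := h.trans ⟨γ⟩
      rw [dif_pos h, dif_pos h, dif_pos h', End.mul_def, arrow_trans]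
      simp
    · have h' : ¬ Joined z y := fun h' => h (h'.trans ⟨γ.symm⟩)
      rw [dif_neg h, dif_neg h, dif_neg h', one_mul]
  homotopic γ γ' h := by
    have : arrow γ = arrow γ' := Path.Homotopic.Quotient.eq.2 h
    simp only [this]

theorem base_hom_self : (base z).hom z = MonoidHom.id _ := by
  ext q
  induction q using Path.Homotopic.Quotient.ind with | mk q
  change (base z).toFun q = _
  have h : Joined z z := Joined.refl z
  simp only [base]
  rw [dif_pos h]
  change connection z h ≫ arrow q ≫ Groupoid.inv (connection z _) = arrow q
  rw [connection_self z, Category.id_comp]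
  simp

theorem base_hom_bijective {x : X} (h : Joined z x) : Function.Bijective ((base z).hom x) := by
  have key : ∀ q : FundamentalGroup X x, (base z).hom x q =
      (connection z h ≫ (show FundamentalGroupoid.mk x ⟶ FundamentalGroupoid.mk x from q) ≫
        Groupoid.inv (connection z h) : FundamentalGroupoid.mk z ⟶ FundamentalGroupoid.mk z) := by
    intro q
    induction q using Path.Homotopic.Quotient.ind with | mk q
    change (base z).toFun q = _
    simp only [base]
    rw [dif_pos h]
  constructor
  · intro q q' hqq
    rw [key, key] at hqq
    have := congrArg (fun r : FundamentalGroupoid.mk z ⟶ FundamentalGroupoid.mk z =>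
      Groupoid.inv (connection z h) ≫ r ≫ connection z h) hqq
    simpa using this
  · intro r
    refine ⟨(Groupoid.inv (connection z h) ≫
      (show FundamentalGroupoid.mk z ⟶ FundamentalGroupoid.mk z from r) ≫ connection z h :
        FundamentalGroupoid.mk x ⟶ FundamentalGroupoid.mk x), ?_⟩
    rw [key]
    simp

/-- The homomorphism is the induced map followed by a change of base point, an isomorphism, which
preserves closedness. -/
theorem base_hom_range_map [PathConnectedSpace Y] (y₀ : Y) (f : C(X, Y)) (x : X) {p : ℕ}
    (h : IsRFRpClosed p (FundamentalGroup.map f x).range) :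
    IsRFRpClosed p (((base y₀).comap f).hom x).range := by
  rw [hom_comap, MonoidHom.range_comp]
  exact h.map_mulEquiv (MulEquiv.ofBijective _
    (base_hom_bijective y₀ (PathConnectedSpace.joined y₀ (f x))))

end Base

section Sigma

variable {V : Type*} {Z : V → Type*} [∀ a, TopologicalSpace (Z a)] {G : Type*} [Group G]

open Classical in
/-- The retraction of a disjoint union onto the piece containing `q` that is constant on the other
pieces. -/
noncomputable def sigmaRetraction (q : Σ a, Z a) : C(Σ a, Z a, Z q.1) where
  toFun r := if h : r.1 = q.1 then h ▸ r.2 else q.2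
  continuous_toFun := by
    refine continuous_sigma fun a => ?_
    obtain ⟨b, y⟩ := q
    by_cases h : a = b
    · subst h
      simp only [dite_true]
      exact continuous_id
    · simpa [h] using continuous_const

theorem sigmaRetraction_mk (a : V) (x y : Z a) : sigmaRetraction ⟨a, x⟩ ⟨a, y⟩ = y := by
  simp [sigmaRetraction]

/-- The index of the piece is locally constant, hence constant along a path. -/
theorem exists_sigma_lift {x y : Σ a, Z a} (γ : Path x y) :
    ∃ (a : V) (x' y' : Z a) (γ' : Path x' y'), x = ⟨a, x'⟩ ∧ y = ⟨a, y'⟩ ∧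
      ∀ t, γ t = ⟨a, γ' t⟩ := by
  have hfst : ∀ t, (γ t).1 = x.1 := by
    have h1 : IsLocallyConstant (Sigma.fst : (Σ a, Z a) → V) :=
      IsLocallyConstant.iff_exists_open _ |>.2 fun q =>
        ⟨Set.range (Sigma.mk q.1), isOpen_range_sigmaMk, ⟨q.2, rfl⟩, by rintro _ ⟨y, rfl⟩; rfl⟩
    intro t
    have := (h1.comp_continuous γ.continuous).apply_eq_of_preconnectedSpace t 0
    simpa using this
  have key : ∀ r : Σ a, Z a, r.1 = x.1 → r = ⟨x.1, sigmaRetraction x r⟩ := by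
    obtain ⟨a, x⟩ := x
    rintro ⟨b, r⟩ rfl
    rw [sigmaRetraction_mk]
  refine ⟨x.1, _, _, γ.map (sigmaRetraction x).continuous, key x rfl, key y ?_, fun t => ?_⟩
  · simpa using hfst 1
  · exact key _ (hfst t)

theorem sigmaRetraction_congr (c : ∀ a, PathCocycle (Z a) G) {x y : Σ a, Z a} (γ : Path x y) {a : V}
    {x' y' : Z a} (γ' : Path x' y') (h : ∀ t, γ t = ⟨a, γ' t⟩) :
    (c x.1).toFun (γ.map (sigmaRetraction x).continuous) = (c a).toFun γ' := by
  obtain rfl : x = ⟨a, x'⟩ := by simpa using h 0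
  refine (c a).congr fun t => ?_
  rw [Path.map_coe, Function.comp_apply, h t, sigmaRetraction_mk]

/-- The cocycle on a disjoint union given by cocycles on the pieces. -/
noncomputable def sigma (c : ∀ a, PathCocycle (Z a) G) : PathCocycle (Σ a, Z a) G where
  toFun {x y} γ := (c x.1).toFun (γ.map (sigmaRetraction x).continuous)
  trans {x y z} γ γ' := by
    obtain ⟨a, x', y', δ, rfl, rfl, h⟩ := exists_sigma_lift γ
    obtain ⟨b, y'', z', δ', h1, rfl, h'⟩ := exists_sigma_lift γ'
    obtain ⟨rfl, h1⟩ := Sigma.mk.inj_iff.1 h1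
    obtain rfl := eq_of_heq h1
    rw [sigmaRetraction_congr c γ δ h, sigmaRetraction_congr c γ' δ' h', ← (c a).trans]
    refine sigmaRetraction_congr c _ _ fun t => ?_
    rw [Path.trans_apply, Path.trans_apply]
    split_ifs
    · exact h _
    · exact h' _
  homotopic γ γ' h := (c _).homotopic _ _ (h.map _)

theorem sigma_eq (c : ∀ a, PathCocycle (Z a) G) {x y : Σ a, Z a} (γ : Path x y) {a : V}
    {x' y' : Z a} (γ' : Path x' y') (h : ∀ t, γ t = ⟨a, γ' t⟩) :
    (sigma c).toFun γ = (c a).toFun γ' :=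
  sigmaRetraction_congr c γ γ' h

end Sigma

end PathCocycle

/-- `μ x` is the value of the cocycle on a representative of the connection from the base point to
`x`. -/
theorem PathCocycle.exists_hom_base {Y M : Type*} [TopologicalSpace Y] [PathConnectedSpace Y]
    [Group M] (c : PathCocycle Y M) (z : Y) : ∃ μ : Y → M, ∀ {x y : Y} (γ : Path x y),
      c.hom z ((PathCocycle.base z).toFun γ) = (μ y)⁻¹ * c.toFun γ * μ x := by
  have h : ∀ x, Joined z x := PathConnectedSpace.joined z
  choose p hp using fun x => Path.Homotopic.Quotient.mk_surjective (PathCocycle.connection z (h x))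
  refine ⟨fun x => c.toFun (p x), fun {x y} γ => ?_⟩
  have : (PathCocycle.base z).toFun γ = FundamentalGroup.fromPath
      (Path.Homotopic.Quotient.mk ((p x).trans (γ.trans (p y).symm))) := by
    simp only [PathCocycle.base]
    rw [dif_pos (h x), ← hp x, ← hp y]
    rfl
  rw [this, PathCocycle.hom_mk, c.trans, c.trans, c.symm]

namespace LocalPathCocycle

variable {X Y : Type*} [TopologicalSpace X] [TopologicalSpace Y] {G : Type*} [Group G] {U : Set X}

open Classical in
/-- The pullback of a cocycle along a map that is continuous on `U`. -/
noncomputable def ofContinuousOn (c : PathCocycle Y G) {f : X → Y} (hf : ContinuousOn f U) :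
    LocalPathCocycle U G where
  toFun γ := if h : ∀ t, γ t ∈ U then
    c.toFun (γ.map' (hf.mono (Set.range_subset_iff.2 h))) else 1
  trans γ γ' h h' := by
    have h'' : ∀ t, γ.trans γ' t ∈ U := by
      intro t
      rw [Path.trans_apply]
      split_ifs
      · exact h _
      · exact h' _
    rw [dif_pos h, dif_pos h', dif_pos h'', ← c.trans]
    refine c.congr fun t => ?_
    simp only [Path.map', Path.coe_mk_mk, Function.comp_apply, Path.trans_apply]
    split_ifs <;> rfl
  homotopic γ γ' F h := by
    have h0 : ∀ t, γ t ∈ U := fun t => by simpa using h (0, t)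
    have h1 : ∀ t, γ' t ∈ U := fun t => by simpa using h (1, t)
    rw [dif_pos h0, dif_pos h1]
    refine c.homotopic _ _ ⟨⟨⟨⟨fun z => f (F z), hf.comp_continuous F.continuous h⟩, ?_, ?_⟩, ?_⟩⟩
    · intro t; simp [Path.map']
    · intro t; simp [Path.map']
    · rintro t s (rfl | rfl) <;> simp [Path.map']

theorem ofContinuousOn_toFun (c : PathCocycle Y G) {f : X → Y} (hf : ContinuousOn f U) {x y : X}
    (γ : Path x y) (h : ∀ t, γ t ∈ U) {x' y' : Y} (δ : Path x' y') (hδ : ∀ t, f (γ t) = δ t) :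
    (ofContinuousOn c hf).toFun γ = c.toFun δ := by
  simp only [ofContinuousOn]
  rw [dif_pos h]
  exact c.congr hδ

/-- The cohomologous local cocycle obtained from a function on the points. -/
def twist (c : LocalPathCocycle U G) (κ : X → G) : LocalPathCocycle U G where
  toFun {x y} γ := κ y * c.toFun γ * (κ x)⁻¹
  trans γ γ' h h' := by rw [c.trans γ γ' h h']; group
  homotopic γ γ' F h := by rw [c.homotopic _ _ F h]

end LocalPathCocycle

namespace GraphOfSpaces

variable {V : Type u} {E : Type v} (𝒳 : GraphOfSpaces.{u, v, w, x} V E)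

/-! ### The topology of the total space -/

/-- The point of the total space over an edge. -/
def edgeMap (e : E) : C(𝒳.edgeSpace e × I, 𝒳.Total) where
  toFun z := Quot.mk _ (Sum.inr ⟨e, z⟩)
  continuous_toFun := continuous_quot_mk.comp (continuous_inr.comp continuous_sigmaMk)

/-- The map from the disjoint union of the vertex spaces to the total space. -/
def verticesMap : C(Σ a, 𝒳.vertexSpace a, 𝒳.Total) where
  toFun z := Quot.mk _ (Sum.inl z)
  continuous_toFun := continuous_quot_mk.comp continuous_inl

variable {𝒳}

theorem edgeMap_zero (e : E) (y : 𝒳.edgeSpace e) :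
    𝒳.edgeMap e (y, 0) = 𝒳.verticesMap ⟨𝒳.src e, 𝒳.srcMap e y⟩ := Quot.sound (.src e y)

theorem edgeMap_one (e : E) (y : 𝒳.edgeSpace e) :
    𝒳.edgeMap e (y, 1) = 𝒳.verticesMap ⟨𝒳.tgt e, 𝒳.tgtMap e y⟩ := Quot.sound (.tgt e y)

theorem total_cases (z : 𝒳.Total) :
    (∃ p, z = 𝒳.verticesMap p) ∨ ∃ e y s, z = 𝒳.edgeMap e (y, s) := by
  induction z using Quot.ind with | mk z
  rcases z with p | ⟨e, y, s⟩
  · exact Or.inl ⟨p, rfl⟩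
  · exact Or.inr ⟨e, y, s, rfl⟩

/-- Over an open set the gluing map is still a quotient map, so continuity can be tested on the
pieces. -/
theorem continuousOn_total {Z : Type*} [TopologicalSpace Z] {f : 𝒳.Total → Z} {U : Set 𝒳.Total}
    (hU : IsOpen U) (hv : Continuous (f ∘ 𝒳.verticesMap))
    (he : ∀ e y s, 𝒳.edgeMap e (y, s) ∈ U → ContinuousAt (f ∘ 𝒳.edgeMap e) (y, s)) :
    ContinuousOn f U := by
  rw [isQuotientMap_quot_mk.continuousOn_isOpen_iff hU]
  rintro (p | ⟨e, y, s⟩) hz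
  · refine ContinuousAt.continuousWithinAt ?_
    exact Topology.IsOpenEmbedding.inl.continuousAt_iff.1 hv.continuousAt
  · refine ContinuousAt.continuousWithinAt ?_
    refine (Topology.IsOpenEmbedding.inr.comp
      Topology.IsOpenEmbedding.sigmaMk).continuousAt_iff.1 ?_
    exact he e y s hz

section Side

variable (𝒳) (χ : I → Prop) (h0 : ¬ χ 0) (h1 : χ 1)

open Classical in
/-- The map pushing a point of an edge to one of its two ends, as prescribed by `χ`. -/
noncomputable def endMap : 𝒳.Total → Σ a, 𝒳.vertexSpace a :=
  Quot.lift (Sum.elim id fun z => if χ z.2.2 then ⟨𝒳.tgt z.1, 𝒳.tgtMap z.1 z.2.1⟩ else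
    ⟨𝒳.src z.1, 𝒳.srcMap z.1 z.2.1⟩) (by
      rintro _ _ (⟨e, y⟩ | ⟨e, y⟩)
      · simp [h0]
      · simp [h1])

theorem endMap_edgeMap_of_not {e : E} {y : 𝒳.edgeSpace e} {s : I} (h : ¬ χ s) :
    𝒳.endMap χ h0 h1 (𝒳.edgeMap e (y, s)) = ⟨𝒳.src e, 𝒳.srcMap e y⟩ := if_neg h

theorem endMap_edgeMap_of_pos {e : E} {y : 𝒳.edgeSpace e} {s : I} (h : χ s) :
    𝒳.endMap χ h0 h1 (𝒳.edgeMap e (y, s)) = ⟨𝒳.tgt e, 𝒳.tgtMap e y⟩ := if_pos h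

open Classical in
/-- The path pushing a point of an edge to one of its two ends, as prescribed by `χ`. -/
noncomputable def pushPath : 𝒳.Total → C(I, 𝒳.Total) :=
  Quot.lift (Sum.elim (fun p => ContinuousMap.const I (𝒳.verticesMap p)) fun z =>
    if χ z.2.2 then
      (𝒳.edgeMap z.1).comp ⟨fun u => (z.2.1, σ (σ z.2.2 * σ u)), by fun_prop⟩
    else (𝒳.edgeMap z.1).comp ⟨fun u => (z.2.1, z.2.2 * σ u), by fun_prop⟩) (by
      rintro _ _ (⟨e, y⟩ | ⟨e, y⟩)
      · ext u
        simpa [h0] using edgeMap_zero e y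
      · ext u
        simpa [h1] using edgeMap_one e y)

theorem pushPath_edgeMap_of_not {e : E} {y : 𝒳.edgeSpace e} {s : I} (h : ¬ χ s) (u : I) :
    𝒳.pushPath χ h0 h1 (𝒳.edgeMap e (y, s)) u = 𝒳.edgeMap e (y, s * σ u) :=
  DFunLike.congr_fun (if_neg h) u

theorem pushPath_edgeMap_of_pos {e : E} {y : 𝒳.edgeSpace e} {s : I} (h : χ s) (u : I) :
    𝒳.pushPath χ h0 h1 (𝒳.edgeMap e (y, s)) u = 𝒳.edgeMap e (y, σ (σ s * σ u)) :=
  DFunLike.congr_fun (if_pos h) u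

theorem pushPath_zero (z : 𝒳.Total) : 𝒳.pushPath χ h0 h1 z 0 = z := by
  obtain ⟨p, rfl⟩ | ⟨e, y, s, rfl⟩ := total_cases z
  · rfl
  · by_cases h : χ s
    · rw [pushPath_edgeMap_of_pos _ _ _ _ h]; simp
    · rw [pushPath_edgeMap_of_not _ _ _ _ h]; simp

theorem pushPath_one (z : 𝒳.Total) :
    𝒳.pushPath χ h0 h1 z 1 = 𝒳.verticesMap (𝒳.endMap χ h0 h1 z) := by
  obtain ⟨p, rfl⟩ | ⟨e, y, s, rfl⟩ := total_cases z
  · rfl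
  · by_cases h : χ s
    · rw [pushPath_edgeMap_of_pos _ _ _ _ h, endMap_edgeMap_of_pos _ _ _ _ h, ← edgeMap_one]; simp
    · rw [pushPath_edgeMap_of_not _ _ _ _ h, endMap_edgeMap_of_not _ _ _ _ h, ← edgeMap_zero]; simp

/-- `pushPath` as a path. -/
noncomputable def push (z : 𝒳.Total) : Path z (𝒳.verticesMap (𝒳.endMap χ h0 h1 z)) where
  toContinuousMap := 𝒳.pushPath χ h0 h1 z
  source' := 𝒳.pushPath_zero χ h0 h1 z
  target' := 𝒳.pushPath_one χ h0 h1 z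

variable {U : Set 𝒳.Total} (hU : IsOpen U) (hχ : ∀ e y s, 𝒳.edgeMap e (y, s) ∈ U →
  ∀ᶠ r in nhds s, (χ r ↔ χ s))

include hU hχ

/-- On `U` the choice of the end is locally constant along the edges. This serves for `farHalf` away
from the middles and for `· = 1` away from the vertex spaces. -/
theorem continuousOn_endMap : ContinuousOn (𝒳.endMap χ h0 h1) U := by
  refine continuousOn_total hU continuous_id fun e y s hs => ?_
  have hev : ∀ᶠ z : 𝒳.edgeSpace e × I in nhds (y, s), (χ z.2 ↔ χ s) :=
    (continuous_snd.tendsto (y, s)).eventually (hχ e y s hs)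
  by_cases h : χ s
  · refine ContinuousAt.congr (f := fun z : 𝒳.edgeSpace e × I =>
      (⟨𝒳.tgt e, 𝒳.tgtMap e z.1⟩ : Σ a, 𝒳.vertexSpace a)) ?_ ?_
    · exact (continuous_sigmaMk.comp ((𝒳.tgtMap e).continuous.comp continuous_fst)).continuousAt
    · filter_upwards [hev] with z hz
      exact (endMap_edgeMap_of_pos _ _ _ _ (hz.2 h)).symm
  · refine ContinuousAt.congr (f := fun z : 𝒳.edgeSpace e × I =>
      (⟨𝒳.src e, 𝒳.srcMap e z.1⟩ : Σ a, 𝒳.vertexSpace a)) ?_ ?_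
    · exact (continuous_sigmaMk.comp ((𝒳.srcMap e).continuous.comp continuous_fst)).continuousAt
    · filter_upwards [hev] with z hz
      exact (endMap_edgeMap_of_not _ _ _ _ (fun h' => h (hz.1 h'))).symm

theorem continuousOn_pushPath : ContinuousOn (𝒳.pushPath χ h0 h1) U := by
  refine continuousOn_total hU ?_ fun e y s hs => ?_
  · exact ContinuousMap.continuous_of_continuous_uncurry _
      (𝒳.verticesMap.continuous.comp continuous_fst)
  have hev : ∀ᶠ z : 𝒳.edgeSpace e × I in nhds (y, s), (χ z.2 ↔ χ s) :=
    (continuous_snd.tendsto (y, s)).eventually (hχ e y s hs)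
  by_cases h : χ s
  · let F : C((𝒳.edgeSpace e × I) × I, 𝒳.Total) :=
      (𝒳.edgeMap e).comp ⟨fun z => (z.1.1, σ (σ z.1.2 * σ z.2)), by fun_prop⟩
    refine ContinuousAt.congr F.curry.continuous.continuousAt ?_
    filter_upwards [hev] with z hz
    ext u
    exact (pushPath_edgeMap_of_pos _ _ _ _ (hz.2 h) u).symm
  · let F : C((𝒳.edgeSpace e × I) × I, 𝒳.Total) :=
      (𝒳.edgeMap e).comp ⟨fun z => (z.1.1, z.1.2 * σ z.2), by fun_prop⟩
    refine ContinuousAt.congr F.curry.continuous.continuousAt ?_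
    filter_upwards [hev] with z hz
    ext u
    exact (pushPath_edgeMap_of_not _ _ _ _ (fun h' => h (hz.1 h')) u).symm

/-- A cocycle is transported by the paths `push` to the ends of the edges. -/
theorem push_square {M : Type*} [Group M] (Ξ : PathCocycle 𝒳.Total M) {z z' : 𝒳.Total}
    (γ : Path z z') (hγ : ∀ t, γ t ∈ U)
    (δ : Path (𝒳.endMap χ h0 h1 z) (𝒳.endMap χ h0 h1 z'))
    (hδ : ∀ t, 𝒳.endMap χ h0 h1 (γ t) = δ t) :
    Ξ.toFun (𝒳.push χ h0 h1 z') * Ξ.toFun γ =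
      (Ξ.comap 𝒳.verticesMap).toFun δ * Ξ.toFun (𝒳.push χ h0 h1 z) := by
  -- The pushes of the points of `γ` sweep out a square whose sides are `γ`, its image under
  -- `endMap` and the pushes of its end points.
  have hc : Continuous fun t => 𝒳.pushPath χ h0 h1 (γ t) :=
    (𝒳.continuousOn_pushPath χ h0 h1 hU hχ).comp_continuous γ.continuous hγ
  refine Ξ.square (ContinuousMap.uncurry ⟨_, hc⟩) γ (δ.map 𝒳.verticesMap.continuous) _ _
    (fun s => ?_) (fun s => ?_) (fun s => ?_) fun s => ?_
  · exact 𝒳.pushPath_zero χ h0 h1 _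
  · exact (𝒳.pushPath_one χ h0 h1 _).trans (congrArg 𝒳.verticesMap (hδ s))
  · change 𝒳.pushPath χ h0 h1 (γ 0) s = 𝒳.pushPath χ h0 h1 z s
    rw [γ.source]
  · change 𝒳.pushPath χ h0 h1 (γ 1) s = 𝒳.pushPath χ h0 h1 z' s
    rw [γ.target]

end Side

/-! ### A cover of the total space by two open sets -/

section Cover

variable (𝒳)

/-- A function that vanishes on the vertex spaces and is maximal in the middle of the edges. -/
noncomputable def height : 𝒳.Total → ℝ :=
  Quot.lift (Sum.elim (fun _ => 0) fun z => (z.2.2 : ℝ) * (1 - z.2.2)) (by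
    rintro _ _ (⟨e, y⟩ | ⟨e, y⟩) <;> simp)

theorem continuous_height : Continuous 𝒳.height := by
  refine continuous_quot_lift _ (Continuous.sumElim continuous_const ?_)
  refine continuous_sigma fun e => ?_
  have h : Continuous fun z : 𝒳.edgeSpace e × I => (z.2 : ℝ) :=
    continuous_subtype_val.comp continuous_snd
  exact h.mul (continuous_const.sub h)

/-- The complement of the middles of the edges. -/
def nearVertices : Set 𝒳.Total := {z | 𝒳.height z < 1 / 4}

/-- The complement of the vertex spaces. -/
def insideEdges : Set 𝒳.Total := {z | 0 < 𝒳.height z}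

theorem isOpen_nearVertices : IsOpen 𝒳.nearVertices :=
  isOpen_lt 𝒳.continuous_height continuous_const

theorem isOpen_insideEdges : IsOpen 𝒳.insideEdges :=
  isOpen_lt continuous_const 𝒳.continuous_height

theorem mem_nearVertices_or (z : 𝒳.Total) : z ∈ 𝒳.nearVertices ∨ z ∈ 𝒳.insideEdges := by
  rcases lt_or_ge (𝒳.height z) (1 / 4) with h | h
  · exact Or.inl h
  · exact Or.inr (lt_of_lt_of_le (by norm_num) h)

theorem edgeMap_mem_nearVertices {e : E} {y : 𝒳.edgeSpace e} {s : I} :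
    𝒳.edgeMap e (y, s) ∈ 𝒳.nearVertices ↔ (s : ℝ) ≠ 1 / 2 := by
  change (s : ℝ) * (1 - s) < 1 / 4 ↔ _
  constructor
  · intro h hs
    rw [hs] at h
    norm_num at h
  · intro h
    have := sq_pos_of_ne_zero (sub_ne_zero.2 h)
    nlinarith

theorem edgeMap_mem_insideEdges {e : E} {y : 𝒳.edgeSpace e} {s : I} :
    𝒳.edgeMap e (y, s) ∈ 𝒳.insideEdges ↔ s ≠ 0 ∧ s ≠ 1 := by
  change 0 < (s : ℝ) * (1 - s) ↔ _
  constructor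
  · intro h
    constructor <;> rintro rfl <;> simp at h
  · rintro ⟨h0, h1⟩
    exact mul_pos (unitInterval.pos_iff_ne_zero.2 h0)
      (sub_pos.2 (unitInterval.lt_one_iff_ne_one.2 h1))

theorem exists_eq_edgeMap_of_mem {z : 𝒳.Total} (hz : z ∈ 𝒳.insideEdges) :
    ∃ e y s, z = 𝒳.edgeMap e (y, s) := by
  obtain ⟨p, rfl⟩ | h := total_cases z
  · exact (lt_irrefl (0 : ℝ) hz).elim
  · exact h

/-- The side of an edge on which a point lies. -/
def farHalf (s : I) : Prop := (1 / 2 : ℝ) < s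

theorem not_farHalf_zero : ¬ farHalf 0 := by simp [farHalf]

theorem farHalf_one : farHalf 1 := by simp only [farHalf, Set.Icc.coe_one]; norm_num

theorem eventually_farHalf (e : E) (y : 𝒳.edgeSpace e) (s : I)
    (h : 𝒳.edgeMap e (y, s) ∈ 𝒳.nearVertices) : ∀ᶠ r in nhds s, (farHalf r ↔ farHalf s) := by
  rw [edgeMap_mem_nearVertices] at h
  rcases lt_or_gt_of_ne h with h | h
  · filter_upwards [continuous_subtype_val.continuousAt.eventually (gt_mem_nhds h)] with r hr
    exact iff_of_false (not_lt.2 (le_of_lt hr)) (not_lt.2 h.le)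
  · filter_upwards [continuous_subtype_val.continuousAt.eventually (lt_mem_nhds h)] with r hr
    exact iff_of_true hr h

theorem eventually_eq_one (e : E) (y : 𝒳.edgeSpace e) (s : I)
    (h : 𝒳.edgeMap e (y, s) ∈ 𝒳.insideEdges) : ∀ᶠ r in nhds s, (r = 1 ↔ s = 1) := by
  have h1 := (𝒳.edgeMap_mem_insideEdges.1 h).2
  filter_upwards [isOpen_ne.mem_nhds h1] with r hr
  exact iff_of_false hr h1

open Classical in
/-- A map inverse to `edgeMap` on the insides of the edges. -/
noncomputable def toEdges (d : Σ e, 𝒳.edgeSpace e × I) : 𝒳.Total → Σ e, 𝒳.edgeSpace e × I :=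
  Quot.lift (Sum.elim (fun _ => d) fun z => if z.2.2 = 0 ∨ z.2.2 = 1 then d else z) (by
    rintro _ _ (⟨e, y⟩ | ⟨e, y⟩) <;> simp)

theorem toEdges_edgeMap (d : Σ e, 𝒳.edgeSpace e × I) {e : E} {y : 𝒳.edgeSpace e} {s : I}
    (h : 𝒳.edgeMap e (y, s) ∈ 𝒳.insideEdges) :
    𝒳.toEdges d (𝒳.edgeMap e (y, s)) = ⟨e, (y, s)⟩ :=
  if_neg (not_or.2 (𝒳.edgeMap_mem_insideEdges.1 h))

theorem continuousOn_toEdges (d : Σ e, 𝒳.edgeSpace e × I) :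
    ContinuousOn (𝒳.toEdges d) 𝒳.insideEdges := by
  refine continuousOn_total 𝒳.isOpen_insideEdges continuous_const fun e y s hs => ?_
  refine ContinuousAt.congr (f := Sigma.mk e) continuous_sigmaMk.continuousAt ?_
  filter_upwards [(𝒳.isOpen_insideEdges.preimage (𝒳.edgeMap e).continuous).mem_nhds hs] with z hz
  exact (𝒳.toEdges_edgeMap d hz).symm

/-- Inside the edges `edgeMap` has the continuous inverse `toEdges`, so a path there stays over one
edge and splits into two coordinates. -/
theorem exists_edge_lift {z z' : 𝒳.Total} (γ : Path z z') (hγ : ∀ t, γ t ∈ 𝒳.insideEdges) :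
    ∃ (e : E) (y y' : 𝒳.edgeSpace e) (s s' : I) (δ : Path y y') (r : Path s s'),
      z = 𝒳.edgeMap e (y, s) ∧ z' = 𝒳.edgeMap e (y', s') ∧ ∀ t, γ t = 𝒳.edgeMap e (δ t, r t) := by
  obtain ⟨e₀, y₀, s₀, -⟩ := 𝒳.exists_eq_edgeMap_of_mem (hγ 0)
  let d : Σ e, 𝒳.edgeSpace e × I := ⟨e₀, (y₀, s₀)⟩
  obtain ⟨e, p, p', δ, -, -, h⟩ := PathCocycle.exists_sigma_lift
    (γ.map' ((𝒳.continuousOn_toEdges d).mono (Set.range_subset_iff.2 hγ)))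
  have key : ∀ t, γ t = 𝒳.edgeMap e (δ t) := by
    intro t
    have h1 : 𝒳.toEdges d (γ t) = ⟨e, δ t⟩ := h t
    obtain ⟨e', y, s, hz⟩ := 𝒳.exists_eq_edgeMap_of_mem (hγ t)
    have h2 := hγ t
    rw [hz] at h2
    rw [hz, 𝒳.toEdges_edgeMap d h2] at h1
    rw [hz]
    obtain ⟨rfl, h3⟩ := Sigma.mk.inj_iff.1 h1
    rw [eq_of_heq h3]
  refine ⟨e, p.1, p'.1, p.2, p'.2, δ.map continuous_fst, δ.map continuous_snd, ?_, ?_, key⟩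
  · simpa using key 0
  · simpa using key 1

end Cover

end GraphOfSpaces

/-! ### Gluing and induction for a cover by two open sets. -/

theorem exists_pathCocycle_of_union {X : Type*} [TopologicalSpace X] {G : Type*} [Group G]
    {A B : Set X} (hA : IsOpen A) (hB : IsOpen B) (hcov : ∀ x, x ∈ A ∨ x ∈ B)
    (cA : LocalPathCocycle A G) (cB : LocalPathCocycle B G)
    (hagree : ∀ {x y : X} (γ : Path x y), (∀ t, γ t ∈ A) → (∀ t, γ t ∈ B) →
      cA.toFun γ = cB.toFun γ) :
    ∃ Φ : PathCocycle X G, (∀ {x y : X} (γ : Path x y), (∀ t, γ t ∈ A) →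
      Φ.toFun γ = cA.toFun γ) ∧ ∀ {x y : X} (γ : Path x y), (∀ t, γ t ∈ B) →
      Φ.toFun γ = cB.toFun γ := by
  obtain ⟨Φ, hΦ⟩ := exists_pathCocycle (U := fun b : Bool => cond b A B)
    (c := fun b => match b with
      | true => cA
      | false => cB)
    (by rintro (_ | _); exacts [hB, hA])
    (fun x => (hcov x).elim (fun h => ⟨true, h⟩) fun h => ⟨false, h⟩)
    (by
      rintro (_ | _) (_ | _) x y γ h h'
      exacts [rfl, (hagree γ h' h).symm, hagree γ h h', rfl])
  exact ⟨Φ, fun γ => hΦ true γ, fun γ => hΦ false γ⟩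

theorem Path.induction_on_union {X : Type*} [TopologicalSpace X] {A B : Set X} (hA : IsOpen A)
    (hB : IsOpen B) (hcov : ∀ x, x ∈ A ∨ x ∈ B) {P : ∀ {x y : X}, Path x y → Prop}
    (htrans : ∀ {x y z : X} (γ : Path x y) (γ' : Path y z), P γ → P γ' → P (γ.trans γ'))
    (hhom : ∀ {x y : X} (γ γ' : Path x y), γ.Homotopic γ' → P γ → P γ')
    (hPA : ∀ {x y : X} (γ : Path x y), (∀ t, γ t ∈ A) → P γ)
    (hPB : ∀ {x y : X} (γ : Path x y), (∀ t, γ t ∈ B) → P γ) {x y : X} (γ : Path x y) :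
    P γ :=
  Path.induction_on_cover (U := fun b : Bool => cond b A B)
    (by rintro (_ | _); exacts [hB, hA])
    (fun x => (hcov x).elim (fun h => ⟨true, h⟩) fun h => ⟨false, h⟩) (P := P) htrans hhom
    (by
      rintro (_ | _) x y γ h
      exacts [hPB γ h, hPA γ h]) γ

theorem PathCocycle.map_interval {X G : Type*} [TopologicalSpace X] [Group G]
    (c : PathCocycle X G) (f : C(I, X)) {s t : I} (γ γ' : Path s t) :
    c.toFun (γ.map f.continuous) = c.toFun (γ'.map f.continuous) := by
  have : ContractibleSpace I := (convex_Icc 0 1).contractibleSpace ⟨0, by simp⟩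
  exact (c.comap f).homotopic _ _ (SimplyConnectedSpace.paths_homotopic _ _)

/-! ### The cocycle on the total space with values in the path group. -/

namespace GraphOfSpaces

theorem forall_farHalf_or {s s' : I} (r : Path s s') (h : ∀ t, (r t : ℝ) ≠ 1 / 2) :
    (∀ t, farHalf (r t)) ∨ ∀ t, ¬ farHalf (r t) := by
  by_contra! h'
  obtain ⟨⟨t, ht⟩, t', ht'⟩ := h'
  have hc : Continuous fun t => (r t : ℝ) := continuous_subtype_val.comp r.continuous
  obtain ⟨t'', h''⟩ := mem_range_of_exists_le_of_exists_ge hc ⟨t, not_lt.1 ht⟩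
    ⟨t', le_of_lt ht'⟩
  exact h t'' h''

variable {V : Type u} {E : Type v} (𝒳 : GraphOfSpaces.{u, v, w, x} V E)

/-- The end of the half of an edge in which a point lies. -/
noncomputable abbrev near : 𝒳.Total → Σ a, 𝒳.vertexSpace a :=
  𝒳.endMap farHalf not_farHalf_zero farHalf_one

/-- The source of the edge in which a point lies. -/
noncomputable abbrev back : 𝒳.Total → Σ a, 𝒳.vertexSpace a :=
  𝒳.endMap (· = 1) zero_ne_one rfl

variable {𝒳} in
theorem near_of_pos {e : E} {y : 𝒳.edgeSpace e} {s : I} (h : farHalf s) :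
    𝒳.near (𝒳.edgeMap e (y, s)) = ⟨𝒳.tgt e, 𝒳.tgtMap e y⟩ := if_pos h

variable {𝒳} in
theorem near_of_not {e : E} {y : 𝒳.edgeSpace e} {s : I} (h : ¬ farHalf s) :
    𝒳.near (𝒳.edgeMap e (y, s)) = ⟨𝒳.src e, 𝒳.srcMap e y⟩ := if_neg h

variable {𝒳} in
theorem back_edgeMap {e : E} {y : 𝒳.edgeSpace e} {s : I} (h : s ≠ 1) :
    𝒳.back (𝒳.edgeMap e (y, s)) = ⟨𝒳.src e, 𝒳.srcMap e y⟩ := if_neg h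

theorem continuousOn_near : ContinuousOn 𝒳.near 𝒳.nearVertices :=
  𝒳.continuousOn_endMap _ _ _ 𝒳.isOpen_nearVertices 𝒳.eventually_farHalf

theorem continuousOn_back : ContinuousOn 𝒳.back 𝒳.insideEdges :=
  𝒳.continuousOn_endMap _ _ _ 𝒳.isOpen_insideEdges 𝒳.eventually_eq_one

variable [∀ a, PathConnectedSpace (𝒳.vertexSpace a)] [∀ e, PathConnectedSpace (𝒳.edgeSpace e)]

/-- A base point of a vertex space. -/
noncomputable def vertexPoint (a : V) : 𝒳.vertexSpace a := Classical.arbitrary _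

/-- A base point of an edge space. -/
noncomputable def edgePoint (e : E) : 𝒳.edgeSpace e := Classical.arbitrary _

/-- The graph of groups formed by the fundamental groups of a graph of spaces. -/
noncomputable def graphOfGroups : GraphOfGroups.{u, v, w, x} V E where
  src := 𝒳.src
  tgt := 𝒳.tgt
  vertexGroup a := FundamentalGroup (𝒳.vertexSpace a) (𝒳.vertexPoint a)
  edgeGroup e := FundamentalGroup (𝒳.edgeSpace e) (𝒳.edgePoint e)
  srcHom e := ((PathCocycle.base (𝒳.vertexPoint (𝒳.src e))).comap (𝒳.srcMap e)).hom
    (𝒳.edgePoint e)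
  tgtHom e := ((PathCocycle.base (𝒳.vertexPoint (𝒳.tgt e))).comap (𝒳.tgtMap e)).hom
    (𝒳.edgePoint e)

/-- The paths in a vertex space as elements of the group `F` of the graph of groups. -/
noncomputable def vertexCocycle (a : V) :
    PathCocycle (𝒳.vertexSpace a) 𝒳.graphOfGroups.PathGroup :=
  (PathCocycle.base (𝒳.vertexPoint a)).mapHom (𝒳.graphOfGroups.ofVertex a)

/-- The image in `F` of the fundamental group of an edge space under the map to the source. -/
noncomputable def srcCocycle (e : E) : PathCocycle (𝒳.edgeSpace e) 𝒳.graphOfGroups.PathGroup :=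
  (𝒳.vertexCocycle (𝒳.src e)).comap (𝒳.srcMap e)

/-- The image in `F` of the fundamental group of an edge space under the map to the target. -/
noncomputable def tgtCocycle (e : E) : PathCocycle (𝒳.edgeSpace e) 𝒳.graphOfGroups.PathGroup :=
  (𝒳.vertexCocycle (𝒳.tgt e)).comap (𝒳.tgtMap e)

/-- The element of `F` given by the segment over a point of an edge space. -/
noncomputable def crossing (e : E) (y : 𝒳.edgeSpace e) : 𝒳.graphOfGroups.PathGroup :=
  -- Cocycles reverse the order of multiplication. Read from the right: back to the base point in
  -- the source, across the edge, then out again in the target. The crossing from source to target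
  -- therefore appears as the inverse of the edge.
  (𝒳.tgtCocycle e).toFun (PathConnectedSpace.somePath (𝒳.edgePoint e) y) *
    (𝒳.graphOfGroups.ofEdge e)⁻¹ *
    ((𝒳.srcCocycle e).toFun (PathConnectedSpace.somePath (𝒳.edgePoint e) y))⁻¹

/-- Closing `γ` up to a loop at the base point of the edge space reduces this to the edge relation.
-/
theorem crossing_mul (e : E) {y y' : 𝒳.edgeSpace e} (γ : Path y y') :
    𝒳.crossing e y' * (𝒳.srcCocycle e).toFun γ = (𝒳.tgtCocycle e).toFun γ * 𝒳.crossing e y := by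
  let l := PathConnectedSpace.somePath (𝒳.edgePoint e) y
  let l' := PathConnectedSpace.somePath (𝒳.edgePoint e) y'
  have h : 𝒳.graphOfGroups.ofEdge e *
      (𝒳.tgtCocycle e).toFun (l.trans (γ.trans l'.symm)) * (𝒳.graphOfGroups.ofEdge e)⁻¹ =
      (𝒳.srcCocycle e).toFun (l.trans (γ.trans l'.symm)) :=
    𝒳.graphOfGroups.ofEdge_conj e
      (FundamentalGroup.fromPath (Path.Homotopic.Quotient.mk (l.trans (γ.trans l'.symm))))
  simp only [PathCocycle.trans, PathCocycle.symm] at h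
  simp only [crossing]
  change _ * _ * ((𝒳.srcCocycle e).toFun l')⁻¹ * _ = _ * ((𝒳.tgtCocycle e).toFun l * _ * _)
  change (𝒳.tgtCocycle e).toFun l' * _ * _ * _ = _ * (_ * _ * ((𝒳.srcCocycle e).toFun l)⁻¹)
  generalize (𝒳.graphOfGroups.ofEdge e) = t at *
  generalize (𝒳.tgtCocycle e).toFun l' = a' at *
  generalize (𝒳.srcCocycle e).toFun l' = b' at *
  generalize (𝒳.tgtCocycle e).toFun l = a at *
  generalize (𝒳.srcCocycle e).toFun l = b at *
  generalize (𝒳.tgtCocycle e).toFun γ = g at *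
  generalize (𝒳.srcCocycle e).toFun γ = k at *
  have h2 : k = b' * (t * (a'⁻¹ * g * a) * t⁻¹) * b⁻¹ := by rw [h]; group
  rw [h2]
  group

theorem isPath_vertexCocycle (a : V) {x y : 𝒳.vertexSpace a} (γ : Path x y) :
    𝒳.graphOfGroups.IsPath a a ((𝒳.vertexCocycle a).toFun γ) := by
  have h := (GraphOfGroups.IsPath.nil (𝒢 := 𝒳.graphOfGroups) a).vertex
    ((PathCocycle.base (𝒳.vertexPoint a)).toFun γ)
  rwa [one_mul] at h

theorem isPath_crossing (e : E) (y : 𝒳.edgeSpace e) :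
    𝒳.graphOfGroups.IsPath (𝒳.tgt e) (𝒳.src e) (𝒳.crossing e y) := by
  have h := (GraphOfGroups.IsPath.nil (𝒢 := 𝒳.graphOfGroups) (𝒳.tgt e)).edgeInv e
  rw [one_mul] at h
  exact ((𝒳.isPath_vertexCocycle (𝒳.tgt e) _).mul h).mul (𝒳.isPath_vertexCocycle (𝒳.src e) _).inv

/-- The paths in the disjoint union of the vertex spaces as elements of `F`. -/
noncomputable def verticesCocycle :
    PathCocycle (Σ a, 𝒳.vertexSpace a) 𝒳.graphOfGroups.PathGroup :=
  PathCocycle.sigma 𝒳.vertexCocycle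

theorem isPath_verticesCocycle {p q : Σ a, 𝒳.vertexSpace a} (γ : Path p q) :
    𝒳.graphOfGroups.IsPath q.1 p.1 (𝒳.verticesCocycle.toFun γ) := by
  obtain ⟨a, x, y, δ, rfl, rfl, h⟩ := PathCocycle.exists_sigma_lift γ
  rw [verticesCocycle, PathCocycle.sigma_eq _ γ δ h]
  exact 𝒳.isPath_vertexCocycle a δ

/-- The crossing of the part of an edge behind its middle. -/
noncomputable def correction : 𝒳.Total → 𝒳.graphOfGroups.PathGroup :=
  open Classical in
  Quot.lift (Sum.elim (fun _ => 1) fun z => if farHalf z.2.2 ∧ z.2.2 ≠ 1 then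
    𝒳.crossing z.1 z.2.1 else 1) (by
      rintro _ _ (⟨e, y⟩ | ⟨e, y⟩)
      · simp [not_farHalf_zero]
      · simp)

variable {𝒳}

theorem correction_of_not {e : E} {y : 𝒳.edgeSpace e} {s : I} (h : ¬ farHalf s) :
    𝒳.correction (𝒳.edgeMap e (y, s)) = 1 := if_neg fun h' => h h'.1

theorem correction_of_pos {e : E} {y : 𝒳.edgeSpace e} {s : I} (h : farHalf s) (h1 : s ≠ 1) :
    𝒳.correction (𝒳.edgeMap e (y, s)) = 𝒳.crossing e y := if_pos ⟨h, h1⟩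

variable (𝒳)

theorem isPath_correction {z : 𝒳.Total} (hz : z ∈ 𝒳.insideEdges) :
    𝒳.graphOfGroups.IsPath (𝒳.near z).1 (𝒳.back z).1 (𝒳.correction z) := by
  obtain ⟨e, y, s, rfl⟩ := 𝒳.exists_eq_edgeMap_of_mem hz
  have h1 := (𝒳.edgeMap_mem_insideEdges.1 hz).2
  rw [back_edgeMap h1]
  by_cases h : farHalf s
  · rw [near_of_pos h, correction_of_pos h h1]
    exact 𝒳.isPath_crossing e y
  · rw [near_of_not h, correction_of_not h]
    exact .nil _

/-- Away from the middles, points are pushed to the nearer end; inside the edges, all are pushed to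
the source. On the overlap the two differ only in the far halves, by the crossing, and the twist by
`correction` makes them agree according to `crossing_mul`. -/
theorem exists_cocycle : ∃ Φ : PathCocycle 𝒳.Total 𝒳.graphOfGroups.PathGroup,
    (∀ {z z' : 𝒳.Total} (γ : Path z z') (hγ : ∀ t, γ t ∈ 𝒳.nearVertices),
      Φ.toFun γ = 𝒳.verticesCocycle.toFun
        (γ.map' (𝒳.continuousOn_near.mono (Set.range_subset_iff.2 hγ)))) ∧
    ∀ {z z' : 𝒳.Total} (γ : Path z z') (hγ : ∀ t, γ t ∈ 𝒳.insideEdges),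
      Φ.toFun γ = 𝒳.correction z' * 𝒳.verticesCocycle.toFun
        (γ.map' (𝒳.continuousOn_back.mono (Set.range_subset_iff.2 hγ))) * (𝒳.correction z)⁻¹ := by
  obtain ⟨Φ, hA, hB⟩ := exists_pathCocycle_of_union 𝒳.isOpen_nearVertices 𝒳.isOpen_insideEdges
    𝒳.mem_nearVertices_or (.ofContinuousOn 𝒳.verticesCocycle 𝒳.continuousOn_near)
    ((LocalPathCocycle.ofContinuousOn 𝒳.verticesCocycle 𝒳.continuousOn_back).twist 𝒳.correction)
    (by
      intro z z' γ hγA hγB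
      obtain ⟨e, y, y', s, s', δ, r, rfl, rfl, h⟩ := 𝒳.exists_edge_lift γ hγB
      have hr1 : ∀ t, r t ≠ 1 := fun t => by
        have := hγB t
        rw [h t] at this
        exact (𝒳.edgeMap_mem_insideEdges.1 this).2
      have hback : ∀ t, 𝒳.back (γ t) = ⟨𝒳.src e, 𝒳.srcMap e (δ t)⟩ := fun t => by
        rw [h t, back_edgeMap (hr1 t)]
      let ps : Path (X := Σ a, 𝒳.vertexSpace a) _ _ :=
        (δ.map (𝒳.srcMap e).continuous).map continuous_sigmaMk
      let pt : Path (X := Σ a, 𝒳.vertexSpace a) _ _ :=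
        (δ.map (𝒳.tgtMap e).continuous).map continuous_sigmaMk
      have es : 𝒳.verticesCocycle.toFun ps = (𝒳.srcCocycle e).toFun δ :=
        PathCocycle.sigma_eq 𝒳.vertexCocycle ps (δ.map (𝒳.srcMap e).continuous) fun _ => rfl
      have et : 𝒳.verticesCocycle.toFun pt = (𝒳.tgtCocycle e).toFun δ :=
        PathCocycle.sigma_eq 𝒳.vertexCocycle pt (δ.map (𝒳.tgtMap e).continuous) fun _ => rfl
      -- A path in the overlap avoids the middle and so remains in one half of its edge.
      have hs := forall_farHalf_or r fun t => by
        have := hγA t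
        rw [h t] at this
        exact 𝒳.edgeMap_mem_nearVertices.1 this
      simp only [LocalPathCocycle.twist]
      rw [LocalPathCocycle.ofContinuousOn_toFun _ _ _ hγB ps hback, es]
      have hs1 : s ≠ 1 := by simpa using hr1 0
      have hs1' : s' ≠ 1 := by simpa using hr1 1
      rcases hs with hs | hs
      · rw [LocalPathCocycle.ofContinuousOn_toFun _ _ _ hγA pt, et, correction_of_pos _ hs1,
          correction_of_pos _ hs1', eq_mul_inv_iff_mul_eq, crossing_mul]
        · simpa using hs 1
        · simpa using hs 0
        · intro t
          rw [h t, near_of_pos (hs t)]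
          rfl
      · rw [LocalPathCocycle.ofContinuousOn_toFun _ _ _ hγA ps, es, correction_of_not,
          correction_of_not, one_mul, inv_one, mul_one]
        · simpa using hs 0
        · simpa using hs 1
        · intro t
          rw [h t, near_of_not (hs t)]
          rfl)
  refine ⟨Φ, fun γ hγ => ?_, fun γ hγ => ?_⟩
  · rw [hA γ hγ]
    exact LocalPathCocycle.ofContinuousOn_toFun _ _ _ hγ _ fun _ => rfl
  · rw [hB γ hγ]
    simp only [LocalPathCocycle.twist]
    rw [LocalPathCocycle.ofContinuousOn_toFun 𝒳.verticesCocycle 𝒳.continuousOn_back γ hγ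
      (γ.map' (𝒳.continuousOn_back.mono (Set.range_subset_iff.2 hγ))) fun _ => rfl]

/-- The cocycle with values in the group `F` of the graph of groups. -/
noncomputable def totalCocycle : PathCocycle 𝒳.Total 𝒳.graphOfGroups.PathGroup :=
  𝒳.exists_cocycle.choose

/-- The type of the word runs from the end of the path to its beginning because multiplication is
reversed. For loops this places the values among closed edge paths. -/
theorem isPath_totalCocycle {z z' : 𝒳.Total} (γ : Path z z') :
    𝒳.graphOfGroups.IsPath (𝒳.near z').1 (𝒳.near z).1 (𝒳.totalCocycle.toFun γ) := by
  refine Path.induction_on_union 𝒳.isOpen_nearVertices 𝒳.isOpen_insideEdges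
    𝒳.mem_nearVertices_or (P := fun {z z'} γ =>
      𝒳.graphOfGroups.IsPath (𝒳.near z').1 (𝒳.near z).1 (𝒳.totalCocycle.toFun γ))
    ?_ ?_ ?_ ?_ γ
  · intro _ _ _ γ γ' h h'
    rw [PathCocycle.trans]
    exact h'.mul h
  · intro _ _ γ γ' h h'
    rwa [← 𝒳.totalCocycle.homotopic _ _ h]
  · intro _ _ γ hγ
    rw [totalCocycle, 𝒳.exists_cocycle.choose_spec.1 γ hγ]
    exact 𝒳.isPath_verticesCocycle _
  · intro z z' γ hγ
    rw [totalCocycle, 𝒳.exists_cocycle.choose_spec.2 γ hγ]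
    refine ((𝒳.isPath_correction ?_).mul (𝒳.isPath_verticesCocycle _)).mul
      (𝒳.isPath_correction ?_).inv
    · simpa using hγ 1
    · simpa using hγ 0

/-! ### The homomorphism from the path group defined by a cocycle on the total space. -/

section Realize

variable {V : Type u} {E : Type v} (𝒳 : GraphOfSpaces.{u, v, w, x} V E)
  {M : Type*} [Group M] (Ξ : PathCocycle 𝒳.Total M)

/-- The segment over a point of an edge space. -/
def segment (e : E) (y : 𝒳.edgeSpace e) : Path (𝒳.verticesMap ⟨𝒳.src e, 𝒳.srcMap e y⟩)
    (𝒳.verticesMap ⟨𝒳.tgt e, 𝒳.tgtMap e y⟩) where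
  toFun t := 𝒳.edgeMap e (y, t)
  continuous_toFun := by fun_prop
  source' := edgeMap_zero e y
  target' := edgeMap_one e y

theorem segment_square (e : E) {y y' : 𝒳.edgeSpace e} (γ : Path y y') :
    Ξ.toFun (𝒳.segment e y') *
        ((Ξ.comap (𝒳.vertexMap (𝒳.src e))).comap (𝒳.srcMap e)).toFun γ =
      ((Ξ.comap (𝒳.vertexMap (𝒳.tgt e))).comap (𝒳.tgtMap e)).toFun γ *
        Ξ.toFun (𝒳.segment e y) :=
  Ξ.square ((𝒳.edgeMap e).comp ⟨fun z => (γ z.1, z.2), by fun_prop⟩)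
    ((γ.map (𝒳.srcMap e).continuous).map (𝒳.vertexMap (𝒳.src e)).continuous)
    ((γ.map (𝒳.tgtMap e).continuous).map (𝒳.vertexMap (𝒳.tgt e)).continuous) _ _
    (fun s => edgeMap_zero e (γ s)) (fun s => edgeMap_one e (γ s))
    (fun s => by
      change 𝒳.edgeMap e (γ 0, s) = 𝒳.edgeMap e (y, s)
      rw [γ.source])
    (fun s => by
      change 𝒳.edgeMap e (γ 1, s) = 𝒳.edgeMap e (y', s)
      rw [γ.target])

variable {𝒳} in
-- Pushing to the target, and pushing to the source before traversing the segment, are images of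
-- paths in an interval with the same ends.
theorem push_near_of_far {e : E} {y : 𝒳.edgeSpace e} {s : I} (h : farHalf s) (h1 : s ≠ 1) :
    Ξ.toFun (𝒳.push farHalf not_farHalf_zero farHalf_one (𝒳.edgeMap e (y, s))) =
      Ξ.toFun (𝒳.segment e y) *
        Ξ.toFun (𝒳.push (· = 1) zero_ne_one rfl (𝒳.edgeMap e (y, s))) := by
  let f : C(I, 𝒳.Total) := (𝒳.edgeMap e).comp ⟨fun t => (y, t), by fun_prop⟩
  let a : Path s 1 := ⟨⟨fun u => σ (σ s * σ u), by fun_prop⟩, by simp, by simp⟩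
  let b : Path s 0 := ⟨⟨fun u => s * σ u, by fun_prop⟩, by simp, by simp⟩
  let c : Path (0 : I) 1 := ⟨⟨fun u => u, by fun_prop⟩, rfl, rfl⟩
  have ea : Ξ.toFun (𝒳.push farHalf not_farHalf_zero farHalf_one (𝒳.edgeMap e (y, s))) =
      Ξ.toFun (a.map f.continuous) := 
    Ξ.congr fun u => 𝒳.pushPath_edgeMap_of_pos farHalf not_farHalf_zero farHalf_one h u
  have eb : Ξ.toFun (𝒳.push (· = 1) zero_ne_one rfl (𝒳.edgeMap e (y, s))) =
      Ξ.toFun (b.map f.continuous) :=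
    Ξ.congr fun u => 𝒳.pushPath_edgeMap_of_not (· = 1) zero_ne_one rfl h1 u
  have ec : Ξ.toFun (𝒳.segment e y) = Ξ.toFun (c.map f.continuous) := Ξ.congr fun u => rfl
  rw [ea, eb, ec, ← Ξ.trans, ← Path.map_trans]
  exact Ξ.map_interval f _ _

variable [∀ a, PathConnectedSpace (𝒳.vertexSpace a)]

/-- A function that expresses how the vertex homomorphisms act on arbitrary paths. -/
noncomputable def potential (p : Σ a, 𝒳.vertexSpace a) : M :=
  ((Ξ.comap (𝒳.vertexMap p.1)).exists_hom_base (𝒳.vertexPoint p.1)).choose p.2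

theorem hom_base (a : V) {x y : 𝒳.vertexSpace a} (γ : Path x y) :
    (Ξ.comap (𝒳.vertexMap a)).hom (𝒳.vertexPoint a)
        ((PathCocycle.base (𝒳.vertexPoint a)).toFun γ) =
      (𝒳.potential Ξ ⟨a, y⟩)⁻¹ * (Ξ.comap (𝒳.vertexMap a)).toFun γ * 𝒳.potential Ξ ⟨a, x⟩ :=
  ((Ξ.comap (𝒳.vertexMap a)).exists_hom_base (𝒳.vertexPoint a)).choose_spec γ

/-- The value of a cocycle on the segment over a point, after closing it up. -/
noncomputable def segmentValue (e : E) (y : 𝒳.edgeSpace e) : M :=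
  (𝒳.potential Ξ ⟨𝒳.tgt e, 𝒳.tgtMap e y⟩)⁻¹ * Ξ.toFun (𝒳.segment e y) *
    𝒳.potential Ξ ⟨𝒳.src e, 𝒳.srcMap e y⟩

theorem segmentValue_mul (e : E) {y y' : 𝒳.edgeSpace e} (γ : Path y y') :
    𝒳.segmentValue Ξ e y' * (Ξ.comap (𝒳.vertexMap (𝒳.src e))).hom (𝒳.vertexPoint (𝒳.src e))
        ((PathCocycle.base (𝒳.vertexPoint (𝒳.src e))).toFun
          (γ.map (𝒳.srcMap e).continuous)) =
      (Ξ.comap (𝒳.vertexMap (𝒳.tgt e))).hom (𝒳.vertexPoint (𝒳.tgt e))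
        ((PathCocycle.base (𝒳.vertexPoint (𝒳.tgt e))).toFun
          (γ.map (𝒳.tgtMap e).continuous)) * 𝒳.segmentValue Ξ e y := by
  have h := 𝒳.segment_square Ξ e γ
  change _ * (Ξ.comap (𝒳.vertexMap (𝒳.src e))).toFun (γ.map (𝒳.srcMap e).continuous) =
    (Ξ.comap (𝒳.vertexMap (𝒳.tgt e))).toFun (γ.map (𝒳.tgtMap e).continuous) * _ at h
  rw [hom_base, hom_base, segmentValue, segmentValue]
  simp only [mul_assoc, mul_inv_cancel_left]
  rw [← mul_assoc (Ξ.toFun _), h, mul_assoc]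

variable [∀ e, PathConnectedSpace (𝒳.edgeSpace e)]

/-- The homomorphism from `F` defined by a cocycle on the total space. -/
noncomputable def realize : 𝒳.graphOfGroups.PathGroup →* M :=
  𝒳.graphOfGroups.lift (fun a => (Ξ.comap (𝒳.vertexMap a)).hom (𝒳.vertexPoint a))
    (fun e => (𝒳.segmentValue Ξ e (𝒳.edgePoint e))⁻¹) (by
      intro e c
      induction c using Path.Homotopic.Quotient.ind with | mk γ
      have h := 𝒳.segmentValue_mul Ξ e γ
      rw [inv_inv, mul_assoc, inv_mul_eq_iff_eq_mul]
      exact h.symm)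

theorem realize_vertexCocycle (a : V) {x y : 𝒳.vertexSpace a} (γ : Path x y) :
    𝒳.realize Ξ ((𝒳.vertexCocycle a).toFun γ) =
      (Ξ.comap (𝒳.vertexMap a)).hom (𝒳.vertexPoint a)
        ((PathCocycle.base (𝒳.vertexPoint a)).toFun γ) :=
  𝒳.graphOfGroups.lift_ofVertex _ _ _ _ _

theorem realize_verticesCocycle {p q : Σ a, 𝒳.vertexSpace a} (γ : Path p q) :
    𝒳.realize Ξ (𝒳.verticesCocycle.toFun γ) =
      (𝒳.potential Ξ q)⁻¹ * (Ξ.comap 𝒳.verticesMap).toFun γ * 𝒳.potential Ξ p := by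
  obtain ⟨a, x, y, δ, rfl, rfl, h⟩ := PathCocycle.exists_sigma_lift γ
  rw [verticesCocycle, PathCocycle.sigma_eq _ γ δ h, realize_vertexCocycle, hom_base]
  congr 2
  exact Ξ.congr fun t => congrArg 𝒳.verticesMap (h t).symm

/-- True over the base point by definition of `realize`, and carried to `y` by `segmentValue_mul`
along the chosen path. -/
theorem realize_crossing (e : E) (y : 𝒳.edgeSpace e) :
    𝒳.realize Ξ (𝒳.crossing e y) = 𝒳.segmentValue Ξ e y := by
  have h : 𝒳.realize Ξ (𝒳.graphOfGroups.ofEdge e) =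
    (𝒳.segmentValue Ξ e (𝒳.edgePoint e))⁻¹ := 𝒳.graphOfGroups.lift_ofEdge _ _ _ _
  rw [crossing, map_mul, map_mul, map_inv, map_inv, h, inv_inv, mul_inv_eq_iff_eq_mul]
  change 𝒳.realize Ξ ((𝒳.vertexCocycle _).toFun _) * _ =
    _ * 𝒳.realize Ξ ((𝒳.vertexCocycle _).toFun _)
  rw [realize_vertexCocycle, realize_vertexCocycle]
  exact (𝒳.segmentValue_mul Ξ e _).symm

/-- The function relating a cocycle to its reconstruction from `F`. -/
noncomputable def gauge (z : 𝒳.Total) : M :=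
  (𝒳.potential Ξ (𝒳.near z))⁻¹ * Ξ.toFun (𝒳.push farHalf not_farHalf_zero farHalf_one z)

/-- Compares pushing to the source with pushing to the nearer end, so that a single `gauge` serves
both open sets. -/
theorem realize_correction {z : 𝒳.Total} (hz : z ∈ 𝒳.insideEdges) :
    𝒳.realize Ξ (𝒳.correction z) * (𝒳.potential Ξ (𝒳.back z))⁻¹ *
      Ξ.toFun (𝒳.push (· = 1) zero_ne_one rfl z) = 𝒳.gauge Ξ z := by
  obtain ⟨e, y, s, rfl⟩ := 𝒳.exists_eq_edgeMap_of_mem hz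
  have h1 := (𝒳.edgeMap_mem_insideEdges.1 hz).2
  rw [gauge, back_edgeMap h1]
  by_cases h : farHalf s
  · rw [correction_of_pos h h1, realize_crossing, push_near_of_far Ξ h h1, near_of_pos h,
      segmentValue]
    group
  · rw [correction_of_not h, map_one, one_mul, near_of_not h]
    congr 1
    refine Ξ.congr fun u => ?_
    exact (𝒳.pushPath_edgeMap_of_not (· = 1) zero_ne_one rfl h1 u).trans
      (𝒳.pushPath_edgeMap_of_not farHalf not_farHalf_zero farHalf_one h u).symm

/-- The cocycle rebuilt from the path group is cohomologous to `Ξ` through `gauge`. It is enough to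
check this in each open set, where it is the square given by `push_square`. -/
theorem realize_totalCocycle {z z' : 𝒳.Total} (γ : Path z z') :
    𝒳.realize Ξ (𝒳.totalCocycle.toFun γ) =
      𝒳.gauge Ξ z' * Ξ.toFun γ * (𝒳.gauge Ξ z)⁻¹ := by
  refine Path.induction_on_union 𝒳.isOpen_nearVertices 𝒳.isOpen_insideEdges
    𝒳.mem_nearVertices_or (P := fun {z z'} γ => 𝒳.realize Ξ (𝒳.totalCocycle.toFun γ) =
      𝒳.gauge Ξ z' * Ξ.toFun γ * (𝒳.gauge Ξ z)⁻¹) ?_ ?_ ?_ ?_ γ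
  · intro _ _ _ γ γ' h h'
    rw [PathCocycle.trans, map_mul, h, h', PathCocycle.trans]
    group
  · intro _ _ γ γ' h h'
    rwa [← 𝒳.totalCocycle.homotopic _ _ h, ← Ξ.homotopic _ _ h]
  · intro z z' γ hγ
    rw [totalCocycle, 𝒳.exists_cocycle.choose_spec.1 γ hγ, realize_verticesCocycle]
    have h := 𝒳.push_square farHalf not_farHalf_zero farHalf_one 𝒳.isOpen_nearVertices
      𝒳.eventually_farHalf Ξ γ hγ
      (γ.map' (𝒳.continuousOn_near.mono (Set.range_subset_iff.2 hγ))) fun _ => rfl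
    rw [eq_mul_inv_iff_mul_eq, gauge, gauge]
    simp only [mul_assoc, mul_inv_cancel_left]
    rw [h]
  · intro z z' γ hγ
    have hz : z ∈ 𝒳.insideEdges := by simpa using hγ 0
    have hz' : z' ∈ 𝒳.insideEdges := by simpa using hγ 1
    rw [totalCocycle, 𝒳.exists_cocycle.choose_spec.2 γ hγ, map_mul, map_mul, map_inv,
      realize_verticesCocycle]
    have h := 𝒳.push_square (· = 1) zero_ne_one rfl 𝒳.isOpen_insideEdges
      𝒳.eventually_eq_one Ξ γ hγ
      (γ.map' (𝒳.continuousOn_back.mono (Set.range_subset_iff.2 hγ))) fun _ => rfl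
    rw [← 𝒳.realize_correction Ξ hz, ← 𝒳.realize_correction Ξ hz', eq_mul_inv_iff_mul_eq]
    simp only [mul_assoc, mul_inv_cancel_left, inv_mul_cancel_left]
    rw [h]

end Realize

/-! ### Graphs of spaces: conclusion in the path connected case. -/

variable {V : Type u} {E : Type v} (𝒳 : GraphOfSpaces.{u, v, w, x} V E)
  [∀ a, PathConnectedSpace (𝒳.vertexSpace a)]

theorem exists_joined (z : 𝒳.Total) : ∃ a, Joined (𝒳.vertexMap a (𝒳.vertexPoint a)) z := by
  have h : Joined z (𝒳.verticesMap (𝒳.near z)) :=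
    ⟨𝒳.push farHalf not_farHalf_zero farHalf_one z⟩
  have h' : Joined (𝒳.vertexPoint (𝒳.near z).1) (𝒳.near z).2 := PathConnectedSpace.joined _ _
  exact ⟨(𝒳.near z).1, (h'.map (𝒳.vertexMap _).continuous).trans h.symm⟩

variable [∀ e, PathConnectedSpace (𝒳.edgeSpace e)]

/-- For the tautological cocycle the composite `π₁(X) → F → π₁(X)` is inner. So the first map is
injective and the second surjective, and no inverse on all of `F` is needed. -/
theorem realize_hom_totalCocycle (z : 𝒳.Total) (q : FundamentalGroup 𝒳.Total z) :
    𝒳.realize (PathCocycle.base z) (𝒳.totalCocycle.hom z q) =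
      𝒳.gauge (PathCocycle.base z) z * q * (𝒳.gauge (PathCocycle.base z) z)⁻¹ := by
  have h : (PathCocycle.base z).hom z q = q := by rw [PathCocycle.base_hom_self]; rfl
  induction q using Path.Homotopic.Quotient.ind with | mk γ
  conv_rhs => rw [← h]
  exact 𝒳.realize_totalCocycle (PathCocycle.base z) γ

theorem isRFRp_fundamentalGroup_vertexMap [Finite V] [Finite E] {p : ℕ} (hp : p.Prime)
    (hG : ∀ a (z : 𝒳.vertexSpace a), IsRFRp p (FundamentalGroup (𝒳.vertexSpace a) z))
    (htop : ∀ a (z : 𝒳.vertexSpace a),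
        InducesRFRpTopology p (FundamentalGroup.map (𝒳.vertexMap a) z))
    (hclosed : ∀ e (y : 𝒳.edgeSpace e),
        IsRFRpClosed p (FundamentalGroup.map (𝒳.srcMap e) y).range ∧
        IsRFRpClosed p (FundamentalGroup.map (𝒳.tgtMap e) y).range) (a : V) :
    IsRFRp p (FundamentalGroup 𝒳.Total (𝒳.vertexMap a (𝒳.vertexPoint a))) := by
  set z := 𝒳.vertexMap a (𝒳.vertexPoint a) with hz
  have key := 𝒳.realize_hom_totalCocycle z
  refine .of_exists_notMem ?_ fun q hq => ?_
  · have hF := 𝒳.graphOfGroups.fg_pathGroup fun b => (hG b (𝒳.vertexPoint b)).1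
    refine Group.fg_of_surjective (f := 𝒳.realize (PathCocycle.base z)) fun q => ?_
    refine ⟨𝒳.totalCocycle.hom z ((𝒳.gauge (PathCocycle.base z) z)⁻¹ * q *
      𝒳.gauge (PathCocycle.base z) z), ?_⟩
    rw [key]
    simp only [mul_assoc, mul_inv_cancel_left, mul_inv_cancel, mul_one]
  · have hne : 𝒳.totalCocycle.hom z q ≠ 1 := by
      intro h
      have h' := key q
      rw [h, map_one, eq_comm, conj_eq_one_iff] at h'
      exact hq h'
    have hpath : 𝒳.graphOfGroups.IsPath a a (𝒳.totalCocycle.hom z q) := by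
      induction q using Path.Homotopic.Quotient.ind with | mk γ
      exact 𝒳.isPath_totalCocycle γ
    -- With the base point in `X_b`, `realize` restricts on the vertex group at `b` to the map
    -- induced by `X_b → X`. Functoriality then carries the hypothesis on topologies over to `F`.
    have hF : ∀ b i, ∃ N, ∀ g, 𝒳.graphOfGroups.ofVertex b g ∈
        rfrpFiltration p 𝒳.graphOfGroups.PathGroup N →
        g ∈ rfrpFiltration p (𝒳.graphOfGroups.vertexGroup b) i := by
      intro b i
      obtain ⟨N, hN⟩ := (htop b (𝒳.vertexPoint b)).exists_mem i
      refine ⟨N, fun g hg => hN g ?_⟩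
      have h := map_mem_rfrpFiltration
        (𝒳.realize (PathCocycle.base (𝒳.vertexMap b (𝒳.vertexPoint b)))) N hg
      have h' : 𝒳.realize (PathCocycle.base (𝒳.vertexMap b (𝒳.vertexPoint b)))
          (𝒳.graphOfGroups.ofVertex b g) =
          FundamentalGroup.map (𝒳.vertexMap b) (𝒳.vertexPoint b) g := by
        refine (𝒳.graphOfGroups.lift_ofVertex _ _ _ _ _).trans ?_
        rw [PathCocycle.hom_comap, PathCocycle.base_hom_self]
        rfl
      rwa [h'] at h
    obtain ⟨i, hi⟩ := GraphOfGroups.exists_notMem_rfrpFiltration hp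
      (fun b => hG b (𝒳.vertexPoint b))
      (fun e => ⟨PathCocycle.base_hom_range_map _ _ _ (hclosed e _).1,
        PathCocycle.base_hom_range_map _ _ _ (hclosed e _).2⟩) hF hpath hne
    exact ⟨i, fun h => hi (map_mem_rfrpFiltration _ i h)⟩

end GraphOfSpaces

/-! ### Path connectedness of connected finite CW complexes, and the theorem. -/

open Topology.RelCWComplex in
theorem IsFiniteCWComplex.pathConnectedSpace {X : Type*} [TopologicalSpace X] [ConnectedSpace X]
    (h : IsFiniteCWComplex X) : PathConnectedSpace X := by
  obtain ⟨hT, hCW, -⟩ := h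
  have hcell : ∀ (n : ℕ) (j : cell (Set.univ : Set X) n), IsPathConnected (closedCell n j) :=
    fun n j => ((convex_closedBall (0 : Fin n → ℝ) 1).isPathConnected
      (Metric.nonempty_closedBall.2 zero_le_one)).image' (continuousOn n j)
  -- In the weak topology a set that contains or misses each closed cell is closed. Closed cells are
  -- path connected, so this applies to a path component and to its complement.
  have hclosed : ∀ A : Set X, (∀ n (j : cell (Set.univ : Set X) n), closedCell n j ⊆ A ∨
      Disjoint A (closedCell n j)) → IsClosed A := by
    intro A hA
    refine hCW.closed' A (Set.subset_univ _) fun n (j : cell (Set.univ : Set X) n) => ?_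
    change IsClosed (A ∩ closedCell n j)
    rcases hA n j with h | h
    · rw [Set.inter_eq_right.2 h]
      exact isClosed_closedCell
    · rw [h.inter_eq]
      exact isClosed_empty
  obtain ⟨x⟩ : Nonempty X := inferInstance
  have hx : ∀ n (j : cell (Set.univ : Set X) n), closedCell n j ⊆ pathComponent x ∨
      Disjoint (pathComponent x) (closedCell n j) := by
    intro n j
    by_cases h : Disjoint (pathComponent x) (closedCell n j)
    · exact Or.inr h
    · obtain ⟨y, hy, hy'⟩ := Set.not_disjoint_iff.1 h
      refine Or.inl ?_
      rw [← pathComponent_congr hy]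
      exact (hcell n j).subset_pathComponent hy'
  have hclopen : IsClopen (pathComponent x) := by
    refine ⟨hclosed _ hx, isClosed_compl_iff.1 (hclosed _ fun n j => ?_)⟩
    rcases hx n j with h | h
    · exact Or.inr (Set.disjoint_compl_left_iff_subset.2 h)
    · exact Or.inl (Set.disjoint_right.1 h)
  exact pathConnectedSpace_iff_eq.2 ⟨x, hclopen.eq_univ ⟨x, mem_pathComponent_self x⟩⟩

theorem theorem1p3 (p : ℕ) (hp : p.Prime) {V : Type u} {E : Type v} [Finite V] [Finite E] :
    -- graphs of groups
    (∀ 𝒢 : GraphOfGroups.{u, v, w, x} V E,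
      (∀ e, Group.FG (𝒢.edgeGroup e)) →
      (∀ a, IsRFRp p (𝒢.vertexGroup a)) →
      (∀ a, InducesRFRpTopology p (𝒢.vertexHom a)) →
      (∀ e, IsRFRpClosed p (𝒢.srcHom e).range ∧ IsRFRpClosed p (𝒢.tgtHom e).range) →
      ∀ a, IsRFRp p (𝒢.fundamentalGroup a)) ∧
    -- graphs of spaces
    (∀ 𝒳 : GraphOfSpaces.{u, v, w, x} V E,
      (∀ a, IsFiniteCWComplex (𝒳.vertexSpace a) ∧ ConnectedSpace (𝒳.vertexSpace a)) →
      (∀ e, IsFiniteCWComplex (𝒳.edgeSpace e) ∧ ConnectedSpace (𝒳.edgeSpace e)) →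
      (∀ a (z : 𝒳.vertexSpace a), IsRFRp p (FundamentalGroup (𝒳.vertexSpace a) z)) →
      (∀ a (z : 𝒳.vertexSpace a),
        InducesRFRpTopology p (FundamentalGroup.map (𝒳.vertexMap a) z)) →
      (∀ e (y : 𝒳.edgeSpace e),
        IsRFRpClosed p (FundamentalGroup.map (𝒳.srcMap e) y).range ∧
        IsRFRpClosed p (FundamentalGroup.map (𝒳.tgtMap e) y).range) →
      ∀ z : 𝒳.Total, IsRFRp p (FundamentalGroup 𝒳.Total z)) := by
  refine ⟨fun 𝒢 _ hG htop hclosed a => GraphOfGroups.isRFRp_fundamentalGroup hp hG hclosed htop a,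
    fun 𝒳 hV hE hG htop hclosed z => ?_⟩
  have : ∀ a, PathConnectedSpace (𝒳.vertexSpace a) := fun a =>
    have := (hV a).2
    (hV a).1.pathConnectedSpace
  have : ∀ e, PathConnectedSpace (𝒳.edgeSpace e) := fun e =>
    have := (hE e).2
    (hE e).1.pathConnectedSpace
  -- The total space need not be connected: the base point is moved to a vertex space in the
  -- component of `z`.
  obtain ⟨a, ⟨γ⟩⟩ := 𝒳.exists_joined z
  exact .of_mulEquiv (FundamentalGroup.fundamentalGroupMulEquivOfPath γ)
    (𝒳.isRFRp_fundamentalGroup_vertexMap hp hG htop hclosed a)
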